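/- Fix a category $\mathcal B$; $\mathit{CAT}$ is the 2-category of categories (of the same size as $\mathcal B$). **Conventions.** All 2-categories are strict, "2-functor" means strict 2-functor, and a 2-natural isomorphism is a strictly natural family of invertible 1-cells that is also compatible with 2-cells. A 2-functor $F\colon\mathcal X\to\mathcal Y$ is a *2-equivalence* if there is a 2-functor $K\colon\mathcal Y\to\mathcal X$ with 2-natural isomorphisms $KF\cong \mathrm{id}_{\mathcal X}$ and $FK\cong \mathrm{id}_{\mathcal Y}$. **Definitions.** - $\mathfrak H\mathcal B$ is the double category whose objects and horizontal arrows are the objects and arrows of $\mathcal B$ and whose only vertical arrows and cells are identities. $\mathfrak{ADJ}$ is the double category whose objects are categories, whose horizontal arrows $\mathcal A\to\mathcal A'$ are adjunctions $L\dashv R$ with $L\colon\mathcal A\to\mathcal A'$, whose vertical arrows are functors, and whose cells with top $L\dashv R$, bottom $L'\dashv R'$, left side $H$ and right side $K$ are mate pairs $(\xi,\zeta)$, with $\xi\colon L'H\Rightarrow KL$ and $\zeta\colon HR\Rightarrow R'K$ corresponding to each other under the two adjunctions. - $\mathit{BI\text{-}IND}(\mathcal B)$ is the 2-category of *bi-indexed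 categories*, that is, pseudo double functors $\Omega\colon\mathfrak H\mathcal B\to\mathfrak{ADJ}$ (with vertically invertible structure cells $\delta,\gamma$), of vertical transformations (a functor $\tau_A\colon\Omega(A)\to\Omega'(A)$ for each object and a mate pair $\tau_f$ for each arrow, natural and coherent with $\delta,\gamma$), and of modifications (a cell $\Xi_A$ with horizontal identities as top and bottom, left side $\sigma_A$ and right side $\tau_A$ for each object, compatible with the cells $\sigma_f,\tau_f$). - ${}_{\mathit{left}}\mathit{OPIND}(\mathcal B)$ is the 2-category of pseudofunctors $\Phi\colon\mathcal B\to\mathit{CAT}$ such that every direct image functor $\Phi(f)$ is a left adjoint, with lax transformations (2-cells $\Phi'(f)\tau_A\Rightarrow\tau_B\Phi(f)$ for $f\colon A\to B$) and modifications. - ${}_{\mathit{right}}\mathit{IND}(\mathcal B)$ is the 2-category of pseudofunctors $\Phi\colon\mathcal B^{op}\to\mathit{CAT}$ such that every inverse image functor $\Phi(f)$ is a right adjoint, with oplax transformations (2-cells $\tau_A\Phi(f)\Rightarrow\Phi'(f)\tau_B$ for $f\colon A\to B$) and modifications. - $\mathit{BIFIB}(\mathcal B)$ is the 2-category of bifibrations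 over $\mathcal B$ (functors $P\colon\mathcal E\to\mathcal B$ that are both fibrations and opfibrations), all functors over $\mathcal B$, and natural transformations over $\mathcal B$. - The forgetful 2-functors $U\colon\mathit{BI\text{-}IND}(\mathcal B)\to{}_{\mathit{left}}\mathit{OPIND}(\mathcal B)$ and $V\colon\mathit{BI\text{-}IND}(\mathcal B)\to{}_{\mathit{right}}\mathit{IND}(\mathcal B)$ keep the categories $\Omega(A)$ and the functors $\tau_A$, and select the left, respectively right, adjoints and the corresponding components of all mate pairs (structure cells, $\tau_f$, $\Xi_A$). - $\mathcal G\colon{}_{\mathit{right}}\mathit{IND}(\mathcal B)\to\mathit{BIFIB}(\mathcal B)$ is the Grothendieck construction (arrows $(A,D)\to(B,E)$ are pairs of $f\colon A\to B$ and $D\to\Phi(f)E$), and $\mathcal G_{op}\colon{}_{\mathit{left}}\mathit{OPIND}(\mathcal B)\to\mathit{BIFIB}(\mathcal B)$ is the Grothendieck op-construction (pairs of $f\colon A\to B$ and $\Phi(f)D\to E$). **Theorem.** The forgetful 2-functors $U$ and $V$ are 2-equivalences, the 2-functors $\mathcal G$ and $\mathcal G_{op}$ are 2-equivalences, and there is a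 2-natural isomorphism $$\mathcal G\circ V\;\cong\;\mathcal G_{op}\circ U\colon \mathit{BI\text{-}IND}(\mathcal B)\longrightarrow\mathit{BIFIB}(\mathcal B).$$ In particular the composite $\mathcal G\circ V$ is a 2-equivalence, so the 2-category of bifibrations over $\mathcal B$ is 2-equivalent to the 2-category of pseudo double functors $\mathfrak H\mathcal B\to\mathfrak{ADJ}$. -/

import Mathlib

open CategoryTheory

universe w₁ w₂ vh₁ vh₂ vv₁ vv₂ u₁ u₂ v u

set_option linter.unusedVariables false
set_option linter.checkUnivs false

/-! ### Strict double categories -/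

/-- A (strict) double category with class of objects `D`: horizontal arrows `HHom`, vertical
arrows `VHom`, and cells `Cell f h k g` filling the squares with vertical domain `f` (top),
horizontal domain `h` (left), horizontal codomain `k` (right) and vertical codomain `g` (bottom).
Composition is written in diagrammatic order. Axioms relating cells whose boundaries are equal, but
not syntactically the same, are expressed with heterogeneous equality. -/
class DoubleCategory (D : Type u₁) where
  HHom : D → D → Type vh₁
  VHom : D → D → Type vv₁
  hId : ∀ A : D, HHom A A
  hComp : ∀ {A B C : D}, HHom A B → HHom B C → HHom A C
  hId_comp : ∀ {A B : D} (f : HHom A B), hComp (hId A) f = f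
  hComp_id : ∀ {A B : D} (f : HHom A B), hComp f (hId B) = f
  hAssoc : ∀ {A B C E : D} (f : HHom A B) (g : HHom B C) (k : HHom C E),
    hComp (hComp f g) k = hComp f (hComp g k)
  vId : ∀ A : D, VHom A A
  vComp : ∀ {A B C : D}, VHom A B → VHom B C → VHom A C
  vId_comp : ∀ {A B : D} (f : VHom A B), vComp (vId A) f = f
  vComp_id : ∀ {A B : D} (f : VHom A B), vComp f (vId B) = f
  vAssoc : ∀ {A B C E : D} (f : VHom A B) (g : VHom B C) (k : VHom C E),
    vComp (vComp f g) k = vComp f (vComp g k)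
  Cell : ∀ {A B C E : D}, HHom A B → VHom A C → VHom B E → HHom C E → Type w₁
  /-- The identity cell of a vertical arrow for horizontal composition of cells. -/
  cellHId : ∀ {A C : D} (h : VHom A C), Cell (hId A) h h (hId C)
  /-- The identity cell of a horizontal arrow for vertical composition of cells. -/
  cellVId : ∀ {A B : D} (f : HHom A B), Cell f (vId A) (vId B) f
  /-- Horizontal composition of cells. -/
  cellHComp : ∀ {A B C A' B' C' : D} {f : HHom A B} {g : HHom B C} {f' : HHom A' B'}
    {g' : HHom B' C'} {h : VHom A A'} {k : VHom B B'} {l : VHom C C'},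
    Cell f h k f' → Cell g k l g' → Cell (hComp f g) h l (hComp f' g')
  /-- Vertical composition of cells. -/
  cellVComp : ∀ {A B A' B' A'' B'' : D} {f : HHom A B} {f' : HHom A' B'} {f'' : HHom A'' B''}
    {h : VHom A A'} {k : VHom B B'} {h' : VHom A' A''} {k' : VHom B' B''},
    Cell f h k f' → Cell f' h' k' f'' → Cell f (vComp h h') (vComp k k') f''
  cellHId_comp : ∀ {A B A' B' : D} {f : HHom A B} {f' : HHom A' B'} {h : VHom A A'}
    {k : VHom B B'} (α : Cell f h k f'), HEq (cellHComp (cellHId h) α) α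
  cellHComp_id : ∀ {A B A' B' : D} {f : HHom A B} {f' : HHom A' B'} {h : VHom A A'}
    {k : VHom B B'} (α : Cell f h k f'), HEq (cellHComp α (cellHId k)) α
  cellHAssoc : ∀ {A B C E A' B' C' E' : D} {f : HHom A B} {g : HHom B C} {e : HHom C E}
    {f' : HHom A' B'} {g' : HHom B' C'} {e' : HHom C' E'}
    {h : VHom A A'} {k : VHom B B'} {l : VHom C C'} {m : VHom E E'}
    (α : Cell f h k f') (β : Cell g k l g') (γ : Cell e l m e'),
    HEq (cellHComp (cellHComp α β) γ) (cellHComp α (cellHComp β γ))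
  cellVId_comp : ∀ {A B A' B' : D} {f : HHom A B} {f' : HHom A' B'} {h : VHom A A'}
    {k : VHom B B'} (α : Cell f h k f'), HEq (cellVComp (cellVId f) α) α
  cellVComp_id : ∀ {A B A' B' : D} {f : HHom A B} {f' : HHom A' B'} {h : VHom A A'}
    {k : VHom B B'} (α : Cell f h k f'), HEq (cellVComp α (cellVId f')) α
  cellVAssoc : ∀ {A B A' B' A'' B'' A''' B''' : D} {f : HHom A B} {f' : HHom A' B'}
    {f'' : HHom A'' B''} {f''' : HHom A''' B'''}
    {h : VHom A A'} {k : VHom B B'} {h' : VHom A' A''} {k' : VHom B' B''}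
    {h'' : VHom A'' A'''} {k'' : VHom B'' B'''}
    (α : Cell f h k f') (β : Cell f' h' k' f'') (γ : Cell f'' h'' k'' f'''),
    HEq (cellVComp (cellVComp α β) γ) (cellVComp α (cellVComp β γ))
  interchange : ∀ {A B C A' B' C' A'' B'' C'' : D} {f : HHom A B} {g : HHom B C}
    {f' : HHom A' B'} {g' : HHom B' C'} {f'' : HHom A'' B''} {g'' : HHom B'' C''}
    {h : VHom A A'} {k : VHom B B'} {l : VHom C C'}
    {h' : VHom A' A''} {k' : VHom B' B''} {l' : VHom C' C''}
    (α : Cell f h k f') (β : Cell g k l g') (γ : Cell f' h' k' f'') (ε : Cell g' k' l' g''),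
    cellHComp (cellVComp α γ) (cellVComp β ε) = cellVComp (cellHComp α β) (cellHComp γ ε)
  cellHId_vComp : ∀ {A B C : D} (h : VHom A B) (k : VHom B C),
    cellHId (vComp h k) = cellVComp (cellHId h) (cellHId k)
  cellVId_hComp : ∀ {A B C : D} (f : HHom A B) (g : HHom B C),
    cellVId (hComp f g) = cellHComp (cellVId f) (cellVId g)
  cellHId_vId : ∀ A : D, cellHId (vId A) = cellVId (hId A)

open DoubleCategory

section CellEq

variable {D : Type u₁} [DoubleCategory.{w₁, vh₁, vv₁} D]

/-- Equality of two cells together with their boundaries. -/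
inductive CellEq {A B A' B' : D} {f : HHom A B} {h : VHom A A'} {k : VHom B B'} {f' : HHom A' B'}
    (α : Cell f h k f') : ∀ {g : HHom A B} {l : VHom A A'} {m : VHom B B'} {g' : HHom A' B'}
    (_ : Cell g l m g'), Prop
  | refl : CellEq α α

variable {A B C A' B' C' A'' B'' C'' : D}

lemma CellEq.of_heq {f g : HHom A B} {h l : VHom A A'} {k m : VHom B B'} {f' g' : HHom A' B'}
    {α : Cell f h k f'} {β : Cell g l m g'} (H : HEq α β) (h₁ : f = g) (h₂ : h = l) (h₃ : k = m)
    (h₄ : f' = g') : CellEq α β := by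
  subst h₁ h₂ h₃ h₄
  cases H
  exact .refl

lemma CellEq.heq {f g : HHom A B} {h l : VHom A A'} {k m : VHom B B'} {f' g' : HHom A' B'}
    {α : Cell f h k f'} {β : Cell g l m g'} (H : CellEq α β) : HEq α β := by
  cases H; rfl

lemma CellEq.eq {f : HHom A B} {h : VHom A A'} {k : VHom B B'} {f' : HHom A' B'}
    {α β : Cell f h k f'} (H : CellEq α β) : α = β := eq_of_heq H.heq

lemma CellEq.of_eq {f : HHom A B} {h : VHom A A'} {k : VHom B B'} {f' : HHom A' B'}
    {α β : Cell f h k f'} (H : α = β) : CellEq α β := by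
  subst H; exact .refl

lemma CellEq.symm {f g : HHom A B} {h l : VHom A A'} {k m : VHom B B'} {f' g' : HHom A' B'}
    {α : Cell f h k f'} {β : Cell g l m g'} (H : CellEq α β) : CellEq β α := by
  cases H; exact .refl

lemma CellEq.trans {f g e : HHom A B} {h l p : VHom A A'} {k m q : VHom B B'}
    {f' g' e' : HHom A' B'}
    {α : Cell f h k f'} {β : Cell g l m g'} {γ : Cell e p q e'}
    (H : CellEq α β) (H' : CellEq β γ) : CellEq α γ := by
  cases H; exact H'

instance {f g e : HHom A B} {h l p : VHom A A'} {k m q : VHom B B'}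
    {f' g' e' : HHom A' B'} :
    Trans (fun (α : Cell f h k f') (β : Cell g l m g') => CellEq α β)
      (fun (β : Cell g l m g') (γ : Cell e p q e') => CellEq β γ)
      (fun (α : Cell f h k f') (γ : Cell e p q e') => CellEq α γ) where
  trans := CellEq.trans

lemma CellEq.hcomp {f₁ f₂ : HHom A B} {g₁ g₂ : HHom B C} {f₁' f₂' : HHom A' B'}
    {g₁' g₂' : HHom B' C'} {h₁ h₂ : VHom A A'} {k₁ k₂ : VHom B B'} {l₁ l₂ : VHom C C'}
    {α₁ : Cell f₁ h₁ k₁ f₁'} {α₂ : Cell f₂ h₂ k₂ f₂'}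
    {β₁ : Cell g₁ k₁ l₁ g₁'} {β₂ : Cell g₂ k₂ l₂ g₂'}
    (H : CellEq α₁ α₂) (H' : CellEq β₁ β₂) :
    CellEq (cellHComp α₁ β₁) (cellHComp α₂ β₂) := by
  cases H; cases H'; exact .refl

lemma CellEq.vcomp {f₁ f₂ : HHom A B} {f₁' f₂' : HHom A' B'} {f₁'' f₂'' : HHom A'' B''}
    {h₁ h₂ : VHom A A'} {k₁ k₂ : VHom B B'} {h₁' h₂' : VHom A' A''} {k₁' k₂' : VHom B' B''}
    {α₁ : Cell f₁ h₁ k₁ f₁'} {α₂ : Cell f₂ h₂ k₂ f₂'}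
    {β₁ : Cell f₁' h₁' k₁' f₁''} {β₂ : Cell f₂' h₂' k₂' f₂''}
    (H : CellEq α₁ α₂) (H' : CellEq β₁ β₂) :
    CellEq (cellVComp α₁ β₁) (cellVComp α₂ β₂) := by
  cases H; cases H'; exact .refl

lemma CellEq.hid {h k : VHom A B} (H : h = k) : CellEq (cellHId h) (cellHId k) := by
  subst H; exact .refl

lemma CellEq.id_hcomp {f : HHom A B} {f' : HHom A' B'} {h : VHom A A'}
    {k : VHom B B'} (α : Cell f h k f') : CellEq (cellHComp (cellHId h) α) α :=
  .of_heq (cellHId_comp α) (hId_comp _) rfl rfl (hId_comp _)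

lemma CellEq.hcomp_id {f : HHom A B} {f' : HHom A' B'} {h : VHom A A'}
    {k : VHom B B'} (α : Cell f h k f') : CellEq (cellHComp α (cellHId k)) α :=
  .of_heq (cellHComp_id α) (hComp_id _) rfl rfl (hComp_id _)

lemma CellEq.id_vcomp {f : HHom A B} {f' : HHom A' B'} {h : VHom A A'}
    {k : VHom B B'} (α : Cell f h k f') : CellEq (cellVComp (cellVId f) α) α :=
  .of_heq (cellVId_comp α) rfl (vId_comp _) (vId_comp _) rfl

lemma CellEq.vcomp_id {f : HHom A B} {f' : HHom A' B'} {h : VHom A A'}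
    {k : VHom B B'} (α : Cell f h k f') : CellEq (cellVComp α (cellVId f')) α :=
  .of_heq (cellVComp_id α) rfl (vComp_id _) (vComp_id _) rfl

lemma CellEq.hassoc {E E' : D} {f : HHom A B} {g : HHom B C} {e : HHom C E}
    {f' : HHom A' B'} {g' : HHom B' C'} {e' : HHom C' E'}
    {h : VHom A A'} {k : VHom B B'} {l : VHom C C'} {m : VHom E E'}
    (α : Cell f h k f') (β : Cell g k l g') (γ : Cell e l m e') :
    CellEq (cellHComp (cellHComp α β) γ) (cellHComp α (cellHComp β γ)) :=
  .of_heq (cellHAssoc α β γ) (hAssoc _ _ _) rfl rfl (hAssoc _ _ _)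

lemma CellEq.vassoc {A''' B''' : D} {f : HHom A B} {f' : HHom A' B'}
    {f'' : HHom A'' B''} {f''' : HHom A''' B'''}
    {h : VHom A A'} {k : VHom B B'} {h' : VHom A' A''} {k' : VHom B' B''}
    {h'' : VHom A'' A'''} {k'' : VHom B'' B'''}
    (α : Cell f h k f') (β : Cell f' h' k' f'') (γ : Cell f'' h'' k'' f''') :
    CellEq (cellVComp (cellVComp α β) γ) (cellVComp α (cellVComp β γ)) :=
  .of_heq (cellVAssoc α β γ) rfl (vAssoc _ _ _) (vAssoc _ _ _) rfl

lemma CellEq.interchange {f : HHom A B} {g : HHom B C}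
    {f' : HHom A' B'} {g' : HHom B' C'} {f'' : HHom A'' B''} {g'' : HHom B'' C''}
    {h : VHom A A'} {k : VHom B B'} {l : VHom C C'}
    {h' : VHom A' A''} {k' : VHom B' B''} {l' : VHom C' C''}
    (α : Cell f h k f') (β : Cell g k l g') (γ : Cell f' h' k' f'') (ε : Cell g' k' l' g'') :
    CellEq (cellHComp (cellVComp α γ) (cellVComp β ε))
      (cellVComp (cellHComp α β) (cellHComp γ ε)) :=
  .of_eq (DoubleCategory.interchange α β γ ε)

end CellEq

/-! ### Pseudo double functors, vertical transformations and modifications -/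

section DblCat

variable (D : Type u₁) [DoubleCategory.{w₁, vh₁, vv₁} D]
  (E : Type u₂) [DoubleCategory.{w₂, vh₂, vv₂} E]

/-- A lax double functor: strict in the vertical direction and lax in the horizontal one, with
structure cells `δ` and `γ`. -/
structure LaxDoubleFunctor where
  obj : D → E
  hMap : ∀ {A B : D}, HHom A B → HHom (obj A) (obj B)
  vMap : ∀ {A B : D}, VHom A B → VHom (obj A) (obj B)
  cellMap : ∀ {A B A' B' : D} {f : HHom A B} {h : VHom A A'} {k : VHom B B'} {f' : HHom A' B'},
    Cell f h k f' → Cell (hMap f) (vMap h) (vMap k) (hMap f')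
  vMap_id : ∀ A : D, vMap (vId A) = vId (obj A)
  vMap_comp : ∀ {A B C : D} (h : VHom A B) (k : VHom B C),
    vMap (vComp h k) = vComp (vMap h) (vMap k)
  cellMap_vId : ∀ {A B : D} (f : HHom A B), HEq (cellMap (cellVId f)) (cellVId (hMap f))
  cellMap_vComp : ∀ {A B A' B' A'' B'' : D} {f : HHom A B} {f' : HHom A' B'}
    {f'' : HHom A'' B''} {h : VHom A A'} {k : VHom B B'} {h' : VHom A' A''} {k' : VHom B' B''}
    (α : Cell f h k f') (β : Cell f' h' k' f''),
    HEq (cellMap (cellVComp α β)) (cellVComp (cellMap α) (cellMap β))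
  δ : ∀ A : D, Cell (hId (obj A)) (vId (obj A)) (vId (obj A)) (hMap (hId A))
  γ : ∀ {A B C : D} (f : HHom A B) (g : HHom B C),
    Cell (hComp (hMap f) (hMap g)) (vId (obj A)) (vId (obj C)) (hMap (hComp f g))
  δ_naturality : ∀ {A C : D} (h : VHom A C),
    HEq (cellVComp (δ A) (cellMap (cellHId h))) (cellVComp (cellHId (vMap h)) (δ C))
  γ_naturality : ∀ {A B C A' B' C' : D} {f : HHom A B} {g : HHom B C} {f' : HHom A' B'}
    {g' : HHom B' C'} {h : VHom A A'} {k : VHom B B'} {l : VHom C C'}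
    (α : Cell f h k f') (β : Cell g k l g'),
    HEq (cellVComp (γ f g) (cellMap (cellHComp α β)))
      (cellVComp (cellHComp (cellMap α) (cellMap β)) (γ f' g'))
  left_unit : ∀ {A B : D} (f : HHom A B),
    HEq (cellVComp (cellHComp (δ A) (cellVId (hMap f))) (γ (hId A) f)) (cellVId (hMap f))
  right_unit : ∀ {A B : D} (f : HHom A B),
    HEq (cellVComp (cellHComp (cellVId (hMap f)) (δ B)) (γ f (hId B))) (cellVId (hMap f))
  assoc : ∀ {A B C C' : D} (f : HHom A B) (g : HHom B C) (e : HHom C C'),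
    HEq (cellVComp (cellHComp (γ f g) (cellVId (hMap e))) (γ (hComp f g) e))
      (cellVComp (cellHComp (cellVId (hMap f)) (γ g e)) (γ f (hComp g e)))

variable {E} in
/-- A cell between vertical identities is vertically invertible. -/
def IsVertIso {A B : E} {f g : HHom A B} (α : Cell f (vId A) (vId B) g) : Prop :=
  ∃ β : Cell g (vId A) (vId B) f,
    HEq (cellVComp α β) (cellVId f) ∧ HEq (cellVComp β α) (cellVId g)

/-- A pseudo double functor is a lax double functor whose structure cells are isomorphisms for the
vertical composition of cells. -/
structure PseudoDoubleFunctor extends LaxDoubleFunctor D E where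
  δ_iso : ∀ A : D, IsVertIso (δ A)
  γ_iso : ∀ {A B C : D} (f : HHom A B) (g : HHom B C), IsVertIso (γ f g)

variable {D E}

/-- A vertical transformation between (the lax double functors underlying) pseudo double
functors. -/
@[ext]
structure VertTrans (F G : PseudoDoubleFunctor D E) where
  app : ∀ A : D, VHom (F.obj A) (G.obj A)
  cell : ∀ {A B : D} (f : HHom A B), Cell (F.hMap f) (app A) (app B) (G.hMap f)
  app_naturality : ∀ {A C : D} (h : VHom A C),
    vComp (F.vMap h) (app C) = vComp (app A) (G.vMap h)
  cell_naturality : ∀ {A B A' B' : D} {f : HHom A B} {f' : HHom A' B'} {h : VHom A A'}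
    {k : VHom B B'} (α : Cell f h k f'),
    HEq (cellVComp (F.cellMap α) (cell f')) (cellVComp (cell f) (G.cellMap α))
  cell_id : ∀ A : D,
    HEq (cellVComp (F.δ A) (cell (hId A))) (cellVComp (cellHId (app A)) (G.δ A))
  cell_comp : ∀ {A B C : D} (f : HHom A B) (g : HHom B C),
    HEq (cellVComp (F.γ f g) (cell (hComp f g)))
      (cellVComp (cellHComp (cell f) (cell g)) (G.γ f g))

/-- A modification between vertical transformations. -/
@[ext]
structure DblModification {F G : PseudoDoubleFunctor D E} (σ τ : VertTrans F G) where
  app : ∀ A : D, Cell (hId (F.obj A)) (σ.app A) (τ.app A) (hId (G.obj A))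
  horizontal : ∀ {A B : D} (f : HHom A B),
    HEq (cellHComp (app A) (τ.cell f)) (cellHComp (σ.cell f) (app B))
  vertical : ∀ {A C : D} (h : VHom A C),
    HEq (cellVComp (app A) (cellHId (G.vMap h))) (cellVComp (cellHId (F.vMap h)) (app C))

section SpecialCells

variable {A B C : E}

/-- Horizontal composition of cells whose horizontal boundaries are identities, read again as such a
cell along the equality `1 ∘ 1 = 1`. -/
def specialComp {h k l : VHom A B} (α : Cell (hId A) h k (hId B)) (β : Cell (hId A) k l (hId B)) :
    Cell (hId A) h l (hId B) :=
  cast (by rw [hId_comp, hId_comp]) (cellHComp α β)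

lemma specialComp_cellEq {h k l : VHom A B} (α : Cell (hId A) h k (hId B))
    (β : Cell (hId A) k l (hId B)) : CellEq (specialComp α β) (cellHComp α β) :=
  .of_heq (cast_heq _ _) (hId_comp _).symm rfl rfl (hId_comp _).symm

end SpecialCells

namespace VertTrans

variable {F G H K : PseudoDoubleFunctor D E}

lemma cellEq_naturality (σ : VertTrans F G) {A B A' B' : D} {f : HHom A B} {f' : HHom A' B'}
    {h : VHom A A'} {k : VHom B B'} (α : Cell f h k f') :
    CellEq (cellVComp (F.cellMap α) (σ.cell f')) (cellVComp (σ.cell f) (G.cellMap α)) :=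
  .of_heq (σ.cell_naturality α) rfl (σ.app_naturality _) (σ.app_naturality _) rfl

lemma cellEq_id (σ : VertTrans F G) (A : D) :
    CellEq (cellVComp (F.δ A) (σ.cell (hId A))) (cellVComp (cellHId (σ.app A)) (G.δ A)) :=
  .of_heq (σ.cell_id A) rfl (by rw [vId_comp, vComp_id]) (by rw [vId_comp, vComp_id]) rfl

lemma cellEq_comp (σ : VertTrans F G) {A B C : D} (f : HHom A B) (g : HHom B C) :
    CellEq (cellVComp (F.γ f g) (σ.cell (hComp f g)))
      (cellVComp (cellHComp (σ.cell f) (σ.cell g)) (G.γ f g)) :=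
  .of_heq (σ.cell_comp f g) rfl (by rw [vId_comp, vComp_id]) (by rw [vId_comp, vComp_id]) rfl

lemma ext' {σ τ : VertTrans F G} (h : ∀ A, σ.app A = τ.app A)
    (h' : ∀ {A B : D} (f : HHom A B), CellEq (σ.cell f) (τ.cell f)) : σ = τ := by
  obtain ⟨a, c⟩ := σ
  obtain ⟨a', c'⟩ := τ
  obtain rfl : a = a' := funext h
  have : @c = @c' := by
    funext A B f
    exact (h' f).eq
  subst this
  rfl

/-- The identity vertical transformation. -/
def id (F : PseudoDoubleFunctor D E) : VertTrans F F where
  app A := vId (F.obj A)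
  cell f := cellVId (F.hMap f)
  app_naturality h := by rw [vId_comp, vComp_id]
  cell_naturality α := ((CellEq.vcomp_id _).trans (CellEq.id_vcomp _).symm).heq
  cell_id A := by
    rw [cellHId_vId]
    exact ((CellEq.vcomp_id _).trans (CellEq.id_vcomp _).symm).heq
  cell_comp f g := by
    rw [← cellVId_hComp]
    exact ((CellEq.vcomp_id _).trans (CellEq.id_vcomp _).symm).heq

/-- Composition of vertical transformations. -/
def comp (σ : VertTrans F G) (τ : VertTrans G H) : VertTrans F H where
  app A := vComp (σ.app A) (τ.app A)
  cell f := cellVComp (σ.cell f) (τ.cell f)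
  app_naturality h := by
    rw [← vAssoc, σ.app_naturality, vAssoc, τ.app_naturality, vAssoc]
  cell_naturality α :=
    ((CellEq.vassoc _ _ _).symm.trans <| (CellEq.vcomp (σ.cellEq_naturality α) .refl).trans <|
      (CellEq.vassoc _ _ _).trans <| (CellEq.vcomp .refl (τ.cellEq_naturality α)).trans
      (CellEq.vassoc _ _ _).symm).heq
  cell_id A := by
    rw [cellHId_vComp]
    exact ((CellEq.vassoc _ _ _).symm.trans <| (CellEq.vcomp (σ.cellEq_id A) .refl).trans <|
      (CellEq.vassoc _ _ _).trans <| (CellEq.vcomp .refl (τ.cellEq_id A)).trans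
      (CellEq.vassoc _ _ _).symm).heq
  cell_comp f g := by
    rw [interchange]
    exact ((CellEq.vassoc _ _ _).symm.trans <| (CellEq.vcomp (σ.cellEq_comp f g) .refl).trans <|
      (CellEq.vassoc _ _ _).trans <| (CellEq.vcomp .refl (τ.cellEq_comp f g)).trans
      (CellEq.vassoc _ _ _).symm).heq

end VertTrans

namespace DblModification

variable {F G H : PseudoDoubleFunctor D E}

lemma cellEq_horizontal {σ τ : VertTrans F G} (Ξ : DblModification σ τ) {A B : D} (f : HHom A B) :
    CellEq (cellHComp (Ξ.app A) (τ.cell f)) (cellHComp (σ.cell f) (Ξ.app B)) :=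
  .of_heq (Ξ.horizontal f) (by rw [hId_comp, hComp_id]) rfl rfl (by rw [hId_comp, hComp_id])

lemma cellEq_vertical {σ τ : VertTrans F G} (Ξ : DblModification σ τ) {A C : D} (h : VHom A C) :
    CellEq (cellVComp (Ξ.app A) (cellHId (G.vMap h)))
      (cellVComp (cellHId (F.vMap h)) (Ξ.app C)) :=
  .of_heq (Ξ.vertical h) rfl (σ.app_naturality h).symm (τ.app_naturality h).symm rfl

/-- The identity modification. -/
def id (σ : VertTrans F G) : DblModification σ σ where
  app A := cellHId (σ.app A)
  horizontal f := ((CellEq.id_hcomp _).trans (CellEq.hcomp_id _).symm).heq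
  vertical h := by
    rw [← cellHId_vComp, ← cellHId_vComp, σ.app_naturality]

/-- Composition of modifications. -/
def comp {σ τ υ : VertTrans F G} (Ξ : DblModification σ τ) (Θ : DblModification τ υ) :
    DblModification σ υ where
  app A := specialComp (Ξ.app A) (Θ.app A)
  horizontal f :=
    ((CellEq.hcomp (specialComp_cellEq _ _) .refl).trans <| (CellEq.hassoc _ _ _).trans <|
      (CellEq.hcomp .refl (Θ.cellEq_horizontal f)).trans <| (CellEq.hassoc _ _ _).symm.trans <|
      (CellEq.hcomp (Ξ.cellEq_horizontal f) .refl).trans <| (CellEq.hassoc _ _ _).trans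
      (CellEq.hcomp .refl (specialComp_cellEq _ _).symm)).heq
  vertical h :=
    ((CellEq.vcomp (specialComp_cellEq _ _) (CellEq.hcomp_id _).symm).trans <|
      (CellEq.interchange _ _ _ _).symm.trans <|
      (CellEq.hcomp (Ξ.cellEq_vertical h) (Θ.cellEq_vertical h)).trans <|
      (CellEq.interchange _ _ _ _).trans <|
      CellEq.vcomp (CellEq.hcomp_id _) (specialComp_cellEq _ _).symm).heq

/-- Left whiskering of a modification by a vertical transformation. -/
def whiskerLeft (σ : VertTrans F G) {τ υ : VertTrans G H} (Ξ : DblModification τ υ) :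
    DblModification (σ.comp τ) (σ.comp υ) where
  app A := cellVComp (cellHId (σ.app A)) (Ξ.app A)
  horizontal f :=
    ((CellEq.interchange _ _ _ _).trans <|
      (CellEq.vcomp ((CellEq.id_hcomp _).trans (CellEq.hcomp_id _).symm)
        (Ξ.cellEq_horizontal f)).trans (CellEq.interchange _ _ _ _).symm).heq
  vertical h :=
    ((CellEq.vassoc _ _ _).trans <| (CellEq.vcomp .refl (Ξ.cellEq_vertical h)).trans <|
      (CellEq.vassoc _ _ _).symm.trans <|
      (CellEq.vcomp ((CellEq.of_eq (cellHId_vComp _ _).symm).trans <|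
        (CellEq.hid (σ.app_naturality h).symm).trans <| .of_eq (cellHId_vComp _ _)) .refl).trans
      (CellEq.vassoc _ _ _)).heq

/-- Right whiskering of a modification by a vertical transformation. -/
def whiskerRight {σ τ : VertTrans F G} (Ξ : DblModification σ τ) (υ : VertTrans G H) :
    DblModification (σ.comp υ) (τ.comp υ) where
  app A := cellVComp (Ξ.app A) (cellHId (υ.app A))
  horizontal f :=
    ((CellEq.interchange _ _ _ _).trans <|
      (CellEq.vcomp (Ξ.cellEq_horizontal f)
        ((CellEq.id_hcomp _).trans (CellEq.hcomp_id _).symm)).trans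
      (CellEq.interchange _ _ _ _).symm).heq
  vertical h :=
    ((CellEq.vassoc _ _ _).trans <|
      (CellEq.vcomp .refl ((CellEq.of_eq (cellHId_vComp _ _).symm).trans <|
        (CellEq.hid (υ.app_naturality h).symm).trans <| .of_eq (cellHId_vComp _ _))).trans <|
      (CellEq.vassoc _ _ _).symm.trans <|
      (CellEq.vcomp (Ξ.cellEq_vertical h) .refl).trans (CellEq.vassoc _ _ _)).heq

end DblModification

instance : CategoryStruct (PseudoDoubleFunctor D E) where
  Hom := VertTrans
  id := VertTrans.id
  comp := VertTrans.comp

instance (F G : PseudoDoubleFunctor D E) : Category (F ⟶ G) where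
  Hom σ τ := DblModification σ τ
  id σ := DblModification.id σ
  comp Ξ Θ := DblModification.comp Ξ Θ
  id_comp _ := DblModification.ext <| funext fun _ =>
    ((specialComp_cellEq _ _).trans (CellEq.id_hcomp _)).eq
  comp_id _ := DblModification.ext <| funext fun _ =>
    ((specialComp_cellEq _ _).trans (CellEq.hcomp_id _)).eq
  assoc _ _ _ := DblModification.ext <| funext fun _ =>
    ((specialComp_cellEq _ _).trans <| (CellEq.hcomp (specialComp_cellEq _ _) .refl).trans <|
      (CellEq.hassoc _ _ _).trans <| (CellEq.hcomp .refl (specialComp_cellEq _ _).symm).trans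
      (specialComp_cellEq _ _).symm).eq

namespace PseudoDoubleFunctor

variable {F G H K : PseudoDoubleFunctor D E}

lemma id_comp (σ : F ⟶ G) : 𝟙 F ≫ σ = σ :=
  VertTrans.ext' (fun _ => vId_comp _) (fun _ => CellEq.id_vcomp _)

lemma comp_id (σ : F ⟶ G) : σ ≫ 𝟙 G = σ :=
  VertTrans.ext' (fun _ => vComp_id _) (fun _ => CellEq.vcomp_id _)

lemma comp_assoc (σ : F ⟶ G) (τ : G ⟶ H) (υ : H ⟶ K) : (σ ≫ τ) ≫ υ = σ ≫ τ ≫ υ :=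
  VertTrans.ext' (fun _ => vAssoc _ _ _) (fun _ => CellEq.vassoc _ _ _)

/-- Two modifications between equal transformations agree as soon as their components do. -/
lemma conj_eq {σ σ' τ τ' : F ⟶ G} (hσ : σ = σ') (hτ : τ' = τ) (Ξ : σ ⟶ τ) (Θ : σ' ⟶ τ')
    (h : ∀ A, CellEq (DblModification.app Ξ A) (DblModification.app Θ A)) :
    Ξ = eqToHom hσ ≫ Θ ≫ eqToHom hτ := by
  subst hσ hτ
  simp only [eqToHom_refl, Category.comp_id, Category.id_comp]
  exact DblModification.ext (funext fun A => (h A).eq)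

lemma whiskerLeft_eqToHom (σ : F ⟶ G) {τ υ : G ⟶ H} (h : τ = υ) :
    DblModification.whiskerLeft σ (eqToHom h) = eqToHom (congrArg (σ ≫ ·) h) := by
  subst h
  exact DblModification.ext <| funext fun _ => (cellHId_vComp _ _).symm

lemma whiskerRight_eqToHom {σ τ : F ⟶ G} (h : σ = τ) (υ : G ⟶ H) :
    DblModification.whiskerRight (eqToHom h) υ = eqToHom (congrArg (· ≫ υ) h) := by
  subst h
  exact DblModification.ext <| funext fun _ => (cellHId_vComp _ _).symm

/-- The 2-category of pseudo double functors, vertical transformations and modifications. -/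
instance bicategory : Bicategory (PseudoDoubleFunctor D E) where
  whiskerLeft σ _ _ Ξ := DblModification.whiskerLeft σ Ξ
  whiskerRight Ξ τ := DblModification.whiskerRight Ξ τ
  associator σ τ υ := eqToIso (comp_assoc σ τ υ)
  leftUnitor σ := eqToIso (id_comp σ)
  rightUnitor σ := eqToIso (comp_id σ)
  whiskerLeft_id σ τ := DblModification.ext <| funext fun _ => (cellHId_vComp _ _).symm
  whiskerLeft_comp σ _ _ _ Ξ Θ := DblModification.ext <| funext fun _ =>
    ((CellEq.vcomp (CellEq.hcomp_id _).symm (specialComp_cellEq _ _)).trans <|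
      (CellEq.interchange _ _ _ _).symm.trans (specialComp_cellEq _ _).symm).eq
  id_whiskerLeft Ξ := by
    refine conj_eq (id_comp _) (id_comp _).symm _ _ fun A => ?_
    exact (CellEq.vcomp (CellEq.of_eq (cellHId_vId _)) .refl).trans (CellEq.id_vcomp _)
  comp_whiskerLeft σ τ _ _ Ξ := by
    refine conj_eq (comp_assoc _ _ _) (comp_assoc _ _ _).symm _ _ fun A => ?_
    exact (CellEq.vcomp (CellEq.of_eq (cellHId_vComp _ _)) .refl).trans (CellEq.vassoc _ _ _)
  id_whiskerRight σ τ := DblModification.ext <| funext fun _ => (cellHId_vComp _ _).symm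
  comp_whiskerRight Ξ Θ τ := DblModification.ext <| funext fun _ =>
    ((CellEq.vcomp (specialComp_cellEq _ _) (CellEq.hcomp_id _).symm).trans <|
      (CellEq.interchange _ _ _ _).symm.trans (specialComp_cellEq _ _).symm).eq
  whiskerRight_id Ξ := by
    refine conj_eq (comp_id _) (comp_id _).symm _ _ fun A => ?_
    exact (CellEq.vcomp .refl (CellEq.of_eq (cellHId_vId _))).trans (CellEq.vcomp_id _)
  whiskerRight_comp Ξ τ υ := by
    refine conj_eq (comp_assoc _ _ _).symm (comp_assoc _ _ _) _ _ fun A => ?_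
    exact (CellEq.vcomp .refl (CellEq.of_eq (cellHId_vComp _ _))).trans
      (CellEq.vassoc _ _ _).symm
  whisker_assoc σ _ _ Ξ υ := by
    refine conj_eq (comp_assoc _ _ _) (comp_assoc _ _ _).symm _ _ fun A => ?_
    exact CellEq.vassoc _ _ _
  whisker_exchange Ξ Θ := DblModification.ext <| funext fun _ =>
    ((specialComp_cellEq _ _).trans <| (CellEq.interchange _ _ _ _).trans <|
      (CellEq.vcomp ((CellEq.id_hcomp _).trans (CellEq.hcomp_id _).symm)
        ((CellEq.hcomp_id _).trans (CellEq.id_hcomp _).symm)).trans <|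
      (CellEq.interchange _ _ _ _).symm.trans (specialComp_cellEq _ _).symm).eq
  pentagon _ _ _ _ := by
    simp only [eqToIso.hom, whiskerLeft_eqToHom, whiskerRight_eqToHom, eqToHom_trans]
  triangle _ _ := by
    simp only [eqToIso.hom, whiskerLeft_eqToHom, whiskerRight_eqToHom, eqToHom_trans]

instance : Bicategory.Strict (PseudoDoubleFunctor D E) where
  id_comp := id_comp
  comp_id := comp_id
  assoc := comp_assoc

end PseudoDoubleFunctor

end DblCat

/-! ### The horizontal double category of a category and the double category of adjunctions -/

/-- The horizontal double category of the category `B`, seen as a 2-category with only identity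
2-cells. -/
structure HB (B : Type u) where
  of : B

lemma plift_heq {p q : Prop} (h : p = q) (x : PLift p) (y : PLift q) : HEq x y := by
  subst h
  obtain ⟨x⟩ := x
  obtain ⟨y⟩ := y
  rfl

/-- Horizontal arrows are the arrows of `B`, the only vertical arrows are identities, and a cell is
an equality between its vertical domain and its vertical codomain. -/
instance HB.doubleCategory (B : Type u) [Category.{v} B] : DoubleCategory.{0, v, 0} (HB B) where
  HHom A C := A.of ⟶ C.of
  VHom A C := PLift (A = C)
  hId A := 𝟙 A.of
  hComp f g := f ≫ g
  hId_comp := Category.id_comp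
  hComp_id := Category.comp_id
  hAssoc := Category.assoc
  vId _ := ⟨rfl⟩
  vComp h k := ⟨h.down.trans k.down⟩
  vId_comp _ := rfl
  vComp_id _ := rfl
  vAssoc _ _ _ := rfl
  Cell f _ _ g := PLift (HEq f g)
  cellHId h := ⟨by obtain ⟨rfl⟩ := h; rfl⟩
  cellVId _ := ⟨HEq.rfl⟩
  cellHComp {_ _ _ _ _ _ _ _ _ _ h k l} α β := ⟨by
    obtain ⟨rfl⟩ := h
    obtain ⟨rfl⟩ := k
    obtain ⟨rfl⟩ := l
    obtain ⟨α⟩ := α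
    obtain ⟨β⟩ := β
    cases α
    cases β
    rfl⟩
  cellVComp α β := ⟨α.down.trans β.down⟩
  cellHId_comp {_ _ _ _ f _ h k} α := by
    obtain ⟨rfl⟩ := h
    obtain ⟨rfl⟩ := k
    obtain ⟨α⟩ := α
    cases α
    exact plift_heq (by rw [Category.id_comp]) _ _
  cellHComp_id {_ _ _ _ f _ h k} α := by
    obtain ⟨rfl⟩ := h
    obtain ⟨rfl⟩ := k
    obtain ⟨α⟩ := α
    cases α
    exact plift_heq (by rw [Category.comp_id]) _ _
  cellHAssoc {_ _ _ _ _ _ _ _ f g e _ _ _ h k l m} α β γ := by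
    obtain ⟨rfl⟩ := h
    obtain ⟨rfl⟩ := k
    obtain ⟨rfl⟩ := l
    obtain ⟨rfl⟩ := m
    obtain ⟨α⟩ := α
    obtain ⟨β⟩ := β
    obtain ⟨γ⟩ := γ
    cases α
    cases β
    cases γ
    exact plift_heq (by rw [Category.assoc]) _ _
  cellVId_comp _ := HEq.rfl
  cellVComp_id _ := HEq.rfl
  cellVAssoc _ _ _ := HEq.rfl
  interchange _ _ _ _ := rfl
  cellHId_vComp _ _ := rfl
  cellVId_hComp _ _ := rfl
  cellHId_vId _ := rfl

/-- An adjunction `L ⊣ R`, seen as an arrow from `A` to `B` in the direction of the left adjoint. -/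
@[ext]
structure AdjHom (A B : Cat.{v, u}) where
  L : A ⥤ B
  R : B ⥤ A
  adj : L ⊣ R

/-- A cell of the double category of adjunctions: a mate pair, that is, a pair of natural
transformations `ξ` (between composites involving left adjoints) and `ζ` (between composites
involving right adjoints) that correspond to each other under the bijections of the
adjunctions. -/
@[ext]
structure MatePair {A B C E : Cat.{v, u}} (f : AdjHom A B) (h : A ⥤ C) (k : B ⥤ E)
    (g : AdjHom C E) where
  ξ : h ⋙ g.L ⟶ f.L ⋙ k
  ζ : f.R ⋙ h ⟶ k ⋙ g.R
  mates : ∀ (a : A) (b : B) (m : f.L.obj a ⟶ b),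
    g.adj.homEquiv (h.obj a) (k.obj b) (ξ.app a ≫ k.map m) =
      h.map (f.adj.homEquiv a b m) ≫ ζ.app b

lemma MatePair.heq {A B C E : Cat.{v, u}} {f f' : AdjHom A B} {h h' : A ⥤ C} {k k' : B ⥤ E}
    {g g' : AdjHom C E} {α : MatePair f h k g} {β : MatePair f' h' k' g'}
    (hf : f = f') (hh : h = h') (hk : k = k') (hg : g = g')
    (hξ : ∀ a, HEq (α.ξ.app a) (β.ξ.app a)) (hζ : ∀ b, HEq (α.ζ.app b) (β.ζ.app b)) :
    HEq α β := by
  subst hf hh hk hg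
  refine heq_of_eq (MatePair.ext ?_ ?_)
  · ext a; exact eq_of_heq (hξ a)
  · ext b; exact eq_of_heq (hζ b)

namespace AdjHom

/-- The identity adjunction. -/
def id (A : Cat.{v, u}) : AdjHom A A := ⟨𝟭 A, 𝟭 A, Adjunction.id⟩

/-- Composition of adjunctions. -/
def comp {A B C : Cat.{v, u}} (f : AdjHom A B) (g : AdjHom B C) : AdjHom A C :=
  ⟨f.L ⋙ g.L, g.R ⋙ f.R, f.adj.comp g.adj⟩

lemma id_comp {A B : Cat.{v, u}} (f : AdjHom A B) : (id A).comp f = f := by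
  obtain ⟨L, R, adj⟩ := f
  have : Adjunction.id.comp adj = adj := Adjunction.ext (by ext; simp)
  exact congrArg (AdjHom.mk L R) this

lemma comp_id {A B : Cat.{v, u}} (f : AdjHom A B) : f.comp (id B) = f := by
  obtain ⟨L, R, adj⟩ := f
  have : adj.comp Adjunction.id = adj := Adjunction.ext (by ext; simp)
  exact congrArg (AdjHom.mk L R) this

lemma assoc {A B C E : Cat.{v, u}} (f : AdjHom A B) (g : AdjHom B C) (k : AdjHom C E) :
    (f.comp g).comp k = f.comp (g.comp k) := by
  have : (f.adj.comp g.adj).comp k.adj = f.adj.comp (g.adj.comp k.adj) :=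
    Adjunction.ext (by ext; simp)
  exact congrArg (AdjHom.mk _ _) this

lemma comp_homEquiv {A B C : Cat.{v, u}} (f : AdjHom A B) (g : AdjHom B C) (a : A) (c : C)
    (m : g.L.obj (f.L.obj a) ⟶ c) :
    (f.comp g).adj.homEquiv a c m = f.adj.homEquiv _ _ (g.adj.homEquiv _ _ m) :=
  congrFun (congrArg (fun e => (e a c : _ → _)) (Adjunction.comp_homEquiv f.adj g.adj)) m

end AdjHom

namespace MatePair

/-- The identity mate pair on a functor. -/
def hId {A C : Cat.{v, u}} (h : A ⥤ C) : MatePair (AdjHom.id A) h h (AdjHom.id C) where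
  ξ := 𝟙 h
  ζ := 𝟙 h
  mates a b m := by
    have e : ∀ {X : Cat.{v, u}} {x y : X} (n : x ⟶ y), Adjunction.id.homEquiv x y n = n :=
      fun n => Category.id_comp n
    exact (e _).trans ((Category.id_comp _).trans ((congrArg h.map (e (X := A) m).symm).trans
      (Category.comp_id _).symm))

/-- The identity mate pair on an adjunction. -/
def vId {A B : Cat.{v, u}} (f : AdjHom A B) : MatePair f (𝟭 A) (𝟭 B) f where
  ξ := 𝟙 f.L
  ζ := 𝟙 f.R
  mates a b m := by simp

/-- Horizontal composition of mate pairs. -/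
def hComp {A B C A' B' C' : Cat.{v, u}} {f : AdjHom A B} {g : AdjHom B C} {f' : AdjHom A' B'}
    {g' : AdjHom B' C'} {h : A ⥤ A'} {k : B ⥤ B'} {l : C ⥤ C'} (α : MatePair f h k f')
    (β : MatePair g k l g') : MatePair (f.comp g) h l (f'.comp g') where
  ξ :=
    { app := fun a => g'.L.map (α.ξ.app a) ≫ β.ξ.app (f.L.obj a)
      naturality := fun a a' m => by
        have h₁ := α.ξ.naturality m
        have h₂ := β.ξ.naturality (f.L.map m)
        dsimp [AdjHom.comp] at h₁ h₂ ⊢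
        rw [← Category.assoc, ← g'.L.map_comp, h₁, g'.L.map_comp, Category.assoc, h₂,
          Category.assoc] }
  ζ :=
    { app := fun c => α.ζ.app (g.R.obj c) ≫ f'.R.map (β.ζ.app c)
      naturality := fun c c' m => by
        have h₁ := α.ζ.naturality (g.R.map m)
        have h₂ := β.ζ.naturality m
        dsimp [AdjHom.comp] at h₁ h₂ ⊢
        rw [← Category.assoc, h₁, Category.assoc, ← f'.R.map_comp, h₂, f'.R.map_comp,
          Category.assoc] }
  mates a c m := by
    have h₁ := α.mates a (g.R.obj c) (g.adj.homEquiv _ _ m)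
    have h₂ := β.mates (f.L.obj a) c m
    rw [AdjHom.comp_homEquiv f g a c m]
    refine (AdjHom.comp_homEquiv f' g' (h.obj a) (l.obj c) _).trans ?_
    dsimp [AdjHom.comp] at h₁ h₂ ⊢
    rw [Category.assoc, Adjunction.homEquiv_naturality_left, h₂, ← Category.assoc,
      Adjunction.homEquiv_naturality_right, h₁, Category.assoc]

/-- Vertical composition of mate pairs. -/
def vComp {A B A' B' A'' B'' : Cat.{v, u}} {f : AdjHom A B} {f' : AdjHom A' B'}
    {f'' : AdjHom A'' B''} {h : A ⥤ A'} {k : B ⥤ B'} {h' : A' ⥤ A''} {k' : B' ⥤ B''}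
    (α : MatePair f h k f') (β : MatePair f' h' k' f'') : MatePair f (h ⋙ h') (k ⋙ k') f'' where
  ξ :=
    { app := fun a => β.ξ.app (h.obj a) ≫ k'.map (α.ξ.app a)
      naturality := fun a a' m => by
        have h₁ := β.ξ.naturality (h.map m)
        have h₂ := α.ξ.naturality m
        dsimp at h₁ h₂ ⊢
        rw [← Category.assoc, h₁, Category.assoc, ← k'.map_comp, h₂, k'.map_comp,
          Category.assoc] }
  ζ :=
    { app := fun b => h'.map (α.ζ.app b) ≫ β.ζ.app (k.obj b)
      naturality := fun b b' m => by
        have h₁ := β.ζ.naturality (k.map m)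
        have h₂ := α.ζ.naturality m
        dsimp at h₁ h₂ ⊢
        rw [← Category.assoc, ← h'.map_comp, h₂, h'.map_comp, Category.assoc, h₁,
          Category.assoc] }
  mates a b m := by
    have h₁ := α.mates a b m
    have h₂ := β.mates (h.obj a) (k.obj b) (α.ξ.app a ≫ k.map m)
    dsimp at h₁ h₂ ⊢
    rw [Category.assoc, ← k'.map_comp, h₂, h₁, h'.map_comp, Category.assoc]

end MatePair

/-- The objects of the double category of adjunctions: categories. -/
abbrev ADJ : Type (max (u + 1) (v + 1)) := Cat.{v, u}

/-- Horizontal arrows are adjunctions, vertical arrows are functors and cells are mate pairs. -/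
instance ADJ.doubleCategory :
    DoubleCategory.{max u v, max u v, max u v} ADJ.{v, u} where
  HHom A B := AdjHom A B
  VHom A B := A ⥤ B
  hId := AdjHom.id
  hComp := AdjHom.comp
  hId_comp := AdjHom.id_comp
  hComp_id := AdjHom.comp_id
  hAssoc := AdjHom.assoc
  vId A := 𝟭 A
  vComp h k := h ⋙ k
  vId_comp _ := rfl
  vComp_id _ := rfl
  vAssoc _ _ _ := rfl
  Cell f h k g := MatePair f h k g
  cellHId := MatePair.hId
  cellVId := MatePair.vId
  cellHComp := MatePair.hComp
  cellVComp := MatePair.vComp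
  cellHId_comp {_ _ _ _ f f' h k} α := by
    refine MatePair.heq (AdjHom.id_comp f) rfl rfl (AdjHom.id_comp f') (fun a => ?_) (fun b => ?_)
    · exact heq_of_eq ((congrArg (· ≫ _) (f'.L.map_id _)).trans (Category.id_comp _))
    · exact heq_of_eq (Category.id_comp _)
  cellHComp_id {_ _ _ _ f f' h k} α := by
    refine MatePair.heq (AdjHom.comp_id f) rfl rfl (AdjHom.comp_id f') (fun a => ?_) (fun b => ?_)
    · exact heq_of_eq (Category.comp_id _)
    · exact heq_of_eq ((congrArg (_ ≫ ·) (f'.R.map_id _)).trans (Category.comp_id _))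
  cellHAssoc {_ _ _ _ _ _ _ _ f g e f' g' e' _ _ _ _} α β γ := by
    refine MatePair.heq (AdjHom.assoc f g e) rfl rfl (AdjHom.assoc f' g' e') (fun a => ?_)
      (fun b => ?_)
    · exact heq_of_eq ((congrArg (· ≫ _) (e'.L.map_comp _ _)).trans (Category.assoc _ _ _))
    · exact heq_of_eq ((Category.assoc _ _ _).trans
        (congrArg (_ ≫ ·) (f'.R.map_comp _ _).symm))
  cellVId_comp {_ _ _ _ f f' h k} α := by
    refine MatePair.heq rfl rfl rfl rfl (fun a => ?_) (fun b => ?_)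
    · exact heq_of_eq ((congrArg (_ ≫ ·) (k.map_id _)).trans (Category.comp_id _))
    · exact heq_of_eq ((congrArg (· ≫ _) (h.map_id _)).trans (Category.id_comp _))
  cellVComp_id {_ _ _ _ f f' h k} α := by
    refine MatePair.heq rfl rfl rfl rfl (fun a => ?_) (fun b => ?_)
    · exact heq_of_eq (Category.id_comp _)
    · exact heq_of_eq (Category.comp_id _)
  cellVAssoc {_ _ _ _ _ _ _ _ _ _ _ _ _ _ _ _ h'' k''} α β γ := by
    refine MatePair.heq rfl rfl rfl rfl (fun a => ?_) (fun b => ?_)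
    · exact heq_of_eq ((congrArg (_ ≫ ·) (k''.map_comp _ _)).trans (Category.assoc _ _ _).symm)
    · exact heq_of_eq ((congrArg (· ≫ _) (h''.map_comp _ _)).trans (Category.assoc _ _ _))
  interchange {_ _ _ _ _ _ _ _ _ f g f' g' f'' g'' h k l h' k' l'} α β γ ε := by
    refine MatePair.ext (NatTrans.ext (funext fun a => ?_)) (NatTrans.ext (funext fun b => ?_))
    · have := ε.ξ.naturality (α.ξ.app a)
      dsimp [MatePair.hComp, MatePair.vComp, AdjHom.comp] at this ⊢
      simp only [Functor.map_comp, Category.assoc]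
      rw [reassoc_of% this]
    · have := γ.ζ.naturality (β.ζ.app b)
      dsimp [MatePair.hComp, MatePair.vComp, AdjHom.comp] at this ⊢
      simp only [Functor.map_comp, Category.assoc]
      rw [reassoc_of% this]
  cellHId_vComp h k := by
    refine MatePair.ext (NatTrans.ext (funext fun a => ?_)) (NatTrans.ext (funext fun b => ?_))
    · exact ((Category.id_comp _).trans (k.map_id _)).symm
    · exact ((Category.comp_id _).trans (k.map_id _)).symm
  cellVId_hComp f g := by
    refine MatePair.ext (NatTrans.ext (funext fun a => ?_)) (NatTrans.ext (funext fun b => ?_)) <;>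
      simp [MatePair.vId, MatePair.hComp, AdjHom.comp]
  cellHId_vId A := rfl

/-! ### Indexed, opindexed and bi-indexed categories -/

open Bicategory Opposite

/-- The 2-category of bi-indexed categories over `B`. -/
abbrev BIIND (B : Type u) [Category.{v} B] := PseudoDoubleFunctor (HB B) ADJ.{v, u}

lemma cat_hom₂_ext {C D : Cat.{v, u}} {F G : C ⟶ D} {α β : F ⟶ G}
    (h : ∀ x, α.toNatTrans.app x = β.toNatTrans.app x) : α = β :=
  Cat.Hom₂.ext (NatTrans.ext (funext h))

lemma laxTrans_ext {X : Type u₁} [Bicategory.{w₁, vh₁} X] {F G : X ⥤ᴸ Cat.{v, u}}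
    {σ τ : Lax.LaxTrans F G} (h : σ.app = τ.app)
    (h' : ∀ {a b : X} (f : a ⟶ b), HEq (σ.naturality f) (τ.naturality f)) : σ = τ := by
  obtain ⟨a, n, _, _, _⟩ := σ
  obtain ⟨a', n', _, _, _⟩ := τ
  obtain rfl : a = a' := h
  obtain rfl : @n = @n' := by
    funext x y f
    exact eq_of_heq (h' f)
  rfl

lemma oplaxTrans_ext {X : Type u₁} [Bicategory.{w₁, vh₁} X] {F G : X ⥤ᴸ Cat.{v, u}}
    {σ τ : Lax.OplaxTrans F G} (h : σ.app = τ.app)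
    (h' : ∀ {a b : X} (f : a ⟶ b), HEq (σ.naturality f) (τ.naturality f)) : σ = τ := by
  obtain ⟨a, n, _, _, _⟩ := σ
  obtain ⟨a', n', _, _, _⟩ := τ
  obtain rfl : a = a' := h
  obtain rfl : @n = @n' := by
    funext x y f
    exact eq_of_heq (h' f)
  rfl

section

variable (J : Type u) [Category.{v} J]

/-- Lax functors from `J` to categories, with lax transformations and modifications. -/
abbrev laxBicategory : Bicategory.{max u v, max u v} (LocallyDiscrete J ⥤ᴸ Cat.{v, u}) :=
  Lax.LaxTrans.LaxFunctor.bicategory _ _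

/-- Lax functors from `J` to categories, with oplax transformations and modifications. -/
abbrev oplaxBicategory : Bicategory.{max u v, max u v} (LocallyDiscrete J ⥤ᴸ Cat.{v, u}) :=
  Lax.OplaxTrans.LaxFunctor.bicategory _ _

lemma laxTrans_comp_app {F G H : LocallyDiscrete J ⥤ᴸ Cat.{v, u}} (σ : Lax.LaxTrans F G)
    (τ : Lax.LaxTrans G H) {a b : LocallyDiscrete J} (f : a ⟶ b) (x : F.obj a) :
    ((σ.vComp τ).naturality f).toNatTrans.app x =
      (τ.naturality f).toNatTrans.app ((σ.app a).toFunctor.obj x) ≫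
        (τ.app b).toFunctor.map ((σ.naturality f).toNatTrans.app x) := by
  simp [Lax.LaxTrans.vComp]

lemma laxTrans_id_app (F : LocallyDiscrete J ⥤ᴸ Cat.{v, u}) {a b : LocallyDiscrete J}
    (f : a ⟶ b) (x : F.obj a) :
    ((Lax.LaxTrans.id F).naturality f).toNatTrans.app x = 𝟙 ((F.map f).toFunctor.obj x) := by
  simp [Lax.LaxTrans.id]

attribute [local instance] laxBicategory in
lemma laxTrans_eqToHom_app {F G : LocallyDiscrete J ⥤ᴸ Cat.{v, u}} {σ τ : F ⟶ G} (h : σ = τ)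
    (x : LocallyDiscrete J) :
    Lax.LaxTrans.Modification.app (Lax.LaxTrans.Hom.as (eqToHom h)) x =
      eqToHom (congrFun (congrArg Lax.LaxTrans.app h) x) := by
  subst h; rfl

attribute [local instance] laxBicategory in
theorem laxStrict : Bicategory.Strict (LocallyDiscrete J ⥤ᴸ Cat.{v, u}) where
  id_comp σ := laxTrans_ext rfl fun f => heq_of_eq <| cat_hom₂_ext fun x => by
    refine (laxTrans_comp_app J (Lax.LaxTrans.id _) σ f x).trans ?_
    exact (congrArg (_ ≫ ·) ((congrArg _ (laxTrans_id_app J _ f x)).trans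
      (CategoryTheory.Functor.map_id _ _))).trans (Category.comp_id _)
  comp_id σ := laxTrans_ext rfl fun f => heq_of_eq <| cat_hom₂_ext fun x => by
    refine (laxTrans_comp_app J σ (Lax.LaxTrans.id _) f x).trans ?_
    exact (congrArg (· ≫ _) (laxTrans_id_app J _ f _)).trans (Category.id_comp _)
  assoc σ τ υ := laxTrans_ext rfl fun f => heq_of_eq <| cat_hom₂_ext fun x => by
    refine (laxTrans_comp_app J (Lax.LaxTrans.vComp σ τ) υ f x).trans ?_
    refine Eq.trans ?_ (laxTrans_comp_app J σ (Lax.LaxTrans.vComp τ υ) f x).symm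
    exact (congrArg (_ ≫ ·) ((congrArg _ (laxTrans_comp_app J σ τ f x)).trans
      (Functor.map_comp _ _ _))).trans ((Category.assoc _ _ _).symm.trans
      (congrArg (· ≫ _) (laxTrans_comp_app J τ υ f _).symm))
  leftUnitor_eqToIso σ := Iso.ext <| Lax.LaxTrans.homCategory.ext fun x => by
    rw [eqToIso.hom, laxTrans_eqToHom_app]
    exact congrArg Iso.hom (Strict.leftUnitor_eqToIso (Lax.LaxTrans.app σ x))
  rightUnitor_eqToIso σ := Iso.ext <| Lax.LaxTrans.homCategory.ext fun x => by
    rw [eqToIso.hom, laxTrans_eqToHom_app]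
    exact congrArg Iso.hom (Strict.rightUnitor_eqToIso (Lax.LaxTrans.app σ x))
  associator_eqToIso σ τ υ := Iso.ext <| Lax.LaxTrans.homCategory.ext fun x => by
    rw [eqToIso.hom, laxTrans_eqToHom_app]
    exact congrArg Iso.hom (Strict.associator_eqToIso (Lax.LaxTrans.app σ x)
      (Lax.LaxTrans.app τ x) (Lax.LaxTrans.app υ x))

lemma oplaxTrans_comp_app {F G H : LocallyDiscrete J ⥤ᴸ Cat.{v, u}} (σ : Lax.OplaxTrans F G)
    (τ : Lax.OplaxTrans G H) {a b : LocallyDiscrete J} (f : a ⟶ b) (x : F.obj a) :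
    ((σ.vComp τ).naturality f).toNatTrans.app x =
      (τ.app b).toFunctor.map ((σ.naturality f).toNatTrans.app x) ≫
        (τ.naturality f).toNatTrans.app ((σ.app a).toFunctor.obj x) := by
  simp [Lax.OplaxTrans.vComp]

lemma oplaxTrans_id_app (F : LocallyDiscrete J ⥤ᴸ Cat.{v, u}) {a b : LocallyDiscrete J}
    (f : a ⟶ b) (x : F.obj a) :
    ((Lax.OplaxTrans.id F).naturality f).toNatTrans.app x = 𝟙 ((F.map f).toFunctor.obj x) := by
  simp [Lax.OplaxTrans.id]

attribute [local instance] oplaxBicategory in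
lemma oplaxTrans_eqToHom_app {F G : LocallyDiscrete J ⥤ᴸ Cat.{v, u}} {σ τ : F ⟶ G} (h : σ = τ)
    (x : LocallyDiscrete J) :
    Lax.OplaxTrans.Modification.app (Lax.OplaxTrans.Hom.as (eqToHom h)) x =
      eqToHom (congrFun (congrArg Lax.OplaxTrans.app h) x) := by
  subst h; rfl

attribute [local instance] oplaxBicategory in
theorem oplaxStrict : Bicategory.Strict (LocallyDiscrete J ⥤ᴸ Cat.{v, u}) where
  id_comp σ := oplaxTrans_ext rfl fun f => heq_of_eq <| cat_hom₂_ext fun x => by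
    refine (oplaxTrans_comp_app J (Lax.OplaxTrans.id _) σ f x).trans ?_
    exact (congrArg (· ≫ _) ((congrArg _ (oplaxTrans_id_app J _ f x)).trans
      (CategoryTheory.Functor.map_id _ _))).trans (Category.id_comp _)
  comp_id σ := oplaxTrans_ext rfl fun f => heq_of_eq <| cat_hom₂_ext fun x => by
    refine (oplaxTrans_comp_app J σ (Lax.OplaxTrans.id _) f x).trans ?_
    exact (congrArg (_ ≫ ·) (oplaxTrans_id_app J _ f _)).trans (Category.comp_id _)
  assoc σ τ υ := oplaxTrans_ext rfl fun f => heq_of_eq <| cat_hom₂_ext fun x => by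
    refine (oplaxTrans_comp_app J (Lax.OplaxTrans.vComp σ τ) υ f x).trans ?_
    refine Eq.trans ?_ (oplaxTrans_comp_app J σ (Lax.OplaxTrans.vComp τ υ) f x).symm
    exact (congrArg (· ≫ _) ((congrArg _ (oplaxTrans_comp_app J σ τ f x)).trans
      (Functor.map_comp _ _ _))).trans ((Category.assoc _ _ _).trans
      (congrArg (_ ≫ ·) (oplaxTrans_comp_app J τ υ f _).symm))
  leftUnitor_eqToIso σ := Iso.ext <| Lax.OplaxTrans.homCategory.ext fun x => by
    rw [eqToIso.hom, oplaxTrans_eqToHom_app]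
    exact congrArg Iso.hom (Strict.leftUnitor_eqToIso (Lax.OplaxTrans.app σ x))
  rightUnitor_eqToIso σ := Iso.ext <| Lax.OplaxTrans.homCategory.ext fun x => by
    rw [eqToIso.hom, oplaxTrans_eqToHom_app]
    exact congrArg Iso.hom (Strict.rightUnitor_eqToIso (Lax.OplaxTrans.app σ x))
  associator_eqToIso σ τ υ := Iso.ext <| Lax.OplaxTrans.homCategory.ext fun x => by
    rw [eqToIso.hom, oplaxTrans_eqToHom_app]
    exact congrArg Iso.hom (Strict.associator_eqToIso (Lax.OplaxTrans.app σ x)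
      (Lax.OplaxTrans.app τ x) (Lax.OplaxTrans.app υ x))

end

/-- An opindexed category over `B` whose direct image functors are left adjoints. -/
structure LeftOpIndexed (B : Type u) [Category.{v} B] where
  toPseudofunctor : LocallyDiscrete B ⥤ᵖ Cat.{v, u}
  isLeftAdjoint : ∀ {a b : LocallyDiscrete B} (f : a ⟶ b),
    (toPseudofunctor.map f).toFunctor.IsLeftAdjoint

/-- An indexed category over `B` whose inverse image functors are right adjoints. -/
structure RightIndexed (B : Type u) [Category.{v} B] where
  toPseudofunctor : LocallyDiscrete Bᵒᵖ ⥤ᵖ Cat.{v, u}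
  isRightAdjoint : ∀ {a b : LocallyDiscrete Bᵒᵖ} (f : a ⟶ b),
    (toPseudofunctor.map f).toFunctor.IsRightAdjoint

/-- The 2-category of opindexed categories over `B` whose direct image functors are left adjoints,
with lax transformations and modifications. -/
def LeftOPIND (B : Type u) [Category.{v} B] :=
  InducedBicategory (LocallyDiscrete B ⥤ᴸ Cat.{v, u})
    (fun F : LeftOpIndexed B => F.toPseudofunctor.toLax)

/-- The 2-category of indexed categories over `B` whose inverse image functors are right adjoints,
with oplax transformations and modifications. -/
def RightIND (B : Type u) [Category.{v} B] :=
  InducedBicategory (LocallyDiscrete Bᵒᵖ ⥤ᴸ Cat.{v, u})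
    (fun F : RightIndexed B => F.toPseudofunctor.toLax)

section

variable (B : Type u) [Category.{v} B]

instance : Bicategory (LeftOPIND B) :=
  @InducedBicategory.bicategory _ _ (laxBicategory B) _

instance : Bicategory.Strict (LeftOPIND B) :=
  @InducedBicategory.instStrict _ _ (laxBicategory B) _ (laxStrict B)

instance : Bicategory (RightIND B) :=
  @InducedBicategory.bicategory _ _ (oplaxBicategory Bᵒᵖ) _

instance : Bicategory.Strict (RightIND B) :=
  @InducedBicategory.instStrict _ _ (oplaxBicategory Bᵒᵖ) _ (oplaxStrict Bᵒᵖ)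

end

section

lemma id_comp_cancel {C : Type u} [Category.{v} C] {a b c d : C} (f : a ⟶ b) (g : b ⟶ c)
    (h : c ⟶ d) : 𝟙 a ≫ f ≫ 𝟙 b ≫ g ≫ 𝟙 c ≫ h = f ≫ g ≫ h := by
  simp only [Category.id_comp]

variable {J : Type u} [Category.{v} J] {F G : LocallyDiscrete J ⥤ᵖ Cat.{v, u}}

lemma laxTrans_unit (σ : Lax.LaxTrans F.toLax G.toLax) (a : LocallyDiscrete J) (x : F.obj a) :
    (G.mapId a).inv.toNatTrans.app ((σ.app a).toFunctor.obj x) ≫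
      (σ.naturality (𝟙 a)).toNatTrans.app x =
    (σ.app a).toFunctor.map ((F.mapId a).inv.toNatTrans.app x) := by
  have := congrArg (fun m => Cat.Hom₂.toNatTrans m) (σ.naturality_id a)
  exact (NatTrans.congr_app this x).trans ((Category.id_comp _).trans (Category.id_comp _))

lemma laxTrans_assoc (σ : Lax.LaxTrans F.toLax G.toLax) {a b c : LocallyDiscrete J} (f : a ⟶ b)
    (g : b ⟶ c) (x : F.obj a) :
    (G.mapComp f g).inv.toNatTrans.app ((σ.app a).toFunctor.obj x) ≫
      (σ.naturality (f ≫ g)).toNatTrans.app x =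
    (G.map g).toFunctor.map ((σ.naturality f).toNatTrans.app x) ≫
      (σ.naturality g).toNatTrans.app ((F.map f).toFunctor.obj x) ≫
        (σ.app c).toFunctor.map ((F.mapComp f g).inv.toNatTrans.app x) := by
  have := congrArg (fun m => Cat.Hom₂.toNatTrans m) (σ.naturality_comp f g)
  exact (NatTrans.congr_app this x).trans (id_comp_cancel _ _ _)

lemma oplaxTrans_unit (σ : Lax.OplaxTrans F.toLax G.toLax) (a : LocallyDiscrete J)
    (x : F.obj a) :
    (σ.app a).toFunctor.map ((F.mapId a).inv.toNatTrans.app x) ≫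
      (σ.naturality (𝟙 a)).toNatTrans.app x =
    (G.mapId a).inv.toNatTrans.app ((σ.app a).toFunctor.obj x) := by
  have := congrArg (fun m => Cat.Hom₂.toNatTrans m) (σ.naturality_id a)
  exact (NatTrans.congr_app this x).trans ((Category.id_comp _).trans (Category.id_comp _))

lemma oplaxTrans_assoc (σ : Lax.OplaxTrans F.toLax G.toLax) {a b c : LocallyDiscrete J}
    (f : a ⟶ b) (g : b ⟶ c) (x : F.obj a) :
    (σ.app c).toFunctor.map ((F.mapComp f g).inv.toNatTrans.app x) ≫
      (σ.naturality (f ≫ g)).toNatTrans.app x =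
    (σ.naturality g).toNatTrans.app ((F.map f).toFunctor.obj x) ≫
      (G.map g).toFunctor.map ((σ.naturality f).toNatTrans.app x) ≫
        (G.mapComp f g).inv.toNatTrans.app ((σ.app a).toFunctor.obj x) := by
  have := congrArg (fun m => Cat.Hom₂.toNatTrans m) (σ.naturality_comp f g)
  exact (NatTrans.congr_app this x).trans (id_comp_cancel _ _ _)

end

section

variable {J : Type u} [Category.{v} J]

lemma catIso_hom_inv {C D : Cat.{v, u}} {F G : C ⟶ D} (e : F ≅ G) (x : C) :
    e.hom.toNatTrans.app x ≫ e.inv.toNatTrans.app x = 𝟙 _ :=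
  NatTrans.congr_app (congrArg (fun m => Cat.Hom₂.toNatTrans m) e.hom_inv_id) x

lemma catIso_inv_hom {C D : Cat.{v, u}} {F G : C ⟶ D} (e : F ≅ G) (x : C) :
    e.inv.toNatTrans.app x ≫ e.hom.toNatTrans.app x = 𝟙 _ :=
  NatTrans.congr_app (congrArg (fun m => Cat.Hom₂.toNatTrans m) e.inv_hom_id) x

/-- The component of an isomorphism between arrows of `Cat`. -/
@[simps]
def catIsoApp {C D : Cat.{v, u}} {F G : C ⟶ D} (e : F ≅ G) (x : C) :
    F.toFunctor.obj x ≅ G.toFunctor.obj x where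
  hom := e.hom.toNatTrans.app x
  inv := e.inv.toNatTrans.app x
  hom_inv_id := catIso_hom_inv e x
  inv_hom_id := catIso_inv_hom e x

section

variable {C D E : Type u} [Category.{v} C] [Category.{v} D] [Category.{v} E]

lemma map_comp_aux (S : C ⥤ D) (T : E ⥤ D) {x y z w : C} {e₀ e₁ e₂ : E} {d : D} {f : x ⟶ y}
    {k : y ⟶ z} {m : z ⟶ w} {n : S.obj w ⟶ d} {r : S.obj z ⟶ T.obj e₁} {p : e₁ ⟶ e₂}
    {q : T.obj e₂ ⟶ d} {s : S.obj y ⟶ T.obj e₀} {t : e₀ ⟶ e₁}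
    (h : S.map m ≫ n = r ≫ T.map p ≫ q) (h' : S.map k ≫ r = s ≫ T.map t) :
    S.map (f ≫ k ≫ m) ≫ n = (S.map f ≫ s) ≫ T.map (t ≫ p) ≫ q := by
  simp only [Functor.map_comp, Category.assoc, h]
  rw [reassoc_of% h']

lemma map_id_aux' (S : C ⥤ D) {x y : C} {d d' : D} (e : d ≅ d') (i : x ≅ y)
    {n : d ⟶ S.obj x} {s : d' ⟶ S.obj y} (h : e.inv ≫ n = s ≫ S.map i.inv) :
    n ≫ S.map i.hom = e.hom ≫ s := by
  rw [← cancel_epi e.inv, reassoc_of% h, ← S.map_comp, i.inv_hom_id, S.map_id, Category.comp_id,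
    e.inv_hom_id_assoc]

lemma map_comp_aux' (S : C ⥤ D) (T : E ⥤ D) {x y z w : C} {e₀ e₁ e₂ : E} {d : D} (i : x ≅ y)
    {k : y ⟶ z} {m : z ⟶ w} (e : d ≅ T.obj e₀) {n : d ⟶ S.obj x} {r : T.obj e₁ ⟶ S.obj y}
    {r' : T.obj e₂ ⟶ S.obj z} {p : e₀ ⟶ e₁} {t : e₁ ⟶ e₂}
    (h : e.inv ≫ n = T.map p ≫ r ≫ S.map i.inv) (h' : T.map t ≫ r' = r ≫ S.map k) :
    n ≫ S.map (i.hom ≫ k ≫ m) = e.hom ≫ T.map (p ≫ t) ≫ r' ≫ S.map m := by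
  have h₁ := map_id_aux' S e i (s := T.map p ≫ r) (by simpa using h)
  rw [S.map_comp, reassoc_of% h₁, T.map_comp, Category.assoc, reassoc_of% h', S.map_comp]

end

/-- The functor between Grothendieck op-constructions induced by a lax transformation. -/
def opGrothendieckMap {F G : LocallyDiscrete J ⥤ᵖ Cat.{v, u}}
    (σ : Lax.LaxTrans F.toLax G.toLax) :
    Pseudofunctor.Grothendieck F ⥤ Pseudofunctor.Grothendieck G where
  obj a := ⟨a.base, (σ.app ⟨a.base⟩).toFunctor.obj a.fiber⟩
  map {a b} f := ⟨f.base, (σ.naturality f.base.toLoc).toNatTrans.app a.fiber ≫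
    (σ.app ⟨b.base⟩).toFunctor.map f.fiber⟩
  map_id a := by
    refine congrArg (Pseudofunctor.Grothendieck.Hom.mk _) ?_
    refine (map_id_aux' _ (catIsoApp (G.mapId ⟨a.base⟩) _) (catIsoApp (F.mapId ⟨a.base⟩) _)
      (s := 𝟙 _) ?_).trans (Category.comp_id _)
    exact (laxTrans_unit σ ⟨a.base⟩ a.fiber).trans (Category.id_comp _).symm
  map_comp {a b c} f g := by
    refine congrArg (Pseudofunctor.Grothendieck.Hom.mk _) ?_
    exact map_comp_aux' (σ.app ⟨c.base⟩).toFunctor (G.map g.base.toLoc).toFunctor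
      (catIsoApp (F.mapComp f.base.toLoc g.base.toLoc) _)
      (catIsoApp (G.mapComp f.base.toLoc g.base.toLoc) _)
      (laxTrans_assoc σ f.base.toLoc g.base.toLoc a.fiber)
      ((σ.naturality g.base.toLoc).toNatTrans.naturality f.fiber)

/-- The functor between Grothendieck constructions induced by an oplax transformation. -/
def grothendieckMap {F G : LocallyDiscrete Jᵒᵖ ⥤ᵖ Cat.{v, u}}
    (σ : Lax.OplaxTrans F.toLax G.toLax) :
    Pseudofunctor.CoGrothendieck F ⥤ Pseudofunctor.CoGrothendieck G where
  obj a := ⟨a.base, (σ.app ⟨op a.base⟩).toFunctor.obj a.fiber⟩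
  map {a b} f := ⟨f.base, (σ.app ⟨op a.base⟩).toFunctor.map f.fiber ≫
    (σ.naturality f.base.op.toLoc).toNatTrans.app b.fiber⟩
  map_id a := congrArg (Pseudofunctor.CoGrothendieck.Hom.mk _) (oplaxTrans_unit σ _ _)
  map_comp {a b c} f g := by
    refine congrArg (Pseudofunctor.CoGrothendieck.Hom.mk _) ?_
    exact map_comp_aux (σ.app ⟨op a.base⟩).toFunctor (G.map f.base.op.toLoc).toFunctor
      (oplaxTrans_assoc σ g.base.op.toLoc f.base.op.toLoc c.fiber)
      ((σ.naturality f.base.op.toLoc).toNatTrans.naturality g.fiber)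

lemma opGrothendieckMap_id (F : LocallyDiscrete J ⥤ᵖ Cat.{v, u}) :
    opGrothendieckMap (Lax.LaxTrans.id F.toLax) = 𝟭 _ := by
  refine Functor.hext (fun _ => rfl) fun x y f => heq_of_eq ?_
  refine congrArg (Pseudofunctor.Grothendieck.Hom.mk _) ?_
  exact (congrArg (· ≫ f.fiber) (laxTrans_id_app J F.toLax f.base.toLoc x.fiber)).trans
    (Category.id_comp _)

lemma opGrothendieckMap_comp {F G H : LocallyDiscrete J ⥤ᵖ Cat.{v, u}}
    (σ : Lax.LaxTrans F.toLax G.toLax) (τ : Lax.LaxTrans G.toLax H.toLax) :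
    opGrothendieckMap (σ.vComp τ) = opGrothendieckMap σ ⋙ opGrothendieckMap τ := by
  refine Functor.hext (fun _ => rfl) fun x y f => heq_of_eq ?_
  refine congrArg (Pseudofunctor.Grothendieck.Hom.mk _) ?_
  exact (congrArg (· ≫ _) (laxTrans_comp_app J σ τ f.base.toLoc x.fiber)).trans
    ((Category.assoc _ _ _).trans
      (congrArg (_ ≫ ·) ((τ.app ⟨y.base⟩).toFunctor.map_comp _ _).symm))

lemma grothendieckMap_id (F : LocallyDiscrete Jᵒᵖ ⥤ᵖ Cat.{v, u}) :
    grothendieckMap (Lax.OplaxTrans.id F.toLax) = 𝟭 _ := by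
  refine Functor.hext (fun _ => rfl) fun x y f => heq_of_eq ?_
  refine congrArg (Pseudofunctor.CoGrothendieck.Hom.mk _) ?_
  exact (congrArg (f.fiber ≫ ·) (oplaxTrans_id_app Jᵒᵖ F.toLax f.base.op.toLoc y.fiber)).trans
    (Category.comp_id _)

lemma grothendieckMap_comp {F G H : LocallyDiscrete Jᵒᵖ ⥤ᵖ Cat.{v, u}}
    (σ : Lax.OplaxTrans F.toLax G.toLax) (τ : Lax.OplaxTrans G.toLax H.toLax) :
    grothendieckMap (σ.vComp τ) = grothendieckMap σ ⋙ grothendieckMap τ := by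
  refine Functor.hext (fun _ => rfl) fun x y f => heq_of_eq ?_
  refine congrArg (Pseudofunctor.CoGrothendieck.Hom.mk _) ?_
  exact (congrArg (_ ≫ ·) (oplaxTrans_comp_app Jᵒᵖ σ τ f.base.op.toLoc y.fiber)).trans
    ((Category.assoc _ _ _).symm.trans
      (congrArg (· ≫ _) ((τ.app ⟨op x.base⟩).toFunctor.map_comp _ _).symm))

end

namespace OpG

variable {J : Type u} [Category.{v} J] {F G : LocallyDiscrete J ⥤ᵖ Cat.{v, u}}

/-- The morphism over an identity given by a morphism of a fibre. -/
def vert {A : J} {x y : F.obj ⟨A⟩} (m : x ⟶ y) :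
    (⟨A, x⟩ : Pseudofunctor.Grothendieck F) ⟶ ⟨A, y⟩ :=
  ⟨𝟙 A, (F.mapId ⟨A⟩).hom.toNatTrans.app x ≫ m⟩

lemma comp_vert {X : Pseudofunctor.Grothendieck F} {A : J} {x y : F.obj ⟨A⟩}
    (f : X ⟶ ⟨A, x⟩) (m : x ⟶ y) : f ≫ vert m = ⟨f.base, f.fiber ≫ m⟩ := by
  refine Eq.trans ?_ (congrArg (fun k : X ⟶ (⟨A, x⟩ : Pseudofunctor.Grothendieck F) =>
    (⟨k.base, k.fiber ≫ m⟩ : Pseudofunctor.Grothendieck.Hom X ⟨A, y⟩)) (Category.comp_id f))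
  refine congrArg (Pseudofunctor.Grothendieck.Hom.mk _) ?_
  exact ((Category.assoc _ _ _).trans
    (congrArg (_ ≫ ·) (Category.assoc _ _ _))).symm

lemma vert_comp {Y : Pseudofunctor.Grothendieck F} {A : J} {x y : F.obj ⟨A⟩}
    (m : x ⟶ y) (f : (⟨A, y⟩ : Pseudofunctor.Grothendieck F) ⟶ Y) :
    vert m ≫ f = ⟨f.base, (F.map f.base.toLoc).toFunctor.map m ≫ f.fiber⟩ := by
  let f' : (⟨A, x⟩ : Pseudofunctor.Grothendieck F) ⟶ Y :=
    ⟨f.base, (F.map f.base.toLoc).toFunctor.map m ≫ f.fiber⟩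
  refine Eq.trans ?_ (Category.id_comp f')
  refine congrArg (Pseudofunctor.Grothendieck.Hom.mk _) ?_
  refine congrArg (_ ≫ ·) ?_
  exact (congrArg (· ≫ _) ((F.map f.base.toLoc).toFunctor.map_comp _ _)).trans
    (Category.assoc _ _ _)

lemma vert_id {A : J} (x : F.obj ⟨A⟩) : vert (𝟙 x) = 𝟙 _ :=
  congrArg (Pseudofunctor.Grothendieck.Hom.mk _) (Category.comp_id _)

lemma vert_vert {A : J} {x y z : F.obj ⟨A⟩} (m : x ⟶ y) (n : y ⟶ z) :
    vert m ≫ vert n = vert (m ≫ n) :=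
  (comp_vert _ _).trans (congrArg (Pseudofunctor.Grothendieck.Hom.mk _) (Category.assoc _ _ _))

lemma map_vert (σ : Lax.LaxTrans F.toLax G.toLax) {A : J} {x y : F.obj ⟨A⟩} (m : x ⟶ y) :
    (opGrothendieckMap σ).map (vert m) = vert ((σ.app ⟨A⟩).toFunctor.map m) := by
  have := congrArg (fun k => k ≫ vert (F := G) ((σ.app ⟨A⟩).toFunctor.map m))
    ((opGrothendieckMap σ).map_id ⟨A, x⟩)
  refine Eq.trans ?_ (this.trans (Category.id_comp _))
  refine Eq.trans ?_ (comp_vert _ _).symm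
  refine congrArg (Pseudofunctor.Grothendieck.Hom.mk _) ?_
  exact (congrArg (_ ≫ ·) ((σ.app ⟨A⟩).toFunctor.map_comp _ _)).trans (Category.assoc _ _ _).symm

/-- The natural transformation induced by a modification of lax transformations. -/
def mapModification {σ τ : Lax.LaxTrans F.toLax G.toLax} (Ξ : Lax.LaxTrans.Modification σ τ) :
    opGrothendieckMap σ ⟶ opGrothendieckMap τ where
  app a := vert ((Ξ.app ⟨a.base⟩).toNatTrans.app a.fiber)
  naturality a b f := by
    refine (comp_vert _ _).trans (Eq.trans ?_ (vert_comp _ _).symm)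
    refine congrArg (Pseudofunctor.Grothendieck.Hom.mk _) ?_
    have h := (Ξ.app ⟨b.base⟩).toNatTrans.naturality f.fiber
    have h' := NatTrans.congr_app
      (congrArg (fun m => Cat.Hom₂.toNatTrans m) (Ξ.naturality f.base.toLoc)) a.fiber
    exact (Category.assoc _ _ _).trans ((congrArg (_ ≫ ·) h).trans
      ((Category.assoc _ _ _).symm.trans ((congrArg (· ≫ _) h'.symm).trans
      (Category.assoc _ _ _))))

end OpG

namespace CoG

variable {J : Type u} [Category.{v} J] {F G : LocallyDiscrete Jᵒᵖ ⥤ᵖ Cat.{v, u}}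

/-- The morphism over an identity given by a morphism of a fibre. -/
def vert {A : J} {x y : F.obj ⟨op A⟩} (m : x ⟶ y) :
    (⟨A, x⟩ : Pseudofunctor.CoGrothendieck F) ⟶ ⟨A, y⟩ :=
  ⟨𝟙 A, m ≫ (F.mapId ⟨op A⟩).inv.toNatTrans.app y⟩

lemma vert_comp {Y : Pseudofunctor.CoGrothendieck F} {A : J} {x y : F.obj ⟨op A⟩}
    (m : x ⟶ y) (f : (⟨A, y⟩ : Pseudofunctor.CoGrothendieck F) ⟶ Y) :
    vert m ≫ f = ⟨f.base, m ≫ f.fiber⟩ := by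
  refine Eq.trans ?_ (congrArg (fun k : (⟨A, y⟩ : Pseudofunctor.CoGrothendieck F) ⟶ Y =>
    (⟨k.base, m ≫ k.fiber⟩ : Pseudofunctor.CoGrothendieck.Hom ⟨A, x⟩ Y)) (Category.id_comp f))
  refine congrArg (Pseudofunctor.CoGrothendieck.Hom.mk _) ?_
  exact Category.assoc _ _ _

lemma comp_vert {X : Pseudofunctor.CoGrothendieck F} {A : J} {x y : F.obj ⟨op A⟩}
    (f : X ⟶ ⟨A, x⟩) (m : x ⟶ y) :
    f ≫ vert m = ⟨f.base, f.fiber ≫ (F.map f.base.op.toLoc).toFunctor.map m⟩ := by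
  let f' : X ⟶ (⟨A, y⟩ : Pseudofunctor.CoGrothendieck F) :=
    ⟨f.base, f.fiber ≫ (F.map f.base.op.toLoc).toFunctor.map m⟩
  refine Eq.trans ?_ (Category.comp_id f')
  refine congrArg (Pseudofunctor.CoGrothendieck.Hom.mk _) ?_
  refine Eq.trans (congrArg (_ ≫ ·) ?_) (Category.assoc _ _ _).symm
  exact (congrArg (· ≫ _) ((F.map f.base.op.toLoc).toFunctor.map_comp _ _)).trans
    (Category.assoc _ _ _)

lemma vert_id {A : J} (x : F.obj ⟨op A⟩) : vert (𝟙 x) = 𝟙 _ :=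
  congrArg (Pseudofunctor.CoGrothendieck.Hom.mk _) (Category.id_comp _)

lemma vert_vert {A : J} {x y z : F.obj ⟨op A⟩} (m : x ⟶ y) (n : y ⟶ z) :
    vert m ≫ vert n = vert (m ≫ n) :=
  (vert_comp _ _).trans
    (congrArg (Pseudofunctor.CoGrothendieck.Hom.mk _) (Category.assoc _ _ _).symm)

lemma map_vert (σ : Lax.OplaxTrans F.toLax G.toLax) {A : J} {x y : F.obj ⟨op A⟩} (m : x ⟶ y) :
    (grothendieckMap σ).map (vert m) = vert ((σ.app ⟨op A⟩).toFunctor.map m) := by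
  have := congrArg (fun k => vert (F := G) ((σ.app ⟨op A⟩).toFunctor.map m) ≫ k)
    ((grothendieckMap σ).map_id ⟨A, y⟩)
  refine Eq.trans ?_ (this.trans (Category.comp_id _))
  refine Eq.trans ?_ (vert_comp _ _).symm
  refine congrArg (Pseudofunctor.CoGrothendieck.Hom.mk _) ?_
  exact (congrArg (· ≫ _) ((σ.app ⟨op A⟩).toFunctor.map_comp _ _)).trans (Category.assoc _ _ _)

/-- The natural transformation induced by a modification of oplax transformations. -/
def mapModification {σ τ : Lax.OplaxTrans F.toLax G.toLax}
    (Ξ : Lax.OplaxTrans.Modification σ τ) : grothendieckMap σ ⟶ grothendieckMap τ where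
  app a := vert ((Ξ.app ⟨op a.base⟩).toNatTrans.app a.fiber)
  naturality a b f := by
    refine (comp_vert _ _).trans (Eq.trans ?_ (vert_comp _ _).symm)
    refine congrArg (Pseudofunctor.CoGrothendieck.Hom.mk _) ?_
    have h := (Ξ.app ⟨op a.base⟩).toNatTrans.naturality f.fiber
    have h' := NatTrans.congr_app
      (congrArg (fun m => Cat.Hom₂.toNatTrans m) (Ξ.naturality f.base.op.toLoc)) b.fiber
    exact (Category.assoc _ _ _).trans ((congrArg (_ ≫ ·) h'.symm).trans
      ((Category.assoc _ _ _).symm.trans ((congrArg (· ≫ _) h).trans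
      (Category.assoc _ _ _))))

end CoG

/-! ### Bifibrations and the two Grothendieck constructions -/

section

variable {C D : Type u} [Category.{v} C] [Category.{v} D]

lemma lift_aux₁ (T : C ⥤ D) {x : C} {d e : D} (i : e ≅ T.obj x) (h : e ⟶ d) (m : T.obj x ⟶ d) :
    i.hom ≫ T.map (𝟙 x) ≫ m = h ↔ m = i.inv ≫ h := by
  rw [T.map_id, Category.id_comp, Iso.eq_inv_comp]

lemma lift_aux₂ {L : C ⥤ D} {R : D ⥤ C} (adj : L ⊣ R) {x : C} {d e : D} (i : e ≅ L.obj x)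
    (h : e ⟶ d) (m : x ⟶ R.obj d) :
    i.hom ≫ L.map m ≫ adj.counit.app d = h ↔ m = adj.homEquiv _ _ (i.inv ≫ h) := by
  rw [← Equiv.symm_apply_eq, Adjunction.homEquiv_counit, Iso.eq_inv_comp]

lemma lift_aux₃ {L : C ⥤ D} {R : D ⥤ C} (adj : L ⊣ R) {x e : C} {y : D} (i : e ≅ R.obj y)
    (h : x ⟶ e) (m : L.obj x ⟶ y) :
    adj.unit.app x ≫ R.map m ≫ i.inv = h ↔ m = (adj.homEquiv _ _).symm (h ≫ i.hom) := by
  rw [← Category.assoc, Iso.comp_inv_eq, Equiv.eq_symm_apply, Adjunction.homEquiv_unit]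

end

section

variable {J : Type u} [Category.{v} J]

lemma isFibered_of_lifts {X : Type u} [Category.{v} X] {p : X ⥤ J}
    (h : ∀ (a : X) (R : J) (f : R ⟶ p.obj a), ∃ (b : X) (e : p.obj b = R) (φ : b ⟶ a),
      p.map φ = eqToHom e ≫ f ∧ ∀ (c : X) (g : p.obj c ⟶ p.obj b) (ψ : c ⟶ a),
        p.map ψ = g ≫ p.map φ → ∃! χ : c ⟶ b, p.map χ = g ∧ χ ≫ φ = ψ) : p.IsFibered := by
  refine Functor.IsFibered.of_exists_isStronglyCartesian fun a R f => ?_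
  obtain ⟨b, rfl, φ, hφ, hu⟩ := h a R f
  obtain rfl : p.map φ = f := by simpa using hφ
  refine ⟨b, φ, ⟨fun {c} g ψ hψ => ?_⟩⟩
  have e := IsHomLift.eq_of_isHomLift p (g ≫ p.map φ) ψ
  obtain ⟨χ, ⟨h₁, h₂⟩, h₃⟩ := hu c g ψ e.symm
  refine ⟨χ, ⟨?_, h₂⟩, fun χ' hχ' => h₃ χ' ⟨?_, hχ'.2⟩⟩
  · subst h₁; infer_instance
  · have := hχ'.1
    exact (IsHomLift.eq_of_isHomLift p g χ').symm

lemma isFibered_op_of_lifts {X : Type u} [Category.{v} X] {p : X ⥤ J}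
    (h : ∀ (a : X) (R : J) (f : p.obj a ⟶ R), ∃ (b : X) (e : R = p.obj b) (φ : a ⟶ b),
      p.map φ = f ≫ eqToHom e ∧ ∀ (c : X) (g : p.obj b ⟶ p.obj c) (ψ : a ⟶ c),
        p.map ψ = p.map φ ≫ g → ∃! χ : b ⟶ c, p.map χ = g ∧ φ ≫ χ = ψ) : p.op.IsFibered := by
  refine isFibered_of_lifts fun a R f => ?_
  obtain ⟨b, e, φ, hφ, hu⟩ := h a.unop R.unop f.unop
  refine ⟨op b, congrArg op e.symm, φ.op, ?_, fun c g ψ hψ => ?_⟩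
  · refine (congrArg Quiver.Hom.op hφ).trans ?_
    rw [op_comp, eqToHom_op]
    rfl
  · obtain ⟨χ, ⟨h₁, h₂⟩, h₃⟩ := hu c.unop g.unop ψ.unop (congrArg Quiver.Hom.unop hψ)
    refine ⟨χ.op, ⟨congrArg Quiver.Hom.op h₁, congrArg Quiver.Hom.op h₂⟩, fun χ' hχ' => ?_⟩
    exact congrArg Quiver.Hom.op (h₃ χ'.unop
      ⟨congrArg Quiver.Hom.unop hχ'.1, congrArg Quiver.Hom.unop hχ'.2⟩)

lemma opGrothendieck_isOpfibered (F : LocallyDiscrete J ⥤ᵖ Cat.{v, u}) :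
    (Pseudofunctor.Grothendieck.forget F).op.IsFibered := by
  refine isFibered_op_of_lifts fun a R f => ⟨⟨R, (F.map f.toLoc).toFunctor.obj a.fiber⟩, rfl,
    ⟨f, 𝟙 _⟩, (Category.comp_id _).symm, ?_⟩
  rintro c g ⟨k, h⟩ (rfl : k = f ≫ g)
  let i := catIsoApp (F.mapComp f.toLoc g.toLoc) a.fiber
  have key : ∀ m : (F.map g.toLoc).toFunctor.obj ((F.map f.toLoc).toFunctor.obj a.fiber) ⟶ c.fiber,
      i.hom ≫ (F.map g.toLoc).toFunctor.map (𝟙 _) ≫ m = h ↔ m = i.inv ≫ h := fun m => lift_aux₁ (F.map g.toLoc).toFunctor i h m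
  refine ⟨⟨g, i.inv ≫ h⟩, ⟨rfl, congrArg (Pseudofunctor.Grothendieck.Hom.mk _)
    ((key _).2 rfl)⟩, ?_⟩
  rintro ⟨g', m⟩ ⟨rfl : g' = g, hm⟩
  have := (Pseudofunctor.Grothendieck.Hom.mk.injEq _ _ _ _).mp hm
  exact congrArg (Pseudofunctor.Grothendieck.Hom.mk _) ((key m).1 (eq_of_heq this.2))

lemma opGrothendieck_isFibered (F : LocallyDiscrete J ⥤ᵖ Cat.{v, u})
    (hF : ∀ {a b : LocallyDiscrete J} (f : a ⟶ b), (F.map f).toFunctor.IsLeftAdjoint) :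
    (Pseudofunctor.Grothendieck.forget F).IsFibered := by
  refine isFibered_of_lifts fun a R f => ?_
  have := hF f.toLoc
  let adj := Adjunction.ofIsLeftAdjoint (F.map f.toLoc).toFunctor
  refine ⟨⟨R, (F.map f.toLoc).toFunctor.rightAdjoint.obj a.fiber⟩, rfl,
    ⟨f, adj.counit.app a.fiber⟩, (Category.id_comp _).symm, ?_⟩
  rintro c g ⟨k, h⟩ (rfl : k = g ≫ f)
  let i := catIsoApp (F.mapComp g.toLoc f.toLoc) c.fiber
  have key : ∀ m : (F.map g.toLoc).toFunctor.obj c.fiber ⟶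
      (F.map f.toLoc).toFunctor.rightAdjoint.obj a.fiber,
      i.hom ≫ (F.map f.toLoc).toFunctor.map m ≫ adj.counit.app a.fiber = h ↔
        m = adj.homEquiv _ _ (i.inv ≫ h) := fun m => lift_aux₂ adj i h m
  refine ⟨⟨g, adj.homEquiv _ _ (i.inv ≫ h)⟩, ⟨rfl, congrArg (Pseudofunctor.Grothendieck.Hom.mk _)
    ((key _).2 rfl)⟩, ?_⟩
  rintro ⟨g', m⟩ ⟨rfl : g' = g, hm⟩
  have := (Pseudofunctor.Grothendieck.Hom.mk.injEq _ _ _ _).mp hm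
  exact congrArg (Pseudofunctor.Grothendieck.Hom.mk _) ((key m).1 (eq_of_heq this.2))

lemma grothendieck_isOpfibered (F : LocallyDiscrete Jᵒᵖ ⥤ᵖ Cat.{v, u})
    (hF : ∀ {a b : LocallyDiscrete Jᵒᵖ} (f : a ⟶ b), (F.map f).toFunctor.IsRightAdjoint) :
    (Pseudofunctor.CoGrothendieck.forget F).op.IsFibered := by
  refine isFibered_op_of_lifts fun a R f => ?_
  have := hF f.op.toLoc
  let adj := Adjunction.ofIsRightAdjoint (F.map f.op.toLoc).toFunctor
  refine ⟨⟨R, (F.map f.op.toLoc).toFunctor.leftAdjoint.obj a.fiber⟩, rfl,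
    ⟨f, adj.unit.app a.fiber⟩, (Category.comp_id _).symm, ?_⟩
  rintro c g ⟨k, h⟩ (rfl : k = f ≫ g)
  let i := catIsoApp (F.mapComp g.op.toLoc f.op.toLoc) c.fiber
  have key : ∀ m : (F.map f.op.toLoc).toFunctor.leftAdjoint.obj a.fiber ⟶
      (F.map g.op.toLoc).toFunctor.obj c.fiber,
      adj.unit.app a.fiber ≫ (F.map f.op.toLoc).toFunctor.map m ≫ i.inv = h ↔
        m = (adj.homEquiv _ _).symm (h ≫ i.hom) := fun m => lift_aux₃ adj i h m
  refine ⟨⟨g, (adj.homEquiv _ _).symm (h ≫ i.hom)⟩, ⟨rfl,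
    congrArg (Pseudofunctor.CoGrothendieck.Hom.mk _) ((key _).2 rfl)⟩, ?_⟩
  rintro ⟨g', m⟩ ⟨rfl : g' = g, hm⟩
  have := (Pseudofunctor.CoGrothendieck.Hom.mk.injEq _ _ _ _).mp hm
  exact congrArg (Pseudofunctor.CoGrothendieck.Hom.mk _) ((key m).1 (eq_of_heq this.2))

end

/-- A bifibration over `B`: a functor to `B` that is a fibration and an opfibration, the latter
meaning that its opposite is a fibration. -/
structure Bifibration (B : Type u) [Category.{v} B] where
  toBased : BasedCategory.{v, u} B
  isFibered : toBased.p.IsFibered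
  isOpfibered : toBased.p.op.IsFibered

/-- The 2-category of bifibrations over `B`, functors over `B` and natural transformations
over `B`. -/
abbrev BIFIB (B : Type u) [Category.{v} B] :=
  InducedBicategory (BasedCategory.{v, u} B) (Bifibration.toBased (B := B))

section

variable {B : Type u} [Category.{v} B]

lemma bifib_hom_ext {X Y : BIFIB B} {F G : X ⟶ Y}
    (h : BasedFunctor.toFunctor F.hom = BasedFunctor.toFunctor G.hom) : F = G := by
  obtain ⟨F, _⟩ := F
  obtain ⟨G, _⟩ := G
  obtain rfl : F = G := h
  rfl

lemma bifib_hom₂_ext {X Y : BIFIB B} {F G : X ⟶ Y} {α β : F ⟶ G}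
    (h : ∀ x, (BasedNatTrans.toNatTrans α.hom).app x = (BasedNatTrans.toNatTrans β.hom).app x) :
    α = β :=
  InducedBicategory.hom₂_ext (BasedNatTrans.ext _ _ (NatTrans.ext (funext h)))

lemma bifib_eqToHom_app {X Y : BIFIB B} {F G : X ⟶ Y} (h : F = G) (x : X.toBased.obj) :
    (BasedNatTrans.toNatTrans (eqToHom h).hom).app x =
      eqToHom (by rw [h]) := by
  subst h; rfl

/-- A conjugate by equalities of a 2-cell between bifibrations is determined by its components. -/
lemma bifib_conj {X Y : BIFIB B} {F F' G G' : X ⟶ Y} (hF : F = F') (hG : G' = G) (α : F ⟶ G)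
    (β : F' ⟶ G')
    (h : ∀ x, HEq ((BasedNatTrans.toNatTrans α.hom).app x)
      ((BasedNatTrans.toNatTrans β.hom).app x)) :
    α = eqToHom hF ≫ β ≫ eqToHom hG := by
  subst hF hG
  simp only [eqToHom_refl, Category.comp_id, Category.id_comp]
  exact bifib_hom₂_ext fun x => eq_of_heq (h x)

variable (B)

attribute [local instance] laxBicategory in
/-- The Grothendieck op-construction: a morphism over `f : A ⟶ B` from `(A, x)` to `(B, y)` is a
morphism from the direct image of `x` under `f` to `y`. -/
def opGrothendieck : StrictPseudofunctor (LeftOPIND B) (BIFIB B) :=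
  StrictPseudofunctor.mk''
    { obj := fun F =>
        ⟨BasedCategory.ofFunctor (Pseudofunctor.Grothendieck.forget F.toPseudofunctor),
          opGrothendieck_isFibered _ F.isLeftAdjoint, opGrothendieck_isOpfibered _⟩
      map := fun σ => InducedBicategory.mkHom
        { toFunctor := opGrothendieckMap σ.hom
          w := rfl }
      map₂ := fun Ξ => InducedBicategory.mkHom₂
        { toNatTrans := OpG.mapModification Ξ.hom.as
          isHomLift' := fun a => IsHomLift.map _ (OpG.vert _) }
      map₂_id := fun σ => bifib_hom₂_ext fun x => OpG.vert_id _
      map₂_comp := fun Ξ Θ => bifib_hom₂_ext fun x => (OpG.vert_vert _ _).symm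
      map_id := fun F => bifib_hom_ext (opGrothendieckMap_id F.toPseudofunctor)
      map_comp := fun σ τ => bifib_hom_ext (opGrothendieckMap_comp σ.hom τ.hom)
      map₂_whisker_left := fun σ τ υ Ξ => bifib_conj _ _ _ _ fun x => HEq.rfl
      map₂_whisker_right := fun Ξ τ => bifib_conj _ _ _ _ fun x =>
        heq_of_eq (OpG.map_vert τ.hom _).symm }

attribute [local instance] oplaxBicategory in
/-- The Grothendieck construction: a morphism over `f : A ⟶ B` from `(A, x)` to `(B, y)` is a
morphism from `x` to the inverse image of `y` under `f`. -/
def grothendieck : StrictPseudofunctor (RightIND B) (BIFIB B) :=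
  StrictPseudofunctor.mk''
    { obj := fun F =>
        ⟨BasedCategory.ofFunctor (Pseudofunctor.CoGrothendieck.forget F.toPseudofunctor),
          inferInstanceAs (Pseudofunctor.CoGrothendieck.forget F.toPseudofunctor).IsFibered,
          grothendieck_isOpfibered _ F.isRightAdjoint⟩
      map := fun σ => InducedBicategory.mkHom
        { toFunctor := grothendieckMap σ.hom
          w := rfl }
      map₂ := fun Ξ => InducedBicategory.mkHom₂
        { toNatTrans := CoG.mapModification Ξ.hom.as
          isHomLift' := fun a => IsHomLift.map _ (CoG.vert _) }
      map₂_id := fun σ => bifib_hom₂_ext fun x => CoG.vert_id _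
      map₂_comp := fun Ξ Θ => bifib_hom₂_ext fun x => (CoG.vert_vert _ _).symm
      map_id := fun F => bifib_hom_ext (grothendieckMap_id F.toPseudofunctor)
      map_comp := fun σ τ => bifib_hom_ext (grothendieckMap_comp σ.hom τ.hom)
      map₂_whisker_left := fun σ τ υ Ξ => bifib_conj _ _ _ _ fun x => HEq.rfl
      map₂_whisker_right := fun Ξ τ => bifib_conj _ _ _ _ fun x =>
        heq_of_eq (CoG.map_vert τ.hom _).symm }

end

/-! ### The forgetful 2-functors -/

section

variable {A C : Cat.{v, u}}

lemma heq_ξ {B E : Cat.{v, u}} {f f' : AdjHom A B} {h h' : A ⥤ C} {k k' : B ⥤ E}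
    {g g' : AdjHom C E} {α : MatePair f h k g} {β : MatePair f' h' k' g'} (H : HEq α β)
    (hf : f = f') (hh : h = h') (hk : k = k') (hg : g = g') (a : A) :
    HEq (α.ξ.app a) (β.ξ.app a) := by
  subst hf hh hk hg
  cases H
  rfl

lemma heq_ζ {B E : Cat.{v, u}} {f f' : AdjHom A B} {h h' : A ⥤ C} {k k' : B ⥤ E}
    {g g' : AdjHom C E} {α : MatePair f h k g} {β : MatePair f' h' k' g'} (H : HEq α β)
    (hf : f = f') (hh : h = h') (hk : k = k') (hg : g = g') (b : B) :
    HEq (α.ζ.app b) (β.ζ.app b) := by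
  subst hf hh hk hg
  cases H
  rfl

variable {f g : AdjHom A C}

/-- The isomorphism between left adjoints given by an invertible mate pair. -/
noncomputable def isoξ (α : MatePair f (𝟭 A) (𝟭 C) g)
    (h : IsVertIso (E := ADJ) (f := f) (g := g) α) : g.L.toCatHom ≅ f.L.toCatHom where
  hom := NatTrans.toCatHom₂ α.ξ
  inv := NatTrans.toCatHom₂ (MatePair.ξ h.choose)
  hom_inv_id := cat_hom₂_ext fun x =>
    eq_of_heq (heq_ξ h.choose_spec.2 rfl rfl rfl rfl x)
  inv_hom_id := cat_hom₂_ext fun x =>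
    eq_of_heq (heq_ξ h.choose_spec.1 rfl rfl rfl rfl x)

/-- The isomorphism between right adjoints given by an invertible mate pair. -/
noncomputable def isoζ (α : MatePair f (𝟭 A) (𝟭 C) g)
    (h : IsVertIso (E := ADJ) (f := f) (g := g) α) : f.R.toCatHom ≅ g.R.toCatHom where
  hom := NatTrans.toCatHom₂ α.ζ
  inv := NatTrans.toCatHom₂ (MatePair.ζ h.choose)
  hom_inv_id := cat_hom₂_ext fun x =>
    eq_of_heq (heq_ζ h.choose_spec.1 rfl rfl rfl rfl x)
  inv_hom_id := cat_hom₂_ext fun x =>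
    eq_of_heq (heq_ζ h.choose_spec.2 rfl rfl rfl rfl x)

end

section

variable {C D : Type u} [Category.{v} C] [Category.{v} D]

lemma cat_eqToHom_app {C D : Cat.{v, u}} {F G : C ⟶ D} (h : F = G) (x : C) :
    (eqToHom h).toNatTrans.app x = eqToHom (by rw [h]) := by
  subst h; rfl

lemma eq_eqToHom_of_heq {x y : C} {m : x ⟶ y} (h : x = y) (H : HEq m (𝟙 y)) :
    m = eqToHom h := by
  subst h
  exact eq_of_heq H

lemma right_unit_ξ (T : D ⥤ C) {x z : C} {w : D} {p : x ⟶ T.obj w} {q : T.obj w ⟶ z}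
    (h : x = z) (H : HEq (p ≫ T.map (𝟙 w) ≫ q) (𝟙 z)) : p ≫ q ≫ 𝟙 z = eqToHom h := by
  rw [T.map_id, Category.id_comp] at H
  rw [Category.comp_id]
  exact eq_eqToHom_of_heq h H

lemma assoc_ξ (T : D ⥤ C) {x x' y z : C} {w : D} {p : x ⟶ y} {q : y ⟶ z} (r : x' ≅ T.obj w)
    (s : T.obj w ≅ z) (h : x = x')
    (H : HEq (p ≫ q ≫ 𝟙 z) (r.hom ≫ T.map (𝟙 w) ≫ s.hom)) :
    p ≫ q ≫ 𝟙 z ≫ s.inv ≫ r.inv = eqToHom h := by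
  subst h
  rw [T.map_id, Category.id_comp] at H
  have := eq_of_heq H
  rw [Category.comp_id] at this
  rw [Category.id_comp, reassoc_of% this]
  simp

lemma right_unit_ζ (T : D ⥤ C) {x y : C} {w : D} (d : x ≅ T.obj w) (g : T.obj w ≅ y)
    (h : y = x) (H : HEq ((d.hom ≫ T.map (𝟙 w)) ≫ g.hom) (𝟙 x)) :
    g.inv ≫ d.inv ≫ 𝟙 x = eqToHom h := by
  subst h
  rw [T.map_id, Category.comp_id] at H
  have := eq_of_heq H
  rw [Category.comp_id, ← Iso.trans_inv, eqToHom_refl, ← Category.comp_id (Iso.inv _),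
    Iso.inv_comp_eq]
  exact this.symm.trans (Category.comp_id _).symm

lemma left_unit_ζ (S : D ⥤ C) {v w : D} {y : C} (q : v ≅ w) (g : S.obj w ≅ y)
    (h : y = S.obj v) (H : HEq ((𝟙 _ ≫ S.map q.hom) ≫ g.hom) (𝟙 (S.obj v))) :
    g.inv ≫ S.map q.inv ≫ 𝟙 _ = eqToHom h := by
  subst h
  have := eq_of_heq H
  rw [Category.id_comp] at this
  rw [Category.comp_id, eqToHom_refl, Iso.inv_comp_eq, Category.comp_id]
  rw [← cancel_epi (S.map q.hom), this, ← S.map_comp, q.hom_inv_id, S.map_id]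

lemma assoc_ζ {C' : Type u} [Category.{v} C'] (T : C' ⥤ C) (S : D ⥤ C)
    {v w : D} {t : C'} {y z : C}
    (q : v ≅ w) (p : S.obj w ≅ y) {s : S.obj v ⟶ T.obj t} {r : T.obj t ⟶ z} (h : y = z)
    (H : HEq ((s ≫ T.map (𝟙 t)) ≫ r) ((𝟙 _ ≫ S.map q.hom) ≫ p.hom)) :
    p.inv ≫ S.map q.inv ≫ 𝟙 _ ≫ s ≫ r = eqToHom h := by
  subst h
  have := eq_of_heq H
  rw [T.map_id, Category.comp_id, Category.id_comp] at this
  rw [Category.id_comp, this, eqToHom_refl, Iso.inv_comp_eq, Category.comp_id, ← Category.assoc,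
    ← S.map_comp, q.inv_hom_id, S.map_id, Category.id_comp]

end

section

variable {B : Type u} [Category.{v} B]

/-- The opindexed category underlying a bi-indexed category: it selects the left adjoints. -/
noncomputable def leftPart (Ω : BIIND B) : LocallyDiscrete B ⥤ᵖ Cat.{v, u} :=
  LocallyDiscrete.mkPseudofunctor
    (fun a => Ω.obj ⟨a⟩)
    (fun {a b} f => (Ω.hMap (A := HB.mk a) (B := HB.mk b) f).L.toCatHom)
    (fun a => isoξ (Ω.δ ⟨a⟩) (Ω.δ_iso ⟨a⟩))
    (fun {a b c} f g => isoξ (Ω.γ (A := HB.mk a) (B := HB.mk b) (C := HB.mk c) f g)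
      (Ω.γ_iso (A := HB.mk a) (B := HB.mk b) (C := HB.mk c) f g))
    (fun {a b c d} f g k => cat_hom₂_ext fun x => by
      refine Eq.trans ?_ (cat_eqToHom_app _ x).symm
      have H := heq_ξ (Ω.assoc (A := HB.mk a) (B := HB.mk b) (C := HB.mk c) (C' := HB.mk d) f g k)
        (AdjHom.assoc _ _ _) rfl rfl (congrArg Ω.hMap (Category.assoc f g k)) x
      exact assoc_ξ (Ω.hMap (A := HB.mk b) (B := HB.mk d) (g ≫ k)).L
        (catIsoApp (isoξ _ (Ω.γ_iso (A := HB.mk a) (B := HB.mk b) (C := HB.mk d) f (g ≫ k))) x)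
        (catIsoApp (isoξ _ (Ω.γ_iso (A := HB.mk b) (B := HB.mk c) (C := HB.mk d) g k)) _) _ H)
    (fun {a b} f => cat_hom₂_ext fun x => by
      refine Eq.trans ?_ (cat_eqToHom_app _ x).symm
      have H := heq_ξ (Ω.left_unit (A := HB.mk a) (B := HB.mk b) f) (AdjHom.id_comp _) rfl rfl
        (congrArg Ω.hMap (Category.id_comp f)) x
      exact eq_eqToHom_of_heq _ H)
    (fun {a b} f => cat_hom₂_ext fun x => by
      refine Eq.trans ?_ (cat_eqToHom_app _ x).symm
      have H := heq_ξ (Ω.right_unit (A := HB.mk a) (B := HB.mk b) f) (AdjHom.comp_id _) rfl rfl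
        (congrArg Ω.hMap (Category.comp_id f)) x
      exact right_unit_ξ (Ω.hMap (A := HB.mk b) (B := HB.mk b) (𝟙 b)).L _ H)

/-- The indexed category underlying a bi-indexed category: it selects the right adjoints. -/
noncomputable def rightPart (Ω : BIIND B) : LocallyDiscrete Bᵒᵖ ⥤ᵖ Cat.{v, u} :=
  LocallyDiscrete.mkPseudofunctor
    (fun a => Ω.obj ⟨a.unop⟩)
    (fun {a b} f => (Ω.hMap (A := HB.mk b.unop) (B := HB.mk a.unop) f.unop).R.toCatHom)
    (fun a => (isoζ (Ω.δ ⟨a.unop⟩) (Ω.δ_iso ⟨a.unop⟩)).symm)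
    (fun {a b c} f g => (isoζ _ (Ω.γ_iso (A := HB.mk c.unop) (B := HB.mk b.unop)
      (C := HB.mk a.unop) g.unop f.unop)).symm)
    (fun {a b c d} f g k => cat_hom₂_ext fun x => by
      refine Eq.trans ?_ (cat_eqToHom_app _ x).symm
      have H := heq_ζ (Ω.assoc (A := HB.mk d.unop) (B := HB.mk c.unop) (C := HB.mk b.unop)
        (C' := HB.mk a.unop) k.unop g.unop f.unop) (AdjHom.assoc _ _ _) rfl rfl
        (congrArg Ω.hMap (Category.assoc k.unop g.unop f.unop)) x
      exact assoc_ζ (Ω.hMap (A := HB.mk d.unop) (B := HB.mk b.unop) (k.unop ≫ g.unop)).R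
        (Ω.hMap (A := HB.mk d.unop) (B := HB.mk c.unop) k.unop).R
        (catIsoApp (isoζ _ (Ω.γ_iso (A := HB.mk c.unop) (B := HB.mk b.unop) (C := HB.mk a.unop)
          g.unop f.unop)) x)
        (catIsoApp (isoζ _ (Ω.γ_iso (A := HB.mk d.unop) (B := HB.mk c.unop) (C := HB.mk a.unop)
          k.unop (g.unop ≫ f.unop))) x) _ H)
    (fun {a b} f => cat_hom₂_ext fun x => by
      refine Eq.trans ?_ (cat_eqToHom_app _ x).symm
      have H := heq_ζ (Ω.right_unit (A := HB.mk b.unop) (B := HB.mk a.unop) f.unop)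
        (AdjHom.comp_id _) rfl rfl (congrArg Ω.hMap (Category.comp_id f.unop)) x
      exact left_unit_ζ (Ω.hMap (A := HB.mk b.unop) (B := HB.mk a.unop) f.unop).R
        (catIsoApp (isoζ _ (Ω.δ_iso ⟨a.unop⟩)) x)
        (catIsoApp (isoζ _ (Ω.γ_iso (A := HB.mk b.unop) (B := HB.mk a.unop) (C := HB.mk a.unop)
          f.unop (𝟙 a.unop))) x) _ H)
    (fun {a b} f => cat_hom₂_ext fun x => by
      refine Eq.trans ?_ (cat_eqToHom_app _ x).symm
      have H := heq_ζ (Ω.left_unit (A := HB.mk b.unop) (B := HB.mk a.unop) f.unop)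
        (AdjHom.id_comp _) rfl rfl (congrArg Ω.hMap (Category.id_comp f.unop)) x
      exact right_unit_ζ (Ω.hMap (A := HB.mk b.unop) (B := HB.mk b.unop) (𝟙 b.unop)).R
        (catIsoApp (isoζ _ (Ω.δ_iso ⟨b.unop⟩)) _)
        (catIsoApp (isoζ _ (Ω.γ_iso (A := HB.mk b.unop) (B := HB.mk b.unop) (C := HB.mk a.unop)
          (𝟙 b.unop) f.unop)) x) _ H)

end

section

variable {C D : Type u} [Category.{v} C] [Category.{v} D]

lemma lax_unit (S : C ⥤ D) {x y : C} {d d' : D} (i : x ≅ y) (j : d ≅ d') {n : d ⟶ S.obj x}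
    {e : d' = S.obj y} (H : n ≫ S.map i.hom = j.hom ≫ eqToHom e) :
    j.inv ≫ n = eqToHom e ≫ 𝟙 _ ≫ S.map i.inv := by
  rw [Iso.inv_comp_eq, ← cancel_mono (S.map i.hom), H, Category.id_comp, Category.assoc,
    Category.assoc, ← S.map_comp, i.inv_hom_id, S.map_id, Category.comp_id]

lemma lax_comp (S : C ⥤ D) {x y : C} {d d₁ d₂ : D} (i : x ≅ y) (j : d ≅ d₁) {n : d ⟶ S.obj x}
    {p : d₁ ⟶ d₂} {q : d₂ ⟶ S.obj y} (H : n ≫ S.map i.hom = j.hom ≫ p ≫ q) :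
    j.inv ≫ n = 𝟙 _ ≫ p ≫ 𝟙 _ ≫ q ≫ 𝟙 _ ≫ S.map i.inv := by
  rw [Iso.inv_comp_eq, ← cancel_mono (S.map i.hom), H]
  simp only [Category.id_comp, Category.assoc, ← S.map_comp, i.inv_hom_id, S.map_id,
    Category.comp_id]

end

section

variable {J : Type u} [Category.{v} J] {F G : LocallyDiscrete J ⥤ᵖ Cat.{v, u}}

lemma discrete_naturality (app : ∀ a, F.obj a ⟶ G.obj a)
    (n : ∀ {a b : LocallyDiscrete J} (f : a ⟶ b), app a ≫ G.map f ⟶ F.map f ≫ app b)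
    {a b : LocallyDiscrete J} {f g : a ⟶ b} (η : f ⟶ g) :
    n f ≫ F.map₂ η ▷ app b = app a ◁ G.map₂ η ≫ n g := by
  obtain rfl := obj_ext_of_isDiscrete η
  obtain rfl := Subsingleton.elim η (𝟙 f)
  simp only [PrelaxFunctor.map₂_id, id_whiskerRight, whiskerLeft_id, Category.comp_id,
    Category.id_comp]

lemma discrete_naturality' (app : ∀ a, F.obj a ⟶ G.obj a)
    (n : ∀ {a b : LocallyDiscrete J} (f : a ⟶ b), F.map f ≫ app b ⟶ app a ≫ G.map f)
    {a b : LocallyDiscrete J} {f g : a ⟶ b} (η : f ⟶ g) :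
    F.map₂ η ▷ app b ≫ n g = n f ≫ app a ◁ G.map₂ η := by
  obtain rfl := obj_ext_of_isDiscrete η
  obtain rfl := Subsingleton.elim η (𝟙 f)
  simp only [PrelaxFunctor.map₂_id, id_whiskerRight, whiskerLeft_id, Category.comp_id,
    Category.id_comp]

end

section

variable {B : Type u} [Category.{v} B] {Ω Ω' : BIIND B}

/-- The lax transformation given by the left parts of the cells of a vertical transformation. -/
noncomputable def leftTrans (τ : VertTrans Ω Ω') :
    Lax.LaxTrans (leftPart Ω).toLax (leftPart Ω').toLax where
  app a := Functor.toCatHom (τ.app ⟨a.as⟩)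
  naturality {a b} f := NatTrans.toCatHom₂
    (MatePair.ξ (τ.cell (A := HB.mk a.as) (B := HB.mk b.as) f.as))
  naturality_naturality η := discrete_naturality (F := leftPart Ω) (G := leftPart Ω')
    (fun a => Functor.toCatHom (τ.app ⟨a.as⟩)) (fun {a b} f => NatTrans.toCatHom₂
      (MatePair.ξ (τ.cell (A := HB.mk a.as) (B := HB.mk b.as) f.as))) η
  naturality_id a := cat_hom₂_ext fun x => by
    have H := eq_of_heq (heq_ξ (τ.cell_id ⟨a.as⟩) rfl rfl rfl rfl x)
    exact lax_unit (τ.app ⟨a.as⟩) (catIsoApp (isoξ _ (Ω.δ_iso ⟨a.as⟩)) x)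
      (catIsoApp (isoξ _ (Ω'.δ_iso ⟨a.as⟩)) _) (e := rfl) H
  naturality_comp {a b c} f g := cat_hom₂_ext fun x => by
    have H := eq_of_heq (heq_ξ (τ.cell_comp (A := HB.mk a.as) (B := HB.mk b.as) (C := HB.mk c.as)
      f.as g.as) rfl rfl rfl rfl x)
    exact lax_comp (τ.app ⟨c.as⟩) (catIsoApp (isoξ _ (Ω.γ_iso (A := HB.mk a.as) (B := HB.mk b.as)
      (C := HB.mk c.as) f.as g.as)) x) (catIsoApp (isoξ _ (Ω'.γ_iso (A := HB.mk a.as)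
      (B := HB.mk b.as) (C := HB.mk c.as) f.as g.as)) _) H

lemma oplax_unit {C D : Type u} [Category.{v} C] [Category.{v} D] (S : C ⥤ D) {x y : C} {d d' : D}
    {i : x ⟶ y} {n : S.obj y ⟶ d'} {e : S.obj x = d} {j : d ⟶ d'}
    (H : S.map i ≫ n = eqToHom e ≫ j) : S.map i ≫ n = eqToHom e ≫ 𝟙 d ≫ j := by
  rw [H, Category.id_comp]

lemma oplax_comp {D : Type u} [Category.{v} D] {d₀ d d₁ d₂ d₃ : D} {i : d₀ ⟶ d} {n : d ⟶ d₃}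
    {p : d₀ ⟶ d₁} {q : d₁ ⟶ d₂} {j : d₂ ⟶ d₃} (H : i ≫ n = (p ≫ q) ≫ j) :
    i ≫ n = 𝟙 _ ≫ p ≫ 𝟙 _ ≫ q ≫ 𝟙 _ ≫ j := by
  rw [H]
  simp only [Category.id_comp, Category.assoc]

/-- The oplax transformation given by the right parts of the cells of a vertical
transformation. -/
noncomputable def rightTrans (τ : VertTrans Ω Ω') :
    Lax.OplaxTrans (rightPart Ω).toLax (rightPart Ω').toLax where
  app a := Functor.toCatHom (τ.app ⟨a.as.unop⟩)
  naturality {a b} f := NatTrans.toCatHom₂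
    (MatePair.ζ (τ.cell (A := HB.mk b.as.unop) (B := HB.mk a.as.unop) f.as.unop))
  naturality_naturality η := discrete_naturality' (F := rightPart Ω) (G := rightPart Ω')
    (fun a => Functor.toCatHom (τ.app ⟨a.as.unop⟩)) (fun {a b} f => NatTrans.toCatHom₂
      (MatePair.ζ (τ.cell (A := HB.mk b.as.unop) (B := HB.mk a.as.unop) f.as.unop))) η
  naturality_id a := cat_hom₂_ext fun x => by
    have H := eq_of_heq (heq_ζ (τ.cell_id ⟨a.as.unop⟩) rfl rfl rfl rfl x)
    exact oplax_unit (τ.app ⟨a.as.unop⟩) (e := rfl) H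
  naturality_comp {a b c} f g := cat_hom₂_ext fun x => by
    have H := eq_of_heq (heq_ζ (τ.cell_comp (A := HB.mk c.as.unop) (B := HB.mk b.as.unop)
      (C := HB.mk a.as.unop) g.as.unop f.as.unop) rfl rfl rfl rfl x)
    exact oplax_comp H

variable {σ τ : VertTrans Ω Ω'}

/-- The modification between lax transformations given by a modification. -/
noncomputable def leftModification (Ξ : DblModification σ τ) :
    Lax.LaxTrans.Modification (leftTrans σ) (leftTrans τ) where
  app a := NatTrans.toCatHom₂ (F := σ.app ⟨a.as⟩) (G := τ.app ⟨a.as⟩) (MatePair.ξ (Ξ.app ⟨a.as⟩))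
  naturality {a b} f := cat_hom₂_ext fun x => by
    exact eq_of_heq (heq_ξ (Ξ.horizontal (A := HB.mk a.as) (B := HB.mk b.as) f.as)
      ((AdjHom.id_comp _).trans (AdjHom.comp_id _).symm) rfl rfl
      ((AdjHom.id_comp _).trans (AdjHom.comp_id _).symm) x)

/-- The modification between oplax transformations given by a modification. -/
noncomputable def rightModification (Ξ : DblModification σ τ) :
    Lax.OplaxTrans.Modification (rightTrans σ) (rightTrans τ) where
  app a := NatTrans.toCatHom₂ (F := σ.app ⟨a.as.unop⟩) (G := τ.app ⟨a.as.unop⟩)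
    (MatePair.ζ (Ξ.app ⟨a.as.unop⟩))
  naturality {a b} f := cat_hom₂_ext fun x => by
    exact eq_of_heq (heq_ζ (Ξ.horizontal (A := HB.mk b.as.unop) (B := HB.mk a.as.unop) f.as.unop)
      ((AdjHom.id_comp _).trans (AdjHom.comp_id _).symm) rfl rfl
      ((AdjHom.id_comp _).trans (AdjHom.comp_id _).symm) x)

end

section

variable {B : Type u} [Category.{v} B]

attribute [local instance] laxBicategory in
lemma left_conj {X Y : LeftOPIND B} {F F' G G' : X ⟶ Y} (hF : F = F') (hG : G' = G) (α : F ⟶ G)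
    (β : F' ⟶ G')
    (h : ∀ a x, HEq ((Lax.LaxTrans.Modification.app (Lax.LaxTrans.Hom.as α.hom) a).toNatTrans.app x)
      ((Lax.LaxTrans.Modification.app (Lax.LaxTrans.Hom.as β.hom) a).toNatTrans.app x)) :
    α = eqToHom hF ≫ β ≫ eqToHom hG := by
  subst hF hG
  simp only [eqToHom_refl, Category.comp_id, Category.id_comp]
  exact InducedBicategory.hom₂_ext (Lax.LaxTrans.homCategory.ext fun a =>
    cat_hom₂_ext fun x => eq_of_heq (h a x))

attribute [local instance] oplaxBicategory in
lemma right_conj {X Y : RightIND B} {F F' G G' : X ⟶ Y} (hF : F = F') (hG : G' = G) (α : F ⟶ G)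
    (β : F' ⟶ G')
    (h : ∀ a x, HEq
      ((Lax.OplaxTrans.Modification.app (Lax.OplaxTrans.Hom.as α.hom) a).toNatTrans.app x)
      ((Lax.OplaxTrans.Modification.app (Lax.OplaxTrans.Hom.as β.hom) a).toNatTrans.app x)) :
    α = eqToHom hF ≫ β ≫ eqToHom hG := by
  subst hF hG
  simp only [eqToHom_refl, Category.comp_id, Category.id_comp]
  exact InducedBicategory.hom₂_ext (Lax.OplaxTrans.homCategory.ext fun a =>
    cat_hom₂_ext fun x => eq_of_heq (h a x))

lemma specialComp_ξ {A C : Cat.{v, u}} {h k l : A ⥤ C}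
    (α : MatePair (AdjHom.id A) h k (AdjHom.id C)) (β : MatePair (AdjHom.id A) k l (AdjHom.id C))
    (x : A) : (MatePair.ξ (specialComp (E := ADJ) (A := A) (B := C) α β)).app x =
      α.ξ.app x ≫ β.ξ.app x :=
  eq_of_heq (heq_ξ (specialComp_cellEq (E := ADJ) (A := A) (B := C) α β).heq
    (AdjHom.id_comp _).symm rfl rfl (AdjHom.id_comp _).symm x)

lemma specialComp_ζ {A C : Cat.{v, u}} {h k l : A ⥤ C}
    (α : MatePair (AdjHom.id A) h k (AdjHom.id C)) (β : MatePair (AdjHom.id A) k l (AdjHom.id C))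
    (x : A) : (MatePair.ζ (specialComp (E := ADJ) (A := A) (B := C) α β)).app x =
      α.ζ.app x ≫ β.ζ.app x :=
  eq_of_heq (heq_ζ (specialComp_cellEq (E := ADJ) (A := A) (B := C) α β).heq
    (AdjHom.id_comp _).symm rfl rfl (AdjHom.id_comp _).symm x)

variable (B)

attribute [local instance] laxBicategory in
/-- The forgetful 2-functor from bi-indexed categories to opindexed categories with left adjoint
direct images. -/
noncomputable def forgetToLeft : StrictPseudofunctor (BIIND B) (LeftOPIND B) :=
  StrictPseudofunctor.mk''
    { obj := fun Ω =>
        { toPseudofunctor := leftPart Ω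
          isLeftAdjoint := fun {a b} f =>
            (Ω.hMap (A := HB.mk a.as) (B := HB.mk b.as) f.as).adj.isLeftAdjoint }
      map := fun τ => InducedBicategory.mkHom (leftTrans τ)
      map₂ := fun Ξ => InducedBicategory.mkHom₂ ⟨leftModification Ξ⟩
      map₂_id := fun σ => rfl
      map₂_comp := fun Ξ Θ => InducedBicategory.hom₂_ext (Lax.LaxTrans.homCategory.ext fun a =>
        cat_hom₂_ext fun x => specialComp_ξ (DblModification.app Ξ _) (DblModification.app Θ _) x)
      map_id := fun Ω => InducedBicategory.hom_ext (laxTrans_ext rfl fun f => heq_of_eq <|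
        cat_hom₂_ext fun x => (laxTrans_id_app B _ f x).symm)
      map_comp := fun σ τ => InducedBicategory.hom_ext (laxTrans_ext rfl fun f => heq_of_eq <|
        cat_hom₂_ext fun x => (laxTrans_comp_app B (leftTrans σ) (leftTrans τ) f x).symm)
      map₂_whisker_left := fun σ τ υ Ξ => left_conj _ _ _ _ fun a x => heq_of_eq
        ((congrArg (_ ≫ ·) (CategoryTheory.Functor.map_id _ _)).trans (Category.comp_id _))
      map₂_whisker_right := fun Ξ τ => left_conj _ _ _ _ fun a x =>
        heq_of_eq (Category.id_comp _) }

attribute [local instance] oplaxBicategory in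
/-- The forgetful 2-functor from bi-indexed categories to indexed categories with right adjoint
inverse images. -/
noncomputable def forgetToRight : StrictPseudofunctor (BIIND B) (RightIND B) :=
  StrictPseudofunctor.mk''
    { obj := fun Ω =>
        { toPseudofunctor := rightPart Ω
          isRightAdjoint := fun {a b} f => (Ω.hMap (A := HB.mk b.as.unop) (B := HB.mk a.as.unop)
            f.as.unop).adj.isRightAdjoint }
      map := fun τ => InducedBicategory.mkHom (rightTrans τ)
      map₂ := fun Ξ => InducedBicategory.mkHom₂ ⟨rightModification Ξ⟩
      map₂_id := fun σ => rfl
      map₂_comp := fun Ξ Θ => InducedBicategory.hom₂_ext (Lax.OplaxTrans.homCategory.ext fun a =>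
        cat_hom₂_ext fun x => specialComp_ζ (DblModification.app Ξ _) (DblModification.app Θ _) x)
      map_id := fun Ω => InducedBicategory.hom_ext (oplaxTrans_ext rfl fun f => heq_of_eq <|
        cat_hom₂_ext fun x => (oplaxTrans_id_app Bᵒᵖ _ f x).symm)
      map_comp := fun σ τ => InducedBicategory.hom_ext (oplaxTrans_ext rfl fun f => heq_of_eq <|
        cat_hom₂_ext fun x => (oplaxTrans_comp_app Bᵒᵖ (rightTrans σ) (rightTrans τ) f x).symm)
      map₂_whisker_left := fun σ τ υ Ξ => right_conj _ _ _ _ fun a x => heq_of_eq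
        ((congrArg (· ≫ _) (CategoryTheory.Functor.map_id _ _)).trans (Category.id_comp _))
      map₂_whisker_right := fun Ξ τ => right_conj _ _ _ _ fun a x =>
        heq_of_eq (Category.comp_id _) }

end

/-! ### 2-natural isomorphisms and 2-equivalences -/

section

variable {X : Type u₁} [Bicategory.{w₁, vh₁} X] {Y : Type u₂} [Bicategory.{w₂, vh₂} Y]

/-- A 2-natural isomorphism between 2-functors: invertible 1-cells, strictly natural with respect to
1-cells and 2-cells. -/
structure TwoNatIso (F G : StrictPseudofunctor X Y) where
  hom : ∀ a : X, F.obj a ⟶ G.obj a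
  inv : ∀ a : X, G.obj a ⟶ F.obj a
  hom_inv_id : ∀ a : X, hom a ≫ inv a = 𝟙 (F.obj a)
  inv_hom_id : ∀ a : X, inv a ≫ hom a = 𝟙 (G.obj a)
  naturality : ∀ {a b : X} (f : a ⟶ b), F.map f ≫ hom b = hom a ≫ G.map f
  naturality₂ : ∀ {a b : X} {f g : a ⟶ b} (η : f ⟶ g), F.map₂ η ▷ hom b =
    eqToHom (naturality f) ≫ hom a ◁ G.map₂ η ≫ eqToHom (naturality g).symm

/-- A 2-functor is a 2-equivalence if it has a quasi-inverse 2-functor, up to 2-natural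
isomorphisms. -/
def IsTwoEquivalence (F : StrictPseudofunctor X Y) : Prop :=
  ∃ K : StrictPseudofunctor Y X, Nonempty (TwoNatIso (F.comp K) (StrictPseudofunctor.id X)) ∧
    Nonempty (TwoNatIso (K.comp F) (StrictPseudofunctor.id Y))

end

/-! ### A recognition principle for 2-equivalences -/

-- A 2-functor is a 2-equivalence as soon as it is bijective on 1-cells, bijective on 2-cells, and
-- every object of its target is strictly isomorphic to one in its image
-- (`FullyFaithful₂.isTwoEquivalence`). These conditions obey cancellation laws and pass along
-- 2-natural isomorphisms, so the four 2-functors of the triangle need not be treated one by one.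
-- Five facts suffice.
--
-- (1) `forgetToLeft` is 2-fully faithful. A mate pair is determined by its left part, and every
-- natural transformation of the right shape is a left part. Hence transformations and modifications
-- of bi-indexed categories are exactly lax transformations and modifications of the left adjoints.
--
-- (2) `opGrothendieck` is 2-fully faithful. In the op-construction every morphism is a chosen
-- opcartesian lift followed by a vertical morphism. A functor over the base is therefore given by
-- its action on the fibres and by the images of the lifts. The first yields the functors of a lax
-- transformation, the second its 2-cells, and functoriality translates into the lax axioms.
--
-- (3) `grothendieck` is 2-fully faithful, by the dual argument with cartesian lifts and oplax
-- transformations.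
--
-- (4) The two constructions of a bi-indexed category are isomorphic over the base: transposition
-- under `L ⊣ R` turns a morphism `L x ⟶ y` into a morphism `x ⟶ R y`. The mate conditions on `δ`,
-- `γ`, the cells of a transformation and the components of a modification say precisely that
-- transposition is functorial and strictly 2-natural (`grothendieckIso`).
--
-- (5) Every bifibration is isomorphic over the base to the op-construction of a bi-indexed
-- category. With cartesian and opcartesian lifts chosen, direct image is left adjoint to inverse
-- image because both hom-sets describe the morphisms over `f`. The fibres with these adjunctions
-- form a bi-indexed category (`biindOfCleavage`), and a morphism of the total category is the same
-- as its base arrow with its opcartesian factorization.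
--
-- By (1), (2) and (5) the composite of `forgetToLeft` and `opGrothendieck` is a 2-equivalence. By
-- (4) so is that of `forgetToRight` and `grothendieck`. Cancellation with (2) and (3) then gives
-- all four 2-functors, including `forgetToRight`, whose full faithfulness is deduced from the other
-- facts.

universe w₃ vh₃ u₃

/-! ### Calculus of 2-cells in strict bicategories, up to equality of boundaries. -/

section

variable {X : Type u₁} [Bicategory.{w₁, vh₁} X] {a b c d : X}

lemma heq_whiskerLeft {f f' : a ⟶ b} {g g' h h' : b ⟶ c} {η : g ⟶ h} {η' : g' ⟶ h'} (hf : f = f')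
    (hg : g = g') (hh : h = h') (H : HEq η η') : HEq (f ◁ η) (f' ◁ η') := by
  subst hf hg hh; cases H; rfl

lemma heq_whiskerRight {f f' g g' : a ⟶ b} {h h' : b ⟶ c} {η : f ⟶ g} {η' : f' ⟶ g'} (hf : f = f')
    (hg : g = g') (hh : h = h') (H : HEq η η') : HEq (η ▷ h) (η' ▷ h') := by
  subst hf hg hh; cases H; rfl

lemma heq_comp₂ {f f' g g' h h' : a ⟶ b} {η : f ⟶ g} {η' : f' ⟶ g'} {θ : g ⟶ h} {θ' : g' ⟶ h'}
    (hf : f = f') (hg : g = g') (hh : h = h') (H : HEq η η') (H' : HEq θ θ') :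
    HEq (η ≫ θ) (η' ≫ θ') := by
  subst hf hg hh; cases H; cases H'; rfl

/-- In the strict setting, unitors, associators and the comparison cells of 2-functors are all built
from `eqToHom`. Heterogeneous equality erases these conjugations, so that pasting identities can be
used as in a strict 2-category. -/
lemma eqToHom_conj_heq {f f' g g' : a ⟶ b} (hf : f = f') (hg : g' = g) (η : f' ⟶ g') :
    HEq (eqToHom hf ≫ η ≫ eqToHom hg) η := by
  subst hf hg; simp

lemma heq_id₂ {f f' : a ⟶ b} (hf : f = f') : HEq (𝟙 f) (𝟙 f') := by
  subst hf; rfl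

variable [Bicategory.Strict X]

/-- The equation `f = 𝟙 a` is a hypothesis because the lemma is applied to composites of mutually
inverse 1-cells, which are identities only propositionally. -/
lemma id_whiskerLeft_heq {f : a ⟶ a} (hf : f = 𝟙 a) {g h : a ⟶ b} (η : g ⟶ h) :
    HEq (f ◁ η) η := by
  subst hf
  rw [Bicategory.id_whiskerLeft, Strict.leftUnitor_eqToIso, Strict.leftUnitor_eqToIso]
  simp only [eqToIso.hom, eqToIso.inv]
  exact eqToHom_conj_heq _ _ _

lemma whiskerRight_id_heq {f : b ⟶ b} (hf : f = 𝟙 b) {g h : a ⟶ b} (η : g ⟶ h) :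
    HEq (η ▷ f) η := by
  subst hf
  rw [Bicategory.whiskerRight_id, Strict.rightUnitor_eqToIso, Strict.rightUnitor_eqToIso]
  simp only [eqToIso.hom, eqToIso.inv]
  exact eqToHom_conj_heq _ _ _

lemma comp_whiskerLeft_heq (f : a ⟶ b) (g : b ⟶ c) {h h' : c ⟶ d} (η : h ⟶ h') :
    HEq ((f ≫ g) ◁ η) (f ◁ g ◁ η) := by
  rw [Bicategory.comp_whiskerLeft, Strict.associator_eqToIso, Strict.associator_eqToIso]
  simp only [eqToIso.hom, eqToIso.inv]
  exact eqToHom_conj_heq _ _ _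

lemma whiskerRight_comp_heq {f f' : a ⟶ b} (η : f ⟶ f') (g : b ⟶ c) (h : c ⟶ d) :
    HEq (η ▷ (g ≫ h)) (η ▷ g ▷ h) := by
  rw [Bicategory.whiskerRight_comp, Strict.associator_eqToIso, Strict.associator_eqToIso]
  simp only [eqToIso.hom, eqToIso.inv]
  exact eqToHom_conj_heq _ _ _

lemma whisker_assoc_heq (f : a ⟶ b) {g g' : b ⟶ c} (η : g ⟶ g') (h : c ⟶ d) :
    HEq ((f ◁ η) ▷ h) (f ◁ η ▷ h) := by
  rw [Bicategory.whisker_assoc, Strict.associator_eqToIso, Strict.associator_eqToIso]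
  simp only [eqToIso.hom, eqToIso.inv]
  exact eqToHom_conj_heq _ _ _

/-- Whiskering once more with `g` gives `(g ≫ f) ◁ η`, which is `η`. A one-sided inverse of `f` is
enough. -/
lemma cancel_whiskerLeft {f : a ⟶ b} {g : b ⟶ a} (e : g ≫ f = 𝟙 b) {h h' : b ⟶ c} {η η' : h ⟶ h'}
    (H : f ◁ η = f ◁ η') : η = η' := by
  refine eq_of_heq ((id_whiskerLeft_heq e η).symm.trans ?_)
  refine HEq.trans ?_ (id_whiskerLeft_heq e η')
  exact (comp_whiskerLeft_heq _ _ _).trans (HEq.trans (by rw [H])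
    (comp_whiskerLeft_heq _ _ _).symm)

lemma cancel_whiskerRight {f : b ⟶ c} {g : c ⟶ b} (e : f ≫ g = 𝟙 b) {h h' : a ⟶ b} {η η' : h ⟶ h'}
    (H : η ▷ f = η' ▷ f) : η = η' := by
  refine eq_of_heq ((whiskerRight_id_heq e η).symm.trans ?_)
  refine HEq.trans ?_ (whiskerRight_id_heq e η')
  exact (whiskerRight_comp_heq _ _ _).trans (HEq.trans (by rw [H])
    (whiskerRight_comp_heq _ _ _).symm)

end

/-! ### Full faithfulness and essential surjectivity of 2-functors. -/

section

variable {X : Type u₁} [Bicategory.{w₁, vh₁} X] {Y : Type u₂} [Bicategory.{w₂, vh₂} Y]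
  {Z : Type u₃} [Bicategory.{w₃, vh₃} Z]

namespace CategoryTheory.StrictPseudofunctor

lemma map₂_whiskerLeft_heq (F : StrictPseudofunctor X Y) {a b c : X} (f : a ⟶ b) {g g' : b ⟶ c}
    (η : g ⟶ g') : HEq (F.map₂ (f ◁ η)) (F.map f ◁ F.map₂ η) := by
  rw [F.map₂_whisker_left, F.mapComp_eq_eqToIso, F.mapComp_eq_eqToIso]
  simp only [eqToIso.hom, eqToIso.inv]
  exact eqToHom_conj_heq _ _ _

lemma map₂_whiskerRight_heq (F : StrictPseudofunctor X Y) {a b c : X} {f f' : a ⟶ b} (η : f ⟶ f')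
    (g : b ⟶ c) : HEq (F.map₂ (η ▷ g)) (F.map₂ η ▷ F.map g) := by
  rw [F.map₂_whisker_right, F.mapComp_eq_eqToIso, F.mapComp_eq_eqToIso]
  simp only [eqToIso.hom, eqToIso.inv]
  exact eqToHom_conj_heq _ _ _

/-- A 2-functor is 2-fully faithful if it induces isomorphisms between categories of 1-cells. -/
structure FullyFaithful₂ (F : StrictPseudofunctor X Y) : Prop where
  map_bijective : ∀ a b : X, Function.Bijective (F.map : (a ⟶ b) → (F.obj a ⟶ F.obj b))
  map₂_bijective : ∀ {a b : X} (f g : a ⟶ b),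
    Function.Bijective (F.map₂ : (f ⟶ g) → (F.map f ⟶ F.map g))

/-- Every object of the target is strictly isomorphic to one in the image. -/
def EssSurj₂ (F : StrictPseudofunctor X Y) : Prop :=
  ∀ y : Y, ∃ (x : X) (h : F.obj x ⟶ y) (k : y ⟶ F.obj x), h ≫ k = 𝟙 _ ∧ k ≫ h = 𝟙 _

variable {F : StrictPseudofunctor X Y} {G : StrictPseudofunctor Y Z}

namespace EssSurj₂

variable (hE : F.EssSurj₂)

/-- An object whose image is isomorphic to a given object. -/
noncomputable def objPreimage (y : Y) : X := (hE y).choose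

/-- The isomorphism from the image of the chosen object. -/
noncomputable def hom (y : Y) : F.obj (hE.objPreimage y) ⟶ y := (hE y).choose_spec.choose

/-- The isomorphism to the image of the chosen object. -/
noncomputable def inv (y : Y) : y ⟶ F.obj (hE.objPreimage y) :=
  (hE y).choose_spec.choose_spec.choose

lemma hom_inv (hE : F.EssSurj₂) (y : Y) : hE.hom y ≫ hE.inv y = 𝟙 _ :=
  (hE y).choose_spec.choose_spec.choose_spec.1

lemma inv_hom (hE : F.EssSurj₂) (y : Y) : hE.inv y ≫ hE.hom y = 𝟙 _ :=
  (hE y).choose_spec.choose_spec.choose_spec.2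

/-- The quasi-inverse acts on 2-cells by conjugation with the chosen isomorphisms; whiskering with
`hE.hom z` cancels the factor `hE.inv z`. This is the 2-naturality of both the unit and the counit.
-/
lemma conj_whiskerRight [Bicategory.Strict Y] (hE : F.EssSurj₂) {y z : Y} {f g : y ⟶ z}
    (η : f ⟶ g) : HEq ((hE.hom y ◁ η ▷ hE.inv z) ▷ hE.hom z) (hE.hom y ◁ η) := by
  refine (whisker_assoc_heq _ _ _).trans (heq_whiskerLeft rfl ?_ ?_ ?_)
  · rw [Strict.assoc, hE.inv_hom, Strict.comp_id]
  · rw [Strict.assoc, hE.inv_hom, Strict.comp_id]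
  · exact (whiskerRight_comp_heq _ _ _).symm.trans (whiskerRight_id_heq (hE.inv_hom z) η)

end EssSurj₂

lemma FullyFaithful₂.comp (hF : F.FullyFaithful₂) (hG : G.FullyFaithful₂) :
    (F.comp G).FullyFaithful₂ where
  map_bijective a b := (hG.map_bijective _ _).comp (hF.map_bijective a b)
  map₂_bijective f g := (hG.map₂_bijective _ _).comp (hF.map₂_bijective f g)

/-- Cancellation of bijections on the left. It yields full faithfulness of `forgetToRight` from that
of `grothendieck` and of the composite. -/
lemma FullyFaithful₂.of_comp (hG : G.FullyFaithful₂) (h : (F.comp G).FullyFaithful₂) :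
    F.FullyFaithful₂ where
  map_bijective a b := ((hG.map_bijective _ _).of_comp_iff' _).1 (h.map_bijective a b)
  map₂_bijective f g := ((hG.map₂_bijective _ _).of_comp_iff' _).1 (h.map₂_bijective f g)

lemma EssSurj₂.of_comp (h : (F.comp G).EssSurj₂) : G.EssSurj₂ := fun z =>
  let ⟨x, e⟩ := h z
  ⟨F.obj x, e⟩

/-- An isomorphism `G (F x) ≅ G y` lifts along the bijections of `G` on 1-cells; injectivity
reflects the two inverse laws. -/
lemma EssSurj₂.of_comp_of_fullyFaithful (hG : G.FullyFaithful₂) (h : (F.comp G).EssSurj₂) :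
    F.EssSurj₂ := fun y => by
  obtain ⟨x, e, e', h₁, h₂⟩ := h (G.obj y)
  obtain ⟨i, rfl⟩ := (hG.map_bijective _ _).2 e
  obtain ⟨j, rfl⟩ := (hG.map_bijective _ _).2 e'
  refine ⟨x, i, j, (hG.map_bijective _ _).1 ?_, (hG.map_bijective _ _).1 ?_⟩
  · rw [G.map_comp, G.map_id]; exact h₁
  · rw [G.map_comp, G.map_id]; exact h₂

end CategoryTheory.StrictPseudofunctor

/-! ### Transport of both conditions along a 2-natural isomorphism. -/

namespace TwoNatIso

open StrictPseudofunctor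

variable {F G : StrictPseudofunctor X Y}

lemma naturality₂_heq (α : TwoNatIso F G) {a b : X} {f g : a ⟶ b} (η : f ⟶ g) :
    HEq (F.map₂ η ▷ α.hom b) (α.hom a ◁ G.map₂ η) := by
  rw [α.naturality₂]
  exact eqToHom_conj_heq _ _ _

variable [Bicategory.Strict Y]

lemma essSurj₂ (α : TwoNatIso F G) (hG : G.EssSurj₂) : F.EssSurj₂ := fun y => by
  obtain ⟨x, e, e', h₁, h₂⟩ := hG y
  refine ⟨x, α.hom x ≫ e, e' ≫ α.inv x, ?_, ?_⟩
  · rw [Strict.assoc, ← Strict.assoc e, h₁, Strict.id_comp, α.hom_inv_id]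
  · rw [Strict.assoc, ← Strict.assoc (α.inv x), α.inv_hom_id, Strict.id_comp, h₂]

lemma map_eq (α : TwoNatIso F G) {a b : X} (f : a ⟶ b) : F.map f = α.hom a ≫ G.map f ≫ α.inv b := by
  rw [← Strict.assoc, ← α.naturality, Strict.assoc, α.hom_inv_id, Strict.comp_id]

lemma map_eq' (α : TwoNatIso F G) {a b : X} (f : a ⟶ b) : G.map f =
    α.inv a ≫ F.map f ≫ α.hom b := by
  rw [α.naturality, ← Strict.assoc, α.inv_hom_id, Strict.id_comp]

lemma fullyFaithful₂ (α : TwoNatIso F G) (hG : G.FullyFaithful₂) : F.FullyFaithful₂ where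
  map_bijective a b := by
    refine ⟨fun f g h => (hG.map_bijective a b).1 ?_, fun m => ?_⟩
    · rw [α.map_eq', α.map_eq', h]
    · obtain ⟨f, hf⟩ := (hG.map_bijective a b).2 (α.inv a ≫ m ≫ α.hom b)
      refine ⟨f, ?_⟩
      rw [α.map_eq, hf, Strict.assoc, Strict.assoc, α.hom_inv_id, Strict.comp_id, ← Strict.assoc,
        α.hom_inv_id, Strict.id_comp]
  map₂_bijective {a b} f g := by
    refine ⟨fun η θ h => (hG.map₂_bijective f g).1 ?_, fun m => ?_⟩
    -- By 2-naturality `α.hom a ◁ G.map₂ η` is `F.map₂ η ▷ α.hom b`, so it depends only on `F.map₂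
    -- η`; the invertible 1-cell `α.hom a` then cancels.
    · refine cancel_whiskerLeft (α.inv_hom_id a) (eq_of_heq ?_)
      refine (α.naturality₂_heq η).symm.trans (HEq.trans ?_ (α.naturality₂_heq θ))
      rw [h]
    -- The preimage sought is that of `m` conjugated by the isomorphisms at `a` and `b`, with
    -- boundaries corrected by `α.map_eq'`.
    · obtain ⟨η, hη⟩ := (hG.map₂_bijective f g).2
        (eqToHom (α.map_eq' f) ≫ (α.inv a ◁ m ▷ α.hom b) ≫ eqToHom (α.map_eq' g).symm)
      refine ⟨η, ?_⟩
      refine cancel_whiskerRight (α.hom_inv_id b) (eq_of_heq ?_)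
      refine (α.naturality₂_heq η).trans ?_
      rw [hη]
      refine (heq_whiskerLeft rfl (α.map_eq' f) (α.map_eq' g) (eqToHom_conj_heq _ _ _)).trans ?_
      exact (comp_whiskerLeft_heq _ _ _).symm.trans (id_whiskerLeft_heq (α.hom_inv_id a) _)

end TwoNatIso

/-! ### The quasi-inverse and the recognition principle. -/

namespace CategoryTheory.StrictPseudofunctor.FullyFaithful₂

variable {F : StrictPseudofunctor X Y} (hF : F.FullyFaithful₂)

/-- Injectivity on 1-cells first identifies the boundaries, after which injectivity on 2-cells
applies. This lets equations between 2-cells with different boundaries be tested after `F`. -/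
lemma heq_of_map₂ (hF : F.FullyFaithful₂) {a b : X} {f f' g g' : a ⟶ b} {η : f ⟶ g} {η' : f' ⟶ g'}
    (hf : F.map f = F.map f') (hg : F.map g = F.map g') (H : HEq (F.map₂ η) (F.map₂ η')) :
    HEq η η' := by
  obtain rfl := (hF.map_bijective _ _).1 hf
  obtain rfl := (hF.map_bijective _ _).1 hg
  exact heq_of_eq ((hF.map₂_bijective _ _).1 (eq_of_heq H))

/-- The 1-cell with a given image. -/
noncomputable def preimage {a b : X} (f : F.obj a ⟶ F.obj b) : a ⟶ b :=
  ((hF.map_bijective a b).2 f).choose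

@[simp]
lemma map_preimage (hF : F.FullyFaithful₂) {a b : X} (f : F.obj a ⟶ F.obj b) :
    F.map (hF.preimage f) = f :=
  ((hF.map_bijective a b).2 f).choose_spec

lemma preimage_comp_preimage (hF : F.FullyFaithful₂) {a b : X} {f : F.obj a ⟶ F.obj b}
    {g : F.obj b ⟶ F.obj a} (h : f ≫ g = 𝟙 _) : hF.preimage f ≫ hF.preimage g = 𝟙 a :=
  (hF.map_bijective _ _).1 <| by rw [F.map_comp, hF.map_preimage, hF.map_preimage, h, F.map_id]

/-- The 2-cell with a given image. -/
noncomputable def preimage₂ {a b : X} {f g : F.obj a ⟶ F.obj b} (η : f ⟶ g) :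
    hF.preimage f ⟶ hF.preimage g :=
  ((hF.map₂_bijective _ _).2
    (eqToHom (hF.map_preimage f) ≫ η ≫ eqToHom (hF.map_preimage g).symm)).choose

lemma map₂_preimage₂ (hF : F.FullyFaithful₂) {a b : X} {f g : F.obj a ⟶ F.obj b} (η : f ⟶ g) :
    HEq (F.map₂ (hF.preimage₂ η)) η := by
  rw [preimage₂, ((hF.map₂_bijective _ _).2 _).choose_spec]
  exact eqToHom_conj_heq _ _ _

variable [Bicategory.Strict X] [Bicategory.Strict Y] (hE : F.EssSurj₂)

/-- A quasi-inverse of a 2-fully faithful and essentially surjective 2-functor. -/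
noncomputable def inverse : StrictPseudofunctor Y X :=
  let x := hE.objPreimage
  let h := hE.hom
  let k := hE.inv
  have hk := hE.hom_inv
  have kh := hE.inv_hom
  -- Conjugation is multiplicative because the inner `k b ≫ h b` is an identity.
  have mc : ∀ {a b c : Y} (f : a ⟶ b) (g : b ⟶ c), h a ≫ (f ≫ g) ≫ k c =
      (h a ≫ f ≫ k b) ≫ h b ≫ g ≫ k c := fun f g => by
    simp only [Strict.assoc]
    rw [← Strict.assoc (k _), kh, Strict.id_comp]
  StrictPseudofunctor.mk''
    { obj := x
      map := fun {a b} f => hF.preimage (h a ≫ f ≫ k b)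
      map₂ := fun {a b f g} η => hF.preimage₂ (h a ◁ η ▷ k b)
      -- This law and those below are verified after applying `F`, where preimages become explicit
      -- conjugates.
      map₂_id := fun {a b} f => (hF.map₂_bijective _ _).1 <| eq_of_heq <|
        (hF.map₂_preimage₂ _).trans <| by
          rw [F.map₂_id, id_whiskerRight, whiskerLeft_id]
          exact heq_id₂ (hF.map_preimage _).symm
      map₂_comp := fun η θ => (hF.map₂_bijective _ _).1 <| eq_of_heq <|
        (hF.map₂_preimage₂ _).trans <| by
          rw [F.map₂_comp, comp_whiskerRight, whiskerLeft_comp]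
          exact heq_comp₂ (hF.map_preimage _).symm (hF.map_preimage _).symm
            (hF.map_preimage _).symm (hF.map₂_preimage₂ _).symm (hF.map₂_preimage₂ _).symm
      map_id := fun a => (hF.map_bijective _ _).1 <| by
        rw [hF.map_preimage, Strict.id_comp, hk, F.map_id]
      map_comp := fun f g => (hF.map_bijective _ _).1 <| by
        rw [F.map_comp, hF.map_preimage, hF.map_preimage, hF.map_preimage, mc]
      map₂_whisker_left := fun {a b c} f {g g'} η => by
        refine eq_of_heq (HEq.trans ?_ (eqToHom_conj_heq _ _ _).symm)
        have e : ∀ g : b ⟶ c, F.map (hF.preimage (h a ≫ (f ≫ g) ≫ k c)) =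
            F.map (hF.preimage (h a ≫ f ≫ k b) ≫ hF.preimage (h b ≫ g ≫ k c)) := fun g => by
          rw [F.map_comp, hF.map_preimage, hF.map_preimage, hF.map_preimage, mc]
        refine hF.heq_of_map₂ (e g) (e g') ((hF.map₂_preimage₂ _).trans ?_)
        refine HEq.trans ?_ (F.map₂_whiskerLeft_heq _ _).symm
        refine HEq.trans ?_ (heq_whiskerLeft (hF.map_preimage _).symm (hF.map_preimage _).symm
          (hF.map_preimage _).symm (hF.map₂_preimage₂ _).symm)
        refine HEq.trans ?_ (comp_whiskerLeft_heq _ _ _).symm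
        refine heq_whiskerLeft rfl ?_ ?_ ?_
        · simp only [Strict.assoc]; rw [← Strict.assoc (k _), kh, Strict.id_comp]
        · simp only [Strict.assoc]; rw [← Strict.assoc (k _), kh, Strict.id_comp]
        refine (whisker_assoc_heq _ _ _).trans ?_
        refine HEq.trans ?_ (comp_whiskerLeft_heq _ _ _).symm
        refine heq_whiskerLeft rfl ?_ ?_ ?_
        · rw [← Strict.assoc (k _), kh, Strict.id_comp]
        · rw [← Strict.assoc (k _), kh, Strict.id_comp]
        -- What remains is to insert the identity `k b ≫ h b` to the left of the whiskered 2-cell.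
        exact (id_whiskerLeft_heq (kh _) _).symm.trans (comp_whiskerLeft_heq _ _ _)
      map₂_whisker_right := fun {a b c f f'} η g => by
        refine eq_of_heq (HEq.trans ?_ (eqToHom_conj_heq _ _ _).symm)
        have e : ∀ f : a ⟶ b, F.map (hF.preimage (h a ≫ (f ≫ g) ≫ k c)) =
            F.map (hF.preimage (h a ≫ f ≫ k b) ≫ hF.preimage (h b ≫ g ≫ k c)) := fun f => by
          rw [F.map_comp, hF.map_preimage, hF.map_preimage, hF.map_preimage, mc]
        refine hF.heq_of_map₂ (e f) (e f') ((hF.map₂_preimage₂ _).trans ?_)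
        refine HEq.trans ?_ (F.map₂_whiskerRight_heq _ _).symm
        refine HEq.trans ?_ (heq_whiskerRight (hF.map_preimage _).symm (hF.map_preimage _).symm
          (hF.map_preimage _).symm (hF.map₂_preimage₂ _).symm)
        refine HEq.trans ?_ (whisker_assoc_heq _ _ _).symm
        refine heq_whiskerLeft rfl ?_ ?_ ?_
        · simp only [Strict.assoc]; rw [← Strict.assoc (k _), kh, Strict.id_comp]
        · simp only [Strict.assoc]; rw [← Strict.assoc (k _), kh, Strict.id_comp]
        refine (whiskerRight_comp_heq _ _ _).symm.trans ?_
        refine HEq.trans ?_ (whiskerRight_comp_heq _ _ _)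
        refine heq_whiskerRight rfl rfl ?_ HEq.rfl
        rw [← Strict.assoc, kh, Strict.id_comp] }

lemma isTwoEquivalence (hF : F.FullyFaithful₂) (hE : F.EssSurj₂) : IsTwoEquivalence F := by
  have nat : ∀ {a b : X} (f : a ⟶ b), hF.preimage (hE.hom (F.obj a) ≫ F.map f ≫
      hE.inv (F.obj b)) ≫ hF.preimage (hE.hom (F.obj b)) =
        hF.preimage (hE.hom (F.obj a)) ≫ f := fun f => (hF.map_bijective _ _).1 <| by
    rw [F.map_comp, F.map_comp, hF.map_preimage, hF.map_preimage, hF.map_preimage, Strict.assoc,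
      Strict.assoc, hE.inv_hom, Strict.comp_id]
  have nat' : ∀ {a b : Y} (f : a ⟶ b), F.map (hF.preimage (hE.hom a ≫ f ≫ hE.inv b)) ≫
      hE.hom b = hE.hom a ≫ f := fun f => by
    rw [hF.map_preimage, Strict.assoc, Strict.assoc, hE.inv_hom, Strict.comp_id]
  refine ⟨hF.inverse hE, ⟨?_⟩, ⟨?_⟩⟩
  · exact
      -- The quasi-inverse sends `F.obj a` to a chosen object that need not be `a`; the chosen
      -- isomorphism between their images is lifted along `F`.
      { hom := fun a => hF.preimage (hE.hom (F.obj a))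
        inv := fun a => hF.preimage (hE.inv (F.obj a))
        hom_inv_id := fun a => hF.preimage_comp_preimage (hE.hom_inv _)
        inv_hom_id := fun a => hF.preimage_comp_preimage (hE.inv_hom _)
        naturality := fun f => nat f
        naturality₂ := fun {a b f g} η => by
          refine eq_of_heq (HEq.trans ?_ (eqToHom_conj_heq _ _ _).symm)
          refine hF.heq_of_map₂ (congrArg F.map (nat f)) (congrArg F.map (nat g)) ?_
          refine (F.map₂_whiskerRight_heq _ _).trans ?_
          refine HEq.trans ?_ (F.map₂_whiskerLeft_heq _ _).symm
          refine (heq_whiskerRight (hF.map_preimage _) (hF.map_preimage _) (hF.map_preimage _)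
            (hF.map₂_preimage₂ _)).trans ?_
          refine HEq.trans ?_ (heq_whiskerLeft (hF.map_preimage _).symm rfl rfl HEq.rfl)
          exact hE.conj_whiskerRight (F.map₂ η) }
  · exact
      { hom := fun y => hE.hom y
        inv := fun y => hE.inv y
        hom_inv_id := fun y => hE.hom_inv y
        inv_hom_id := fun y => hE.inv_hom y
        naturality := fun f => nat' f
        naturality₂ := fun {a b f g} η => by
          refine eq_of_heq (HEq.trans ?_ (eqToHom_conj_heq _ _ _).symm)
          refine (heq_whiskerRight (hF.map_preimage _) (hF.map_preimage _) rfl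
            (hF.map₂_preimage₂ _)).trans ?_
          exact hE.conj_whiskerRight η }

end CategoryTheory.StrictPseudofunctor.FullyFaithful₂

end

/-! ### Mate pairs are determined by their left parts -/

section

namespace MatePair

variable {A B C E : Cat.{v, u}} {f : AdjHom A B} {h : A ⥤ C} {k : B ⥤ E} {g : AdjHom C E}

/-- The mate condition is applied to the counit at `b`, whose transpose is the identity of `f.R.obj
b`. -/
lemma ζ_eq (α : MatePair f h k g) (b : B) : α.ζ.app b = g.adj.homEquiv _ _
    (α.ξ.app (f.R.obj b) ≫ k.map (f.adj.counit.app b)) := by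
  rw [α.mates]
  simp [Adjunction.homEquiv_unit]

/-- Since right parts are functions of left parts, every coherence law between mate pairs may be
checked on left parts alone. All later equations of cells that are checked by components use this.
-/
lemma heq_of_ξ {f' : AdjHom A B} {h' : A ⥤ C} {k' : B ⥤ E} {g' : AdjHom C E}
    {α : MatePair f h k g} {β : MatePair f' h' k' g'}
    (hf : f = f') (hh : h = h') (hk : k = k') (hg : g = g')
    (hξ : ∀ a, HEq (α.ξ.app a) (β.ξ.app a)) : HEq α β := by
  refine MatePair.heq hf hh hk hg hξ fun b => ?_
  subst hf hh hk hg
  rw [α.ζ_eq, β.ζ_eq, eq_of_heq (hξ _)]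

/-- The mate pair with a given left part. -/
def ofξ (ξ : h ⋙ g.L ⟶ f.L ⋙ k) : MatePair f h k g where
  ξ := ξ
  ζ :=
    { app := fun b => g.adj.homEquiv _ _ (ξ.app (f.R.obj b) ≫ k.map (f.adj.counit.app b))
      naturality := fun b b' m => by
        have h₁ := ξ.naturality (f.R.map m)
        have h₂ := congrArg k.map (f.adj.counit.naturality m)
        dsimp at h₁ h₂ ⊢
        rw [← Adjunction.homEquiv_naturality_left, ← Adjunction.homEquiv_naturality_right,
          reassoc_of% h₁, Category.assoc, ← k.map_comp, h₂, k.map_comp] }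
  mates a b m := by
    -- Naturality of `ξ` along the transpose of `m` reduces the claim to recovering `m` from its
    -- transpose by the counit.
    have h₁ := ξ.naturality (f.adj.homEquiv a b m)
    dsimp at h₁ ⊢
    rw [← Adjunction.homEquiv_naturality_left, reassoc_of% h₁, ← k.map_comp,
      ← Adjunction.homEquiv_counit, Equiv.symm_apply_apply]

end MatePair

end

/-! ### The forgetful 2-functor to opindexed categories is 2-fully faithful -/

section

variable {B : Type u} [Category.{v} B] {Ω Ω' : BIIND B}

/-- Vertical arrows and cells of `HB B` are proofs of propositions, so `α` is the identity cell by
proof irrelevance. Naturality conditions in the vertical direction thus reduce to unit laws. -/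
lemma BIIND.cellMap_eq (Ω : BIIND B) {A C : HB B} (f : HHom A C) (h : VHom A A) (k : VHom C C)
    (α : Cell f h k f) : CellEq (Ω.cellMap α) (cellVId (Ω.hMap f)) :=
  .of_heq (Ω.cellMap_vId f) rfl (Ω.vMap_id A) (Ω.vMap_id C) rfl

/-- The vertical transformation whose left part is a given lax transformation. -/
noncomputable def vertTransOfLax (s : Lax.LaxTrans (leftPart Ω).toLax (leftPart Ω').toLax) :
    VertTrans Ω Ω' where
  app A := (s.app ⟨A.of⟩).toFunctor
  cell {A C} f := MatePair.ofξ (f := Ω.hMap f) (g := Ω'.hMap f)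
    (s.naturality (a := ⟨A.of⟩) (b := ⟨C.of⟩) (Quiver.Hom.toLoc f)).toNatTrans
  app_naturality {A C} h := by
    obtain ⟨rfl⟩ := h
    exact (congrArg (fun t => vComp t (s.app ⟨A.of⟩).toFunctor) (Ω.vMap_id A)).trans
      (congrArg (vComp (D := ADJ) (s.app ⟨A.of⟩).toFunctor) (Ω'.vMap_id A).symm)
  cell_naturality {A C A' C' f f' h k} α := by
    obtain ⟨rfl⟩ := h
    obtain ⟨rfl⟩ := k
    obtain ⟨α⟩ := α
    cases α
    exact ((CellEq.vcomp (Ω.cellMap_eq f _ _ _) .refl).trans <| (CellEq.id_vcomp _).trans <|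
      (CellEq.vcomp_id _).symm.trans <| CellEq.vcomp .refl (Ω'.cellMap_eq f _ _ _).symm).heq
  cell_id A := by
    -- On left parts this is the unit axiom of `s`. That axiom is stated with the inverses of the
    -- structure isomorphisms, and `map_id_aux'` passes to the isomorphisms themselves.
    refine MatePair.heq_of_ξ rfl rfl rfl rfl fun x => heq_of_eq ?_
    exact map_id_aux' (s.app ⟨A.of⟩).toFunctor (catIsoApp ((leftPart Ω').mapId ⟨A.of⟩) _)
      (catIsoApp ((leftPart Ω).mapId ⟨A.of⟩) x) (s := 𝟙 _)
      ((laxTrans_unit s ⟨A.of⟩ x).trans (Category.id_comp _).symm)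
  cell_comp {A C E} f g := by
    refine MatePair.heq_of_ξ rfl rfl rfl rfl fun x => heq_of_eq ?_
    exact map_id_aux' (s.app ⟨E.of⟩).toFunctor
      (catIsoApp ((leftPart Ω').mapComp (a := ⟨A.of⟩) (b := ⟨C.of⟩) (c := ⟨E.of⟩)
        (Quiver.Hom.toLoc f) (Quiver.Hom.toLoc g)) _)
      (catIsoApp ((leftPart Ω).mapComp (a := ⟨A.of⟩) (b := ⟨C.of⟩) (c := ⟨E.of⟩)
        (Quiver.Hom.toLoc f) (Quiver.Hom.toLoc g)) x)
      ((laxTrans_assoc s (a := ⟨A.of⟩) (b := ⟨C.of⟩) (c := ⟨E.of⟩) (Quiver.Hom.toLoc f)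
        (Quiver.Hom.toLoc g) x).trans (Category.assoc _ _ _).symm)

variable {σ τ : VertTrans Ω Ω'}

/-- The modification whose left part is a given modification of lax transformations. -/
noncomputable def modificationOfLax (m : Lax.LaxTrans.Modification (leftTrans σ) (leftTrans τ)) :
    DblModification σ τ where
  app A := MatePair.ofξ (f := AdjHom.id _) (g := AdjHom.id _) (h := σ.app A) (k := τ.app A)
    (m.app ⟨A.of⟩).toNatTrans
  horizontal {A C} f := by
    refine MatePair.heq_of_ξ ((AdjHom.id_comp _).trans (AdjHom.comp_id _).symm) rfl rfl
      ((AdjHom.id_comp _).trans (AdjHom.comp_id _).symm) fun x => heq_of_eq ?_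
    exact NatTrans.congr_app (congrArg (fun m => Cat.Hom₂.toNatTrans m)
      (m.naturality (a := ⟨A.of⟩) (b := ⟨C.of⟩) (Quiver.Hom.toLoc f))) x
  vertical {A C} h := by
    obtain ⟨rfl⟩ := h
    exact ((CellEq.vcomp .refl ((CellEq.hid (Ω'.vMap_id A)).trans
      (.of_eq (cellHId_vId _)))).trans <| (CellEq.vcomp_id _).trans <|
        (CellEq.id_vcomp _).symm.trans <|
      CellEq.vcomp ((CellEq.hid (Ω.vMap_id A)).trans (.of_eq (cellHId_vId _))).symm .refl).heq

end

section

variable (B : Type u) [Category.{v} B]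

open StrictPseudofunctor

-- Injectivity on 1-cells and 2-cells comes from `heq_of_ξ`. Surjectivity comes from completing each
-- left part to a mate pair with `ofξ`; the left part of the result is the given datum by
-- definition.
attribute [local instance] laxBicategory in
lemma forgetToLeft_fullyFaithful₂ : (forgetToLeft B).FullyFaithful₂ where
  map_bijective Ω Ω' := by
    constructor
    · intro σ τ h
      have H : leftTrans σ = leftTrans τ := congrArg InducedBicategory.Hom.hom h
      have h₁ : ∀ A, σ.app A = τ.app A := fun A =>
        congrArg (fun s : Lax.LaxTrans (leftPart Ω).toLax (leftPart Ω').toLax =>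
          (s.app ⟨A.of⟩).toFunctor) H
      refine VertTrans.ext' h₁ fun {A C} f => ?_
      refine .of_heq (MatePair.heq_of_ξ rfl (h₁ A) (h₁ C) rfl fun x => ?_) rfl (h₁ A) (h₁ C) rfl
      -- Generalizing to variables `s` and `t` permits substitution, which the compound sides of `H`
      -- do not.
      have key : ∀ {s t : Lax.LaxTrans (leftPart Ω).toLax (leftPart Ω').toLax}, s = t →
          HEq ((s.naturality (a := ⟨A.of⟩) (b := ⟨C.of⟩) (Quiver.Hom.toLoc f)).toNatTrans.app x)
            ((t.naturality (a := ⟨A.of⟩) (b := ⟨C.of⟩) (Quiver.Hom.toLoc f)).toNatTrans.app x) :=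
        fun e => by subst e; rfl
      exact key H
    · intro s
      exact ⟨vertTransOfLax s.hom, InducedBicategory.hom_ext (laxTrans_ext rfl fun f => HEq.rfl)⟩
  map₂_bijective {Ω Ω'} σ τ := by
    constructor
    · intro Ξ Θ h
      have H : leftModification Ξ = leftModification Θ :=
        congrArg (fun m => Lax.LaxTrans.Hom.as (InducedBicategory.Hom₂.hom m)) h
      refine DblModification.ext (funext fun A => eq_of_heq ?_)
      refine MatePair.heq_of_ξ rfl rfl rfl rfl fun x => heq_of_eq ?_
      exact congrArg (fun m : Lax.LaxTrans.Modification (leftTrans σ) (leftTrans τ) =>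
        (m.app ⟨A.of⟩).toNatTrans.app x) H
    · intro m
      refine ⟨modificationOfLax m.hom.as, InducedBicategory.hom₂_ext
        (Lax.LaxTrans.homCategory.ext fun a => cat_hom₂_ext fun x => rfl)⟩

end

/-! ### The Grothendieck op-construction is 2-fully faithful -/

/-- A 2-cell between functors is determined by its components, up to equality of boundaries. -/
lemma cat_hom₂_hext {C D : Cat.{v, u}} {F F' G G' : C ⟶ D} {α : F ⟶ G} {β : F' ⟶ G'} (hF : F = F')
    (hG : G = G') (h : ∀ x, HEq (α.toNatTrans.app x) (β.toNatTrans.app x)) : HEq α β := by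
  subst hF hG
  exact heq_of_eq (cat_hom₂_ext fun x => eq_of_heq (h x))

/-- Conjugation by equalities does not change a morphism, up to equality of boundaries. -/
lemma conj_heq {C : Type u} [Category.{v} C] {a b c d : C} (p : a = b) (k : b ⟶ c) (q : c = d) :
    HEq (eqToHom p ≫ k ≫ eqToHom q) k := by
  subst p q; simp

namespace OpG

variable {J : Type u} [Category.{v} J] {F G : LocallyDiscrete J ⥤ᵖ Cat.{v, u}}

/-- A morphism of the Grothendieck op-construction, given by its components. -/
def homMk {A A' : J} {x : F.obj ⟨A⟩} {y : F.obj ⟨A'⟩} (f : A ⟶ A')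
    (m : (F.map f.toLoc).toFunctor.obj x ⟶ y) :
    (⟨A, x⟩ : Pseudofunctor.Grothendieck F) ⟶ ⟨A', y⟩ :=
  ⟨f, m⟩

section

variable {A A' A'' : J} {x x' : F.obj ⟨A⟩} {y y' : F.obj ⟨A'⟩} {z : F.obj ⟨A''⟩}

lemma homMk_injective {f : A ⟶ A'} {m n : (F.map f.toLoc).toFunctor.obj x ⟶ y}
    (h : homMk f m = homMk f n) : m = n :=
  eq_of_heq ((Pseudofunctor.Grothendieck.Hom.mk.injEq _ _ _ _).mp h).2

lemma exists_homMk (k : (⟨A, x⟩ : Pseudofunctor.Grothendieck F) ⟶ ⟨A', y⟩) {f : A ⟶ A'}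
    (h : k.base = f) : ∃ m, k = homMk f m := by
  subst h; exact ⟨k.fiber, rfl⟩

lemma homMk_vert (f : A ⟶ A') (m : (F.map f.toLoc).toFunctor.obj x ⟶ y) (n : y ⟶ y') :
    homMk f m ≫ vert n = homMk f (m ≫ n) :=
  comp_vert _ _

lemma vert_homMk (f : A ⟶ A') (n : x ⟶ x') (m : (F.map f.toLoc).toFunctor.obj x' ⟶ y) :
    vert n ≫ homMk f m = homMk f ((F.map f.toLoc).toFunctor.map n ≫ m) :=
  vert_comp _ _

lemma vert_injective {m n : x ⟶ x'} (h : vert m = vert n) : m = n :=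
  (cancel_epi (catIsoApp (F.mapId ⟨A⟩) x).hom).1 (homMk_injective h)

/-- A morphism over an identity has a fibre component out of the direct image of `x` under `𝟙 A`;
the invertible unit constraint replaces that object by `x`. -/
lemma exists_vert (k : (⟨A, x⟩ : Pseudofunctor.Grothendieck F) ⟶ ⟨A, x'⟩) (h : k.base = 𝟙 A) :
    ∃ m, k = vert m := by
  obtain ⟨m, rfl⟩ := exists_homMk k h
  exact ⟨(catIsoApp (F.mapId ⟨A⟩) x).inv ≫ m, congrArg (homMk _)
    ((catIsoApp (F.mapId ⟨A⟩) x).hom_inv_id_assoc m).symm⟩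

end

/-- The opcartesian morphism over `f`. -/
def lift {A A' : J} (f : A ⟶ A') (x : F.obj ⟨A⟩) : (⟨A, x⟩ : Pseudofunctor.Grothendieck F) ⟶
    ⟨A', (F.map f.toLoc).toFunctor.obj x⟩ :=
  homMk f (𝟙 _)

section

variable {A A' A'' : J} (f : A ⟶ A') (g : A' ⟶ A'')

/-- Opcartesian lifts and vertical morphisms generate the total category. A functor over the base
carries the relations `vert_lift`, `lift_id` and `lift_comp` to the naturality, unit and composition
laws of a lax transformation. -/
lemma lift_vert {x : F.obj ⟨A⟩} {y : F.obj ⟨A'⟩} (m : (F.map f.toLoc).toFunctor.obj x ⟶ y) :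
    lift f x ≫ vert m = homMk f m := by
  rw [lift, homMk_vert, Category.id_comp]

lemma vert_lift {x y : F.obj ⟨A⟩} (m : x ⟶ y) :
    vert m ≫ lift f y = lift f x ≫ vert ((F.map f.toLoc).toFunctor.map m) := by
  rw [lift_vert, lift, vert_homMk, Category.comp_id]

lemma lift_id (x : F.obj ⟨A⟩) :
    lift (𝟙 A) x = vert ((F.mapId ⟨A⟩).inv.toNatTrans.app x) :=
  (congrArg (homMk (𝟙 A)) (catIso_hom_inv (F.mapId ⟨A⟩) x)).symm

lemma lift_comp (x : F.obj ⟨A⟩) :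
    lift (f ≫ g) x = (lift f x ≫ lift g _) ≫
      vert ((F.mapComp f.toLoc g.toLoc).inv.toNatTrans.app x) := by
  refine Eq.trans (congrArg (homMk (f ≫ g)) (Eq.symm ?_)) (homMk_vert (f ≫ g) _ _).symm
  refine Eq.trans (congrArg (· ≫ _) ?_) (catIso_hom_inv (F.mapComp f.toLoc g.toLoc) x)
  exact (congrArg ((F.mapComp f.toLoc g.toLoc).hom.toNatTrans.app x ≫ ·)
    ((Category.comp_id _).trans ((F.map g.toLoc).toFunctor.map_id _))).trans (Category.comp_id _)

lemma map_lift (σ : Lax.LaxTrans F.toLax G.toLax) (x : F.obj ⟨A⟩) :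
    (opGrothendieckMap σ).map (lift f x) = homMk f ((σ.naturality f.toLoc).toNatTrans.app x) :=
  congrArg (homMk f) ((congrArg ((σ.naturality f.toLoc).toNatTrans.app x ≫ ·)
    ((σ.app ⟨A'⟩).toFunctor.map_id _)).trans (Category.comp_id _))

end

lemma vert_heq {A : J} {x x' y y' : F.obj ⟨A⟩} {m : x ⟶ y} {m' : x' ⟶ y'} (hx : x = x')
    (hy : y = y') (h : HEq (vert m) (vert m')) : HEq m m' := by
  subst hx hy
  exact heq_of_eq (vert_injective (eq_of_heq h))

lemma homMk_heq {A A' : J} {f : A ⟶ A'} {x x' : F.obj ⟨A⟩} {y y' : F.obj ⟨A'⟩}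
    {m : (F.map f.toLoc).toFunctor.obj x ⟶ y} {m' : (F.map f.toLoc).toFunctor.obj x' ⟶ y'}
    (hx : x = x') (hy : y = y') (h : HEq (homMk f m) (homMk f m')) : HEq m m' := by
  subst hx hy
  exact heq_of_eq (homMk_injective (eq_of_heq h))

/-- Vertical morphisms recover the functors between fibres (`map_vert`), and opcartesian lifts
recover the 2-cells (`map_lift`). -/
lemma opGrothendieckMap_injective {σ τ : Lax.LaxTrans F.toLax G.toLax}
    (h : opGrothendieckMap σ = opGrothendieckMap τ) : σ = τ := by
  have hobj : ∀ (A : J) (x : F.obj ⟨A⟩), (σ.app ⟨A⟩).toFunctor.obj x =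
      (τ.app ⟨A⟩).toFunctor.obj x := fun A x =>
    eq_of_heq ((Pseudofunctor.Grothendieck.mk.injEq _ _ _ _).mp (Functor.congr_obj h ⟨A, x⟩)).2
  have hmap : ∀ {a b : Pseudofunctor.Grothendieck F} (f : a ⟶ b),
      HEq ((opGrothendieckMap σ).map f) ((opGrothendieckMap τ).map f) := fun f => by rw [h]
  have happ : σ.app = τ.app := funext fun a => Cat.Hom.ext <| Functor.hext (hobj a.as)
    fun x y m => vert_heq (A := a.as) (hobj _ x) (hobj _ y)
      ((heq_of_eq (map_vert σ (A := a.as) m).symm).trans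
        ((hmap _).trans (heq_of_eq (map_vert τ (A := a.as) m))))
  refine laxTrans_ext happ fun {a b} f => ?_
  refine cat_hom₂_hext (by rw [happ]) (by rw [happ]) fun x => ?_
  refine homMk_heq (A := a.as) (A' := b.as) (f := f.as) (hobj _ x) (hobj _ _) ?_
  exact (heq_of_eq (map_lift f.as σ x).symm).trans ((hmap _).trans (heq_of_eq (map_lift f.as τ x)))

/-- The functor is given on literal pairs and keeps the base object by definition, so that no
transport enters the construction of the transformation. The general case is reduced to this one in
`opGrothendieckMap_surjective`. -/
lemma exists_laxTrans_of_map (t : ∀ {A : J}, F.obj ⟨A⟩ → G.obj ⟨A⟩)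
    (m : ∀ {A A' : J} {x : F.obj ⟨A⟩} {y : F.obj ⟨A'⟩}
      (f : (⟨A, x⟩ : Pseudofunctor.Grothendieck F) ⟶ ⟨A', y⟩),
        (⟨A, t x⟩ : Pseudofunctor.Grothendieck G) ⟶ ⟨A', t y⟩)
    (m_id : ∀ {A : J} (x : F.obj ⟨A⟩), m (𝟙 (⟨A, x⟩ : Pseudofunctor.Grothendieck F)) = 𝟙 _)
    (m_comp : ∀ {A A' A'' : J} {x : F.obj ⟨A⟩} {y : F.obj ⟨A'⟩} {z : F.obj ⟨A''⟩}
      (f : (⟨A, x⟩ : Pseudofunctor.Grothendieck F) ⟶ ⟨A', y⟩)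
      (g : (⟨A', y⟩ : Pseudofunctor.Grothendieck F) ⟶ ⟨A'', z⟩), m (f ≫ g) = m f ≫ m g)
    (m_base : ∀ {A A' : J} {x : F.obj ⟨A⟩} {y : F.obj ⟨A'⟩}
      (f : (⟨A, x⟩ : Pseudofunctor.Grothendieck F) ⟶ ⟨A', y⟩), (m f).base = f.base) :
    ∃ σ : Lax.LaxTrans F.toLax G.toLax, ∃ h : ∀ (A : J) (x : F.obj ⟨A⟩),
      (σ.app ⟨A⟩).toFunctor.obj x = t x, ∀ {A A' : J} {x : F.obj ⟨A⟩} {y : F.obj ⟨A'⟩}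
      (f : (⟨A, x⟩ : Pseudofunctor.Grothendieck F) ⟶ ⟨A', y⟩),
        HEq ((opGrothendieckMap σ).map f) (m f) := by
  -- `v` is the action on the fibres, read from images of vertical morphisms; `n` gives the lax
  -- components, read from images of opcartesian lifts.
  choose v hv using fun (A : J) (x y : F.obj ⟨A⟩) (φ : x ⟶ y) =>
    exists_vert (m (vert φ)) (m_base _)
  choose n hn using fun (A A' : J) (f : A ⟶ A') (x : F.obj ⟨A⟩) =>
    exists_homMk (m (lift f x)) (m_base _)
  have v_id : ∀ (A : J) (x : F.obj ⟨A⟩), v A x x (𝟙 x) = 𝟙 _ := fun A x =>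
    vert_injective (by rw [← hv, vert_id, m_id, vert_id])
  have v_comp : ∀ (A : J) (x y z : F.obj ⟨A⟩) (φ : x ⟶ y) (ψ : y ⟶ z),
      v A x z (φ ≫ ψ) = v A x y φ ≫ v A y z ψ := fun A x y z φ ψ =>
    vert_injective (by rw [← hv, ← vert_vert, m_comp, ← vert_vert, ← hv, ← hv])
  have n_nat : ∀ (A A' : J) (f : A ⟶ A') (x y : F.obj ⟨A⟩) (φ : x ⟶ y),
      (G.map f.toLoc).toFunctor.map (v A x y φ) ≫ n A A' f y =
        n A A' f x ≫ v A' _ _ ((F.map f.toLoc).toFunctor.map φ) := fun A A' f x y φ =>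
    homMk_injective (by
      have h := congrArg m (vert_lift f φ)
      rw [m_comp, m_comp, hn, hn, hv, hv] at h
      exact (vert_homMk _ _ _).symm.trans (h.trans (homMk_vert _ _ _)))
  have n_id : ∀ (A : J) (x : F.obj ⟨A⟩), n A A (𝟙 A) x =
      (G.mapId ⟨A⟩).hom.toNatTrans.app (t x) ≫ v A _ _ ((F.mapId ⟨A⟩).inv.toNatTrans.app x) :=
    fun A x => homMk_injective (by
      exact (hn _ _ _ _).symm.trans ((congrArg m (lift_id x)).trans (hv _ _ _ _)))
  have n_comp : ∀ (A A' A'' : J) (f : A ⟶ A') (g : A' ⟶ A'') (x : F.obj ⟨A⟩),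
      n A A'' (f ≫ g) x = (G.mapComp f.toLoc g.toLoc).hom.toNatTrans.app (t x) ≫
        (G.map g.toLoc).toFunctor.map (n A A' f x) ≫ n A' A'' g _ ≫
          v A'' _ _ ((F.mapComp f.toLoc g.toLoc).inv.toNatTrans.app x) :=
    fun A A' A'' f g x => homMk_injective (by
      refine (hn _ _ _ _).symm.trans ((congrArg m (lift_comp f g x)).trans ((m_comp _ _).trans
        ((congrArg₂ (· ≫ ·) ((m_comp _ _).trans (congrArg₂ (· ≫ ·) (hn _ _ _ _) (hn _ _ _ _)))
          (hv _ _ _ _)).trans ((homMk_vert (f ≫ g) _ _).trans (congrArg (homMk (f ≫ g)) ?_)))))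
      exact (Category.assoc _ _ _).trans (congrArg (_ ≫ ·) (Category.assoc _ _ _)))
  let T : ∀ A : J, F.obj ⟨A⟩ ⥤ G.obj ⟨A⟩ := fun A =>
    { obj := t
      map := fun {x y} φ => v A x y φ
      map_id := v_id A
      map_comp := v_comp A _ _ _ }
  let N : ∀ {A A' : J} (f : A ⟶ A'), (T A).toCatHom ≫ G.map f.toLoc ⟶
      F.map f.toLoc ≫ (T A').toCatHom := fun {A A'} f => NatTrans.toCatHom₂
    { app := fun x => n A A' f x
      naturality := fun x y φ => n_nat A A' f x y φ }
  refine ⟨{ app := fun a => (T a.as).toCatHom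
            naturality := fun {a b} f => N f.as
            naturality_naturality := fun {a b f g} η => discrete_naturality (F := F) (G := G)
              (fun a => (T a.as).toCatHom) (fun {a b} f => N f.as) η
            naturality_id := fun a => cat_hom₂_ext fun x => ?_
            naturality_comp := fun {a b c} f g => cat_hom₂_ext fun x => ?_ },
    fun A x => rfl, fun {A A' x y} f => heq_of_eq ?_⟩
  · refine Eq.trans ?_ ((Category.id_comp _).trans (Category.id_comp _)).symm
    exact (catIsoApp (G.mapId a) (t (A := a.as) x)).inv_comp_eq.2 (n_id a.as x)
  · refine Eq.trans ?_ (id_comp_cancel _ _ _).symm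
    exact (catIsoApp (G.mapComp f g) (t (A := a.as) x)).inv_comp_eq.2
      (n_comp a.as b.as c.as f.as g.as x)
  -- Both sides agree on lifts and on vertical morphisms, hence on their composite `f`.
  · have h := congrArg m (lift_vert f.base f.fiber)
    rw [m_comp, hn, hv] at h
    exact (homMk_vert _ _ _).symm.trans h

lemma exists_eq_mk (z : Pseudofunctor.Grothendieck G) {A : J} (h : z.base = A) :
    ∃ y : G.obj ⟨A⟩, z = ⟨A, y⟩ := by
  subst h; exact ⟨z.fiber, rfl⟩

lemma opGrothendieckMap_surjective
    (H : Pseudofunctor.Grothendieck F ⥤ Pseudofunctor.Grothendieck G)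
    (w : H ⋙ Pseudofunctor.Grothendieck.forget G = Pseudofunctor.Grothendieck.forget F) :
    ∃ σ : Lax.LaxTrans F.toLax G.toLax, opGrothendieckMap σ = H := by
  have hw : ∀ (A : J) (x : F.obj ⟨A⟩), (H.obj ⟨A, x⟩).base = A := fun A x =>
    Functor.congr_obj w ⟨A, x⟩
  choose t ht using fun (A : J) (x : F.obj ⟨A⟩) => exists_eq_mk (H.obj ⟨A, x⟩) (hw A x)
  -- The object `H.obj ⟨A, x⟩` is a pair over `A` only up to the equation `ht`; conjugating by
  -- `eqToHom` yields a functorial assignment on literal pairs.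
  obtain ⟨σ, hσ, hσ'⟩ := exists_laxTrans_of_map (F := F) (G := G) (fun {A} x => t A x)
    (fun {A A' x y} f => eqToHom (ht A x).symm ≫ H.map f ≫ eqToHom (ht A' y)) (by simp) (by simp)
    (fun {A A' x y} f => by
      have h₁ := Functor.congr_hom w f
      simp only [Functor.comp_map, Pseudofunctor.Grothendieck.forget_map] at h₁
      have e : ∀ {z z' y y' : Pseudofunctor.Grothendieck G} (p : z = z') (k : z' ⟶ y) (q : y = y'),
          HEq (eqToHom p ≫ k ≫ eqToHom q).base k.base := by rintro _ _ _ _ rfl k rfl; simp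
      exact eq_of_heq ((e _ _ _).trans ((heq_of_eq h₁).trans (conj_heq _ _ _))))
  refine ⟨σ, Functor.hext (fun a => (congrArg (Pseudofunctor.Grothendieck.mk a.base)
    (hσ a.base a.fiber)).trans (ht _ _).symm) fun a b f => (hσ' f).trans ?_⟩
  exact conj_heq _ _ _

lemma isHomLift_base {X Y : Pseudofunctor.Grothendieck F} {f : X.base ⟶ Y.base} {k : X ⟶ Y}
    (h : (Pseudofunctor.Grothendieck.forget F).IsHomLift f k) : k.base = f :=
  (@IsHomLift.eq_of_isHomLift _ _ _ _ (Pseudofunctor.Grothendieck.forget F) _ _ f k h).symm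

/-- The components of `α` are vertical. Their naturality against vertical morphisms is naturality
inside a fibre, and their naturality against opcartesian lifts is the modification axiom. -/
lemma exists_modification {σ τ : Lax.LaxTrans F.toLax G.toLax}
    (α : opGrothendieckMap σ ⟶ opGrothendieckMap τ) (hα : ∀ a, (α.app a).base = 𝟙 a.base) :
    ∃ Ξ : Lax.LaxTrans.Modification σ τ, mapModification Ξ = α := by
  choose c hc using fun (A : J) (x : F.obj ⟨A⟩) => exists_vert (α.app ⟨A, x⟩) (hα ⟨A, x⟩)
  have c_nat : ∀ (A : J) (x y : F.obj ⟨A⟩) (φ : x ⟶ y), (σ.app ⟨A⟩).toFunctor.map φ ≫ c A y =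
      c A x ≫ (τ.app ⟨A⟩).toFunctor.map φ := fun A x y φ => vert_injective <| by
    exact (vert_vert _ _).symm.trans ((congrArg₂ (· ≫ ·) (map_vert σ φ) (hc A y)).symm.trans
      ((α.naturality (vert φ)).trans ((congrArg₂ (· ≫ ·) (hc A x) (map_vert τ φ)).trans
        (vert_vert _ _))))
  have c_lift : ∀ (A A' : J) (f : A ⟶ A') (x : F.obj ⟨A⟩),
      (G.map f.toLoc).toFunctor.map (c A x) ≫ (τ.naturality f.toLoc).toNatTrans.app x =
        (σ.naturality f.toLoc).toNatTrans.app x ≫ c A' _ := fun A A' f x => homMk_injective <|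
    (vert_homMk _ _ _).symm.trans <| Eq.trans
      ((congrArg₂ (· ≫ ·) (hc A x) (map_lift f τ x)).symm.trans
      ((α.naturality (lift f x)).symm.trans (congrArg₂ (· ≫ ·) (map_lift f σ x) (hc A' _))))
      (homMk_vert _ _ _)
  refine ⟨⟨fun a => NatTrans.toCatHom₂ ⟨fun x => c a.as x, fun x y φ => c_nat a.as x y φ⟩,
    fun {a b} f => cat_hom₂_ext fun x => c_lift a.as b.as f.as x⟩, ?_⟩
  exact NatTrans.ext (funext fun a => (hc a.base a.fiber).symm)

end OpG

section

variable (B : Type u) [Category.{v} B]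

open StrictPseudofunctor

-- The 1-cells of `BIFIB B` need not preserve opcartesian morphisms, which is why the components of
-- the matching lax transformations need not be invertible. The 2-cells lie over identities, so
-- their components are vertical.
attribute [local instance] laxBicategory in
lemma opGrothendieck_fullyFaithful₂ : (opGrothendieck B).FullyFaithful₂ where
  map_bijective Φ Ψ := by
    refine ⟨fun σ τ h => InducedBicategory.hom_ext (OpG.opGrothendieckMap_injective
      (congrArg (fun M => BasedFunctor.toFunctor (InducedBicategory.Hom.hom M)) h)), fun M => ?_⟩
    obtain ⟨σ, hσ⟩ := OpG.opGrothendieckMap_surjective M.hom.toFunctor M.hom.w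
    exact ⟨InducedBicategory.mkHom σ, bifib_hom_ext hσ⟩
  map₂_bijective {Φ Ψ} σ τ := by
    refine ⟨fun Ξ Θ h => ?_, fun α => ?_⟩
    · refine InducedBicategory.hom₂_ext (Lax.LaxTrans.homCategory.ext fun a =>
        cat_hom₂_ext fun x => OpG.vert_injective (A := a.as) ?_)
      exact congrArg (fun α : (opGrothendieck B).map σ ⟶ (opGrothendieck B).map τ =>
        (BasedNatTrans.toNatTrans α.hom).app ⟨a.as, x⟩) h
    · obtain ⟨Ξ, hΞ⟩ := OpG.exists_modification (BasedNatTrans.toNatTrans α.hom)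
        fun a => OpG.isHomLift_base (α.hom.isHomLift' a)
      exact ⟨InducedBicategory.Hom₂.mk ⟨Ξ⟩, bifib_hom₂_ext fun x => NatTrans.congr_app hΞ x⟩

end

/-! ### The Grothendieck construction is 2-fully faithful -/

namespace CoG

variable {J : Type u} [Category.{v} J] {F G : LocallyDiscrete Jᵒᵖ ⥤ᵖ Cat.{v, u}}

/-- A morphism of the Grothendieck construction, given by its components. -/
def homMk {A A' : J} {x : F.obj ⟨op A⟩} {y : F.obj ⟨op A'⟩} (f : A ⟶ A')
    (m : x ⟶ (F.map f.op.toLoc).toFunctor.obj y) :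
    (⟨A, x⟩ : Pseudofunctor.CoGrothendieck F) ⟶ ⟨A', y⟩ :=
  ⟨f, m⟩

section

variable {A A' A'' : J} {x x' : F.obj ⟨op A⟩} {y y' : F.obj ⟨op A'⟩} {z : F.obj ⟨op A''⟩}

lemma homMk_injective {f : A ⟶ A'} {m n : x ⟶ (F.map f.op.toLoc).toFunctor.obj y}
    (h : homMk f m = homMk f n) : m = n :=
  eq_of_heq ((Pseudofunctor.CoGrothendieck.Hom.mk.injEq _ _ _ _).mp h).2

lemma exists_homMk (k : (⟨A, x⟩ : Pseudofunctor.CoGrothendieck F) ⟶ ⟨A', y⟩) {f : A ⟶ A'}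
    (h : k.base = f) : ∃ m, k = homMk f m := by
  subst h; exact ⟨k.fiber, rfl⟩

lemma vert_homMk (f : A ⟶ A') (n : x ⟶ x') (m : x' ⟶ (F.map f.op.toLoc).toFunctor.obj y) :
    vert n ≫ homMk f m = homMk f (n ≫ m) :=
  vert_comp _ _

lemma homMk_vert (f : A ⟶ A') (m : x ⟶ (F.map f.op.toLoc).toFunctor.obj y) (n : y ⟶ y') :
    homMk f m ≫ vert n = homMk f (m ≫ (F.map f.op.toLoc).toFunctor.map n) :=
  comp_vert _ _

lemma vert_injective {m n : x ⟶ x'} (h : vert m = vert n) : m = n :=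
  (cancel_mono (catIsoApp (F.mapId ⟨op A⟩) x').inv).1 (homMk_injective h)

lemma exists_vert (k : (⟨A, x⟩ : Pseudofunctor.CoGrothendieck F) ⟶ ⟨A, x'⟩) (h : k.base = 𝟙 A) :
    ∃ m, k = vert m := by
  obtain ⟨m, rfl⟩ := exists_homMk k h
  exact ⟨m ≫ (catIsoApp (F.mapId ⟨op A⟩) x').hom, congrArg (homMk _)
    (((Category.assoc _ _ _).trans (congrArg (m ≫ ·)
      (catIsoApp (F.mapId ⟨op A⟩) x').hom_inv_id)).trans (Category.comp_id m)).symm⟩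

end

/-- The cartesian morphism over `f`. -/
def lift {A A' : J} (f : A ⟶ A') (y : F.obj ⟨op A'⟩) :
    (⟨A, (F.map f.op.toLoc).toFunctor.obj y⟩ : Pseudofunctor.CoGrothendieck F) ⟶ ⟨A', y⟩ :=
  homMk f (𝟙 _)

section

variable {A A' A'' : J} (f : A ⟶ A') (g : A' ⟶ A'')

/-- Dually to the op-construction, each morphism is a vertical morphism followed by a cartesian
lift. The relations below translate into the axioms of an oplax transformation. -/
lemma vert_lift {x : F.obj ⟨op A⟩} {y : F.obj ⟨op A'⟩}
    (m : x ⟶ (F.map f.op.toLoc).toFunctor.obj y) : vert m ≫ lift f y = homMk f m :=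
  (vert_homMk _ _ _).trans (congrArg (homMk f) (Category.comp_id m))

lemma lift_vert {x y : F.obj ⟨op A'⟩} (m : x ⟶ y) :
    lift f x ≫ vert m = vert ((F.map f.op.toLoc).toFunctor.map m) ≫ lift f y :=
  ((homMk_vert _ _ _).trans (congrArg (homMk f) (Category.id_comp _))).trans (vert_lift f _).symm

lemma lift_id (y : F.obj ⟨op A⟩) :
    lift (𝟙 A) y = vert ((F.mapId ⟨op A⟩).hom.toNatTrans.app y) :=
  (congrArg (homMk (𝟙 A)) (catIso_hom_inv (F.mapId ⟨op A⟩) y)).symm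

lemma lift_comp (z : F.obj ⟨op A''⟩) :
    lift (f ≫ g) z = vert ((F.mapComp g.op.toLoc f.op.toLoc).hom.toNatTrans.app z) ≫
      (lift f _ ≫ lift g z) := by
  refine Eq.trans (congrArg (homMk (f ≫ g)) (Eq.symm ?_)) (vert_homMk (f ≫ g) _ _).symm
  refine Eq.trans (congrArg (_ ≫ ·) ?_) (catIso_hom_inv (F.mapComp g.op.toLoc f.op.toLoc) z)
  exact (Category.id_comp _).trans ((congrArg (· ≫ (F.mapComp g.op.toLoc
    f.op.toLoc).inv.toNatTrans.app z) ((F.map f.op.toLoc).toFunctor.map_id _)).trans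
    (Category.id_comp _))

lemma map_lift (σ : Lax.OplaxTrans F.toLax G.toLax) (y : F.obj ⟨op A'⟩) :
    (grothendieckMap σ).map (lift f y) =
      homMk f ((σ.naturality f.op.toLoc).toNatTrans.app y) :=
  congrArg (homMk f) ((congrArg (· ≫ (σ.naturality f.op.toLoc).toNatTrans.app y)
    ((σ.app ⟨op A⟩).toFunctor.map_id _)).trans (Category.id_comp _))

end

lemma vert_heq {A : J} {x x' y y' : F.obj ⟨op A⟩} {m : x ⟶ y} {m' : x' ⟶ y'} (hx : x = x')
    (hy : y = y') (h : HEq (vert m) (vert m')) : HEq m m' := by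
  subst hx hy
  exact heq_of_eq (vert_injective (eq_of_heq h))

lemma homMk_heq {A A' : J} {f : A ⟶ A'} {x x' : F.obj ⟨op A⟩} {y y' : F.obj ⟨op A'⟩}
    {m : x ⟶ (F.map f.op.toLoc).toFunctor.obj y} {m' : x' ⟶ (F.map f.op.toLoc).toFunctor.obj y'}
    (hx : x = x') (hy : y = y') (h : HEq (homMk f m) (homMk f m')) : HEq m m' := by
  subst hx hy
  exact heq_of_eq (homMk_injective (eq_of_heq h))

lemma grothendieckMap_injective {σ τ : Lax.OplaxTrans F.toLax G.toLax}
    (h : grothendieckMap σ = grothendieckMap τ) : σ = τ := by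
  have hobj : ∀ (A : J) (x : F.obj ⟨op A⟩), (σ.app ⟨op A⟩).toFunctor.obj x =
      (τ.app ⟨op A⟩).toFunctor.obj x := fun A x =>
    eq_of_heq ((Pseudofunctor.CoGrothendieck.mk.injEq _ _ _ _).mp (Functor.congr_obj h ⟨A, x⟩)).2
  have hmap : ∀ {a b : Pseudofunctor.CoGrothendieck F} (f : a ⟶ b),
      HEq ((grothendieckMap σ).map f) ((grothendieckMap τ).map f) := fun f => by rw [h]
  have happ : σ.app = τ.app := funext fun a => Cat.Hom.ext <| Functor.hext (hobj a.as.unop)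
    fun x y m => vert_heq (A := a.as.unop) (hobj _ x) (hobj _ y)
      ((heq_of_eq (map_vert σ (A := a.as.unop) m).symm).trans
        ((hmap _).trans (heq_of_eq (map_vert τ (A := a.as.unop) m))))
  refine oplaxTrans_ext happ fun {a b} f => ?_
  refine cat_hom₂_hext (by rw [happ]) (by rw [happ]) fun x => ?_
  refine homMk_heq (A := b.as.unop) (A' := a.as.unop) (f := f.as.unop) (hobj _ _) (hobj _ x) ?_
  exact (heq_of_eq (map_lift f.as.unop σ x).symm).trans
    ((hmap _).trans (heq_of_eq (map_lift f.as.unop τ x)))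

/-- The cartesian counterpart of `OpG.exists_laxTrans_of_map`: images of cartesian lifts supply the
oplax components, which point into inverse images. -/
lemma exists_oplaxTrans_of_map (t : ∀ {A : J}, F.obj ⟨op A⟩ → G.obj ⟨op A⟩)
    (m : ∀ {A A' : J} {x : F.obj ⟨op A⟩} {y : F.obj ⟨op A'⟩}
      (f : (⟨A, x⟩ : Pseudofunctor.CoGrothendieck F) ⟶ ⟨A', y⟩),
        (⟨A, t x⟩ : Pseudofunctor.CoGrothendieck G) ⟶ ⟨A', t y⟩)
    (m_id : ∀ {A : J} (x : F.obj ⟨op A⟩),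
      m (𝟙 (⟨A, x⟩ : Pseudofunctor.CoGrothendieck F)) = 𝟙 _)
    (m_comp : ∀ {A A' A'' : J} {x : F.obj ⟨op A⟩} {y : F.obj ⟨op A'⟩} {z : F.obj ⟨op A''⟩}
      (f : (⟨A, x⟩ : Pseudofunctor.CoGrothendieck F) ⟶ ⟨A', y⟩)
      (g : (⟨A', y⟩ : Pseudofunctor.CoGrothendieck F) ⟶ ⟨A'', z⟩), m (f ≫ g) = m f ≫ m g)
    (m_base : ∀ {A A' : J} {x : F.obj ⟨op A⟩} {y : F.obj ⟨op A'⟩}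
      (f : (⟨A, x⟩ : Pseudofunctor.CoGrothendieck F) ⟶ ⟨A', y⟩), (m f).base = f.base) :
    ∃ σ : Lax.OplaxTrans F.toLax G.toLax, ∃ h : ∀ (A : J) (x : F.obj ⟨op A⟩),
      (σ.app ⟨op A⟩).toFunctor.obj x = t x, ∀ {A A' : J} {x : F.obj ⟨op A⟩} {y : F.obj ⟨op A'⟩}
      (f : (⟨A, x⟩ : Pseudofunctor.CoGrothendieck F) ⟶ ⟨A', y⟩),
        HEq ((grothendieckMap σ).map f) (m f) := by
  choose v hv using fun (A : J) (x y : F.obj ⟨op A⟩) (φ : x ⟶ y) =>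
    exists_vert (m (vert φ)) (m_base _)
  choose n hn using fun (A A' : J) (f : A ⟶ A') (y : F.obj ⟨op A'⟩) =>
    exists_homMk (m (lift f y)) (m_base _)
  have v_id : ∀ (A : J) (x : F.obj ⟨op A⟩), v A x x (𝟙 x) = 𝟙 _ := fun A x =>
    vert_injective (by rw [← hv, vert_id, m_id, vert_id])
  have v_comp : ∀ (A : J) (x y z : F.obj ⟨op A⟩) (φ : x ⟶ y) (ψ : y ⟶ z),
      v A x z (φ ≫ ψ) = v A x y φ ≫ v A y z ψ := fun A x y z φ ψ =>
    vert_injective (by rw [← hv, ← vert_vert, m_comp, ← vert_vert, ← hv, ← hv])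
  have n_nat : ∀ (A A' : J) (f : A ⟶ A') (x y : F.obj ⟨op A'⟩) (φ : x ⟶ y),
      v A _ _ ((F.map f.op.toLoc).toFunctor.map φ) ≫ n A A' f y =
        n A A' f x ≫ (G.map f.op.toLoc).toFunctor.map (v A' x y φ) := fun A A' f x y φ =>
    homMk_injective (by
      have h := congrArg m (lift_vert f φ)
      rw [m_comp, m_comp, hn, hn, hv, hv] at h
      exact (vert_homMk _ _ _).symm.trans (h.symm.trans (homMk_vert _ _ _)))
  have n_id : ∀ (A : J) (x : F.obj ⟨op A⟩), n A A (𝟙 A) x =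
      v A _ _ ((F.mapId ⟨op A⟩).hom.toNatTrans.app x) ≫
        (G.mapId ⟨op A⟩).inv.toNatTrans.app (t x) :=
    fun A x => homMk_injective (by
      exact (hn _ _ _ _).symm.trans ((congrArg m (lift_id x)).trans (hv _ _ _ _)))
  have n_comp : ∀ (A A' A'' : J) (f : A ⟶ A') (g : A' ⟶ A'') (x : F.obj ⟨op A''⟩),
      n A A'' (f ≫ g) x = v A _ _ ((F.mapComp g.op.toLoc f.op.toLoc).hom.toNatTrans.app x) ≫
        n A A' f _ ≫ (G.map f.op.toLoc).toFunctor.map (n A' A'' g x) ≫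
          (G.mapComp g.op.toLoc f.op.toLoc).inv.toNatTrans.app (t x) :=
    fun A A' A'' f g x => homMk_injective (by
      exact (hn _ _ _ _).symm.trans ((congrArg m (lift_comp f g x)).trans ((m_comp _ _).trans
        ((congrArg₂ (· ≫ ·) (hv _ _ _ _) ((m_comp _ _).trans (congrArg₂ (· ≫ ·) (hn _ _ _ _)
          (hn _ _ _ _)))).trans (vert_homMk (f ≫ g) _ _)))))
  let T : ∀ A : J, F.obj ⟨op A⟩ ⥤ G.obj ⟨op A⟩ := fun A =>
    { obj := t
      map := fun {x y} φ => v A x y φ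
      map_id := v_id A
      map_comp := v_comp A _ _ _ }
  let N : ∀ {A A' : J} (f : A ⟶ A'), F.map f.op.toLoc ≫ (T A).toCatHom ⟶
      (T A').toCatHom ≫ G.map f.op.toLoc := fun {A A'} f => NatTrans.toCatHom₂
    { app := fun x => n A A' f x
      naturality := fun x y φ => n_nat A A' f x y φ }
  refine ⟨{ app := fun a => (T a.as.unop).toCatHom
            naturality := fun {a b} f => N f.as.unop
            naturality_naturality := fun {a b f g} η => discrete_naturality' (F := F) (G := G)
              (fun a => (T a.as.unop).toCatHom) (fun {a b} f => N f.as.unop) η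
            naturality_id := fun a => cat_hom₂_ext fun x => ?_
            naturality_comp := fun {a b c} f g => cat_hom₂_ext fun x => ?_ },
    fun A x => rfl, fun {A A' x y} f => heq_of_eq ?_⟩
  · refine Eq.trans ?_ ((Category.id_comp _).trans (Category.id_comp _)).symm
    -- In the oplax axioms it is the constraint of `F`, carried along by `T`, that is moved across;
    -- in the lax case it was the constraint of `G`.
    exact ((T a.as.unop).mapIso (catIsoApp (F.mapId a) x)).inv_comp_eq.2 (n_id a.as.unop x)
  · refine Eq.trans ?_ (id_comp_cancel _ _ _).symm
    exact ((T c.as.unop).mapIso (catIsoApp (F.mapComp f g) x)).inv_comp_eq.2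
      -- The order is reversed because `f` and `g` are arrows of the opposite category.
      (n_comp c.as.unop b.as.unop a.as.unop g.as.unop f.as.unop x)
  · have h := congrArg m (vert_lift f.base f.fiber)
    rw [m_comp, hn, hv] at h
    exact (vert_homMk _ _ _).symm.trans h

lemma exists_eq_mk (z : Pseudofunctor.CoGrothendieck G) {A : J} (h : z.base = A) :
    ∃ y : G.obj ⟨op A⟩, z = ⟨A, y⟩ := by
  subst h; exact ⟨z.fiber, rfl⟩

lemma grothendieckMap_surjective
    (H : Pseudofunctor.CoGrothendieck F ⥤ Pseudofunctor.CoGrothendieck G)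
    (w : H ⋙ Pseudofunctor.CoGrothendieck.forget G = Pseudofunctor.CoGrothendieck.forget F) :
    ∃ σ : Lax.OplaxTrans F.toLax G.toLax, grothendieckMap σ = H := by
  have hw : ∀ (A : J) (x : F.obj ⟨op A⟩), (H.obj ⟨A, x⟩).base = A := fun A x =>
    Functor.congr_obj w ⟨A, x⟩
  choose t ht using fun (A : J) (x : F.obj ⟨op A⟩) => exists_eq_mk (H.obj ⟨A, x⟩) (hw A x)
  obtain ⟨σ, hσ, hσ'⟩ := exists_oplaxTrans_of_map (F := F) (G := G) (fun {A} x => t A x)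
    (fun {A A' x y} f => eqToHom (ht A x).symm ≫ H.map f ≫ eqToHom (ht A' y)) (by simp) (by simp)
    (fun {A A' x y} f => by
      have h₁ := Functor.congr_hom w f
      have e : ∀ {z z' y y' : Pseudofunctor.CoGrothendieck G} (p : z = z') (k : z' ⟶ y)
          (q : y = y'), HEq (eqToHom p ≫ k ≫ eqToHom q).base k.base := by
        rintro _ _ _ _ rfl k rfl; simp
      exact eq_of_heq ((e _ _ _).trans ((heq_of_eq h₁).trans (conj_heq _ _ _))))
  refine ⟨σ, Functor.hext (fun a => (congrArg (Pseudofunctor.CoGrothendieck.mk a.base)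
    (hσ a.base a.fiber)).trans (ht _ _).symm) fun a b f => (hσ' f).trans ?_⟩
  exact conj_heq _ _ _

lemma isHomLift_base {X Y : Pseudofunctor.CoGrothendieck F} {f : X.base ⟶ Y.base} {k : X ⟶ Y}
    (h : (Pseudofunctor.CoGrothendieck.forget F).IsHomLift f k) : k.base = f :=
  (@IsHomLift.eq_of_isHomLift _ _ _ _ (Pseudofunctor.CoGrothendieck.forget F) _ _ f k h).symm

lemma exists_modification {σ τ : Lax.OplaxTrans F.toLax G.toLax}
    (α : grothendieckMap σ ⟶ grothendieckMap τ) (hα : ∀ a, (α.app a).base = 𝟙 a.base) :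
    ∃ Ξ : Lax.OplaxTrans.Modification σ τ, mapModification Ξ = α := by
  choose c hc using fun (A : J) (x : F.obj ⟨op A⟩) => exists_vert (α.app ⟨A, x⟩) (hα ⟨A, x⟩)
  have c_nat : ∀ (A : J) (x y : F.obj ⟨op A⟩) (φ : x ⟶ y), (σ.app ⟨op A⟩).toFunctor.map φ ≫
      c A y = c A x ≫ (τ.app ⟨op A⟩).toFunctor.map φ := fun A x y φ => vert_injective <| by
    exact (vert_vert _ _).symm.trans ((congrArg₂ (· ≫ ·) (map_vert σ φ) (hc A y)).symm.trans
      ((α.naturality (vert φ)).trans ((congrArg₂ (· ≫ ·) (hc A x) (map_vert τ φ)).trans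
        (vert_vert _ _))))
  have c_lift : ∀ (A A' : J) (f : A ⟶ A') (x : F.obj ⟨op A'⟩),
      c A _ ≫ (τ.naturality f.op.toLoc).toNatTrans.app x =
        (σ.naturality f.op.toLoc).toNatTrans.app x ≫
          (G.map f.op.toLoc).toFunctor.map (c A' x) := fun A A' f x => homMk_injective <|
    (vert_homMk _ _ _).symm.trans <| Eq.trans
      ((congrArg₂ (· ≫ ·) (hc A _) (map_lift f τ x)).symm.trans
        ((α.naturality (lift f x)).symm.trans (congrArg₂ (· ≫ ·) (map_lift f σ x) (hc A' _))))
      (homMk_vert _ _ _)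
  refine ⟨⟨fun a => NatTrans.toCatHom₂ ⟨fun x => c a.as.unop x,
    fun x y φ => c_nat a.as.unop x y φ⟩,
    fun {a b} f => cat_hom₂_ext fun x => (c_lift b.as.unop a.as.unop f.as.unop x)⟩, ?_⟩
  exact NatTrans.ext (funext fun a => (hc a.base a.fiber).symm)

end CoG

section

variable (B : Type u) [Category.{v} B]

open StrictPseudofunctor

-- A functor over the base corresponds to its action on fibres together with its values on cartesian
-- lifts, which form an oplax transformation.
attribute [local instance] oplaxBicategory in
lemma grothendieck_fullyFaithful₂ : (grothendieck B).FullyFaithful₂ where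
  map_bijective Φ Ψ := by
    refine ⟨fun σ τ h => InducedBicategory.hom_ext (CoG.grothendieckMap_injective
      (congrArg (fun M => BasedFunctor.toFunctor (InducedBicategory.Hom.hom M)) h)), fun M => ?_⟩
    obtain ⟨σ, hσ⟩ := CoG.grothendieckMap_surjective M.hom.toFunctor M.hom.w
    exact ⟨InducedBicategory.mkHom σ, bifib_hom_ext hσ⟩
  map₂_bijective {Φ Ψ} σ τ := by
    refine ⟨fun Ξ Θ h => ?_, fun α => ?_⟩
    · refine InducedBicategory.hom₂_ext (Lax.OplaxTrans.homCategory.ext fun a =>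
        cat_hom₂_ext fun x => CoG.vert_injective (A := a.as.unop) ?_)
      exact congrArg (fun α : (grothendieck B).map σ ⟶ (grothendieck B).map τ =>
        (BasedNatTrans.toNatTrans α.hom).app ⟨a.as.unop, x⟩) h
    · obtain ⟨Ξ, hΞ⟩ := CoG.exists_modification (BasedNatTrans.toNatTrans α.hom)
        fun a => CoG.isHomLift_base (α.hom.isHomLift' a)
      exact ⟨InducedBicategory.Hom₂.mk ⟨Ξ⟩, bifib_hom₂_ext fun x => NatTrans.congr_app hΞ x⟩

end

/-! ### Comparison of the two Grothendieck constructions of a bi-indexed category -/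

namespace BIIND

variable {B : Type u} [Category.{v} B] (Ω : BIIND B)

/-- The adjunction over an arrow of the base. -/
abbrev adjHom {A A' : B} (f : A ⟶ A') : AdjHom (Ω.obj ⟨A⟩) (Ω.obj ⟨A'⟩) :=
  Ω.hMap (A := HB.mk A) (B := HB.mk A') f

/-- The transposition of morphisms over an arrow of the base. -/
abbrev transpose {A A' : B} (f : A ⟶ A') (x : Ω.obj ⟨A⟩) (y : Ω.obj ⟨A'⟩) :
    ((Ω.adjHom f).L.obj x ⟶ y) ≃ (x ⟶ (Ω.adjHom f).R.obj y) :=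
  (Ω.adjHom f).adj.homEquiv x y

/-- The mate condition on `δ`. With `m` an identity it says that transposition preserves identities;
the general case says that it preserves vertical morphisms. -/
lemma transpose_id {A : B} {x y : Ω.obj ⟨A⟩} (m : x ⟶ y) :
    Ω.transpose (𝟙 A) x y ((MatePair.ξ (Ω.δ ⟨A⟩)).app x ≫ m) =
      m ≫ (MatePair.ζ (Ω.δ ⟨A⟩)).app y :=
  (MatePair.mates (Ω.δ ⟨A⟩) x y m).trans (congrArg (· ≫ _) (Category.id_comp m))

/-- The mate condition on `γ`, combined with the naturality of the two hom-set bijections, says that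
transposition preserves composition. -/
lemma transpose_comp {A A' A'' : B} (f : A ⟶ A') (g : A' ⟶ A'') {x : Ω.obj ⟨A⟩} {y : Ω.obj ⟨A'⟩}
    {z : Ω.obj ⟨A''⟩} (m : (Ω.adjHom f).L.obj x ⟶ y) (n : (Ω.adjHom g).L.obj y ⟶ z) :
    Ω.transpose (f ≫ g) x z ((MatePair.ξ (Ω.γ (A := HB.mk A) (B := HB.mk A') (C := HB.mk A'')
        f g)).app x ≫ (Ω.adjHom g).L.map m ≫ n) =
      Ω.transpose f x y m ≫ (Ω.adjHom f).R.map (Ω.transpose g y z n) ≫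
        (MatePair.ζ (Ω.γ (A := HB.mk A) (B := HB.mk A') (C := HB.mk A'') f g)).app z := by
  refine (MatePair.mates (Ω.γ (A := HB.mk A) (B := HB.mk A') (C := HB.mk A'') f g) x z _).trans ?_
  refine Eq.trans (congrArg (· ≫ _) ?_) (Category.assoc _ _ _)
  refine (AdjHom.comp_homEquiv (Ω.adjHom f) (Ω.adjHom g) x z _).trans ?_
  exact (congrArg (Ω.transpose f _ _) ((Ω.adjHom g).adj.homEquiv_naturality_left m n)).trans
    ((Ω.adjHom f).adj.homEquiv_naturality_right m _)

variable {Ω}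
variable {Ω' : BIIND B}

/-- This is what makes the comparison strictly natural with respect to transformations of bi-indexed
categories. -/
lemma transpose_trans (τ : VertTrans Ω Ω') {A A' : B} (f : A ⟶ A') {x : Ω.obj ⟨A⟩}
    {y : Ω.obj ⟨A'⟩} (m : (Ω.adjHom f).L.obj x ⟶ y) :
    Ω'.transpose f _ _ ((MatePair.ξ (τ.cell (A := HB.mk A) (B := HB.mk A') f)).app x ≫
        CategoryTheory.Functor.map (τ.app ⟨A'⟩) m) =
      CategoryTheory.Functor.map (τ.app ⟨A⟩) (Ω.transpose f x y m) ≫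
        (MatePair.ζ (τ.cell (A := HB.mk A) (B := HB.mk A') f)).app y :=
  MatePair.mates (τ.cell (A := HB.mk A) (B := HB.mk A') f) x y m

variable (Ω)

/-- The functor from the Grothendieck op-construction to the Grothendieck construction that
transposes morphisms. -/
noncomputable def toCoGrothendieck :
    Pseudofunctor.Grothendieck (leftPart Ω) ⥤ Pseudofunctor.CoGrothendieck (rightPart Ω) where
  obj a := ⟨a.base, a.fiber⟩
  map {a b} f := ⟨f.base, Ω.transpose f.base a.fiber b.fiber f.fiber⟩
  map_id a := congrArg (Pseudofunctor.CoGrothendieck.Hom.mk _)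
    ((congrArg (Ω.transpose _ _ _) (Category.comp_id _).symm).trans
      ((Ω.transpose_id (𝟙 a.fiber)).trans (Category.id_comp _)))
  map_comp f g := congrArg (Pseudofunctor.CoGrothendieck.Hom.mk _)
    (Ω.transpose_comp f.base g.base f.fiber g.fiber)

lemma toCoGrothendieck_map_injective {a b : Pseudofunctor.Grothendieck (leftPart Ω)} {f g : a ⟶ b}
    (h : Ω.toCoGrothendieck.map f = Ω.toCoGrothendieck.map g) : f = g := by
  obtain ⟨f, m⟩ := f
  obtain ⟨g, n⟩ := g
  have h' := (Pseudofunctor.CoGrothendieck.Hom.mk.injEq _ _ _ _).mp h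
  obtain rfl : f = g := h'.1
  exact congrArg (Pseudofunctor.Grothendieck.Hom.mk _)
    ((Ω.transpose f a.fiber b.fiber).injective (eq_of_heq h'.2))

/-- The inverse of `toCoGrothendieck`. -/
noncomputable def ofCoGrothendieck :
    Pseudofunctor.CoGrothendieck (rightPart Ω) ⥤ Pseudofunctor.Grothendieck (leftPart Ω) where
  obj a := ⟨a.base, a.fiber⟩
  map {a b} f := ⟨f.base, (Ω.transpose f.base a.fiber b.fiber).symm f.fiber⟩
  -- Transposition is injective on morphisms, so the functor laws of the inverse follow from those
  -- of `toCoGrothendieck`.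
  map_id a := Ω.toCoGrothendieck_map_injective <|
    (congrArg (Pseudofunctor.CoGrothendieck.Hom.mk _) (Equiv.apply_symm_apply _ _)).trans
      (Ω.toCoGrothendieck.map_id ⟨a.base, a.fiber⟩).symm
  map_comp {a b c} f g := Ω.toCoGrothendieck_map_injective <|
    (congrArg (Pseudofunctor.CoGrothendieck.Hom.mk _) (Equiv.apply_symm_apply _ _)).trans <|
      Eq.symm <| (Ω.toCoGrothendieck.map_comp _ _).trans <| congrArg₂ (· ≫ ·)
        (congrArg (Pseudofunctor.CoGrothendieck.Hom.mk f.base) (Equiv.apply_symm_apply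
          (Ω.transpose f.base a.fiber b.fiber) _))
        (congrArg (Pseudofunctor.CoGrothendieck.Hom.mk g.base) (Equiv.apply_symm_apply
          (Ω.transpose g.base b.fiber c.fiber) _))

lemma toCoGrothendieck_comp_ofCoGrothendieck :
    Ω.toCoGrothendieck ⋙ Ω.ofCoGrothendieck = 𝟭 _ :=
  Functor.hext (fun _ => rfl) fun a b f => heq_of_eq <|
    congrArg (Pseudofunctor.Grothendieck.Hom.mk _)
      ((Ω.transpose f.base a.fiber b.fiber).symm_apply_apply _)

lemma ofCoGrothendieck_comp_toCoGrothendieck :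
    Ω.ofCoGrothendieck ⋙ Ω.toCoGrothendieck = 𝟭 _ :=
  Functor.hext (fun _ => rfl) fun a b f => heq_of_eq <|
    congrArg (Pseudofunctor.CoGrothendieck.Hom.mk _)
      ((Ω.transpose f.base a.fiber b.fiber).apply_symm_apply _)

lemma ofCoGrothendieck_vert {A : B} {x y : Ω.obj ⟨A⟩} (m : x ⟶ y) :
    Ω.ofCoGrothendieck.map (CoG.vert (F := rightPart Ω) m) = OpG.vert (F := leftPart Ω) m :=
  congrArg (Pseudofunctor.Grothendieck.Hom.mk _)
    ((Equiv.symm_apply_eq _).2 (Ω.transpose_id m).symm)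

variable {Ω}

lemma grothendieckMap_comp_ofCoGrothendieck (τ : VertTrans Ω Ω') :
    grothendieckMap (rightTrans τ) ⋙ Ω'.ofCoGrothendieck =
      Ω.ofCoGrothendieck ⋙ opGrothendieckMap (leftTrans τ) :=
  Functor.hext (fun _ => rfl) fun a b f => heq_of_eq <|
    congrArg (Pseudofunctor.Grothendieck.Hom.mk _) <| (Equiv.symm_apply_eq _).2 <| Eq.symm <|
      (transpose_trans τ f.base ((Ω.transpose f.base a.fiber b.fiber).symm f.fiber)).trans
        (congrArg (fun k => CategoryTheory.Functor.map (τ.app ⟨a.base⟩) k ≫ _)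
          (Equiv.apply_symm_apply _ _))

/-- Top and bottom are identity adjunctions, whose hom-set bijections are identities, so the mate
condition at `𝟙 x` equates the two parts. Thus both forgetful 2-functors extract the same family of
morphisms from a modification. -/
lemma modification_ξ_eq_ζ {σ τ : VertTrans Ω Ω'} (Ξ : DblModification σ τ) (A : HB B)
    (x : Ω.obj A) : (MatePair.ξ (Ξ.app A)).app x = (MatePair.ζ (Ξ.app A)).app x := by
  have e : ∀ {X : Cat.{v, u}} {x y : X} (n : x ⟶ y), Adjunction.id.homEquiv x y n = n :=
    fun n => Category.id_comp n
  have h := MatePair.mates (Ξ.app A) x x (𝟙 x)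
  refine Eq.trans (Eq.trans ?_ (e _).symm) (h.trans ?_)
  · exact ((congrArg (_ ≫ ·) (CategoryTheory.Functor.map_id _ _)).trans (Category.comp_id _)).symm
  · exact (congrArg (fun k => CategoryTheory.Functor.map (σ.app A) k ≫ _) (e (𝟙 x))).trans
      ((congrArg (· ≫ _) (CategoryTheory.Functor.map_id _ _)).trans (Category.id_comp _))

end BIIND

section

variable (B : Type u) [Category.{v} B]

/-- The Grothendieck construction of the right adjoints is isomorphic to the Grothendieck
op-construction of the left adjoints. -/
noncomputable def grothendieckIso : TwoNatIso ((forgetToRight B).comp (grothendieck B))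
    ((forgetToLeft B).comp (opGrothendieck B)) where
  hom Ω := InducedBicategory.mkHom { toFunctor := BIIND.ofCoGrothendieck Ω, w := rfl }
  inv Ω := InducedBicategory.mkHom { toFunctor := BIIND.toCoGrothendieck Ω, w := rfl }
  hom_inv_id Ω := bifib_hom_ext (BIIND.ofCoGrothendieck_comp_toCoGrothendieck Ω)
  inv_hom_id Ω := bifib_hom_ext (BIIND.toCoGrothendieck_comp_ofCoGrothendieck Ω)
  naturality τ := bifib_hom_ext (BIIND.grothendieckMap_comp_ofCoGrothendieck τ)
  -- The inverse transposition carries the vertical morphism of the right part to that of the left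
  -- part, since these parts coincide.
  naturality₂ {Ω Ω' σ τ} Ξ := bifib_conj _ _ _ _ fun x => heq_of_eq <|
    (BIIND.ofCoGrothendieck_vert Ω' (A := x.base) _).trans
      (congrArg OpG.vert (BIIND.modification_ξ_eq_ζ Ξ ⟨x.base⟩ x.fiber).symm)

end

/-! ### The bi-indexed category of a bifibration -/

section

variable {J : Type u} [Category.{v} J] {X : Type u} [Category.{v} X] {p : X ⥤ J}

lemma isHomLift_unop {R S : Jᵒᵖ} {a b : Xᵒᵖ} {f : R ⟶ S} {φ : a ⟶ b} (h : p.op.IsHomLift f φ) :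
    p.IsHomLift f.unop φ.unop := by
  obtain ⟨⟩ := h
  exact IsHomLift.map p φ.unop

lemma isHomLift_op {R S : J} {a b : X} {f : R ⟶ S} {φ : a ⟶ b} (h : p.IsHomLift f φ) :
    p.op.IsHomLift f.op φ.op := by
  obtain ⟨⟩ := h
  exact IsHomLift.map p.op φ.op

/-- The object of the total category underlying an object of a fibre. -/
def fiberObj {A : J} (x : p.Fiber A) : X := Subtype.val x

/-- The morphism of the total category underlying a morphism of a fibre. -/
def fiberVal {A : J} {x y : p.Fiber A} (m : x ⟶ y) : fiberObj x ⟶ fiberObj y := Subtype.val m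

section

variable {A : J} {x y z : p.Fiber A}

lemma fiberVal_isHomLift (m : x ⟶ y) : p.IsHomLift (𝟙 A) (fiberVal m) := Subtype.property m

lemma fiberVal_id : fiberVal (𝟙 x) = 𝟙 (fiberObj x) := rfl

lemma fiberVal_comp (m : x ⟶ y) (n : y ⟶ z) : fiberVal (m ≫ n) = fiberVal m ≫ fiberVal n := rfl

lemma fiberVal_injective {m n : x ⟶ y} (h : fiberVal m = fiberVal n) : m = n := Subtype.ext h

lemma isHomLift_comp_fiberVal {A' : J} {w : p.Fiber A'} {f : A' ⟶ A} {φ : fiberObj w ⟶ fiberObj x}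
    (h : p.IsHomLift f φ) (m : x ⟶ y) : p.IsHomLift f (φ ≫ fiberVal m) := by
  have := fiberVal_isHomLift m
  infer_instance

lemma isHomLift_fiberVal_comp {A' : J} {w : p.Fiber A'} {f : A ⟶ A'} {φ : fiberObj y ⟶ fiberObj w}
    (h : p.IsHomLift f φ) (m : x ⟶ y) : p.IsHomLift f (fiberVal m ≫ φ) := by
  have := fiberVal_isHomLift m
  infer_instance

end

variable (p)

/-- A choice of opcartesian lifts. -/
structure OpCleavage where
  obj : ∀ {A A' : J} (f : A ⟶ A'), p.Fiber A → p.Fiber A'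
  lift : ∀ {A A' : J} (f : A ⟶ A') (x : p.Fiber A), fiberObj x ⟶ fiberObj (obj f x)
  isHomLift : ∀ {A A' : J} (f : A ⟶ A') (x : p.Fiber A), p.IsHomLift f (lift f x)
  existsUnique : ∀ {A A' A'' : J} (f : A ⟶ A') (g : A' ⟶ A'') {x : p.Fiber A} {y : p.Fiber A''}
    (ψ : fiberObj x ⟶ fiberObj y), p.IsHomLift (f ≫ g) ψ →
      ∃! χ : fiberObj (obj f x) ⟶ fiberObj y, p.IsHomLift g χ ∧ lift f x ≫ χ = ψ

/-- A choice of cartesian lifts. -/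
structure Cleavage where
  obj : ∀ {A A' : J} (f : A ⟶ A'), p.Fiber A' → p.Fiber A
  lift : ∀ {A A' : J} (f : A ⟶ A') (y : p.Fiber A'), fiberObj (obj f y) ⟶ fiberObj y
  isHomLift : ∀ {A A' : J} (f : A ⟶ A') (y : p.Fiber A'), p.IsHomLift f (lift f y)
  existsUnique : ∀ {A A' : J} (f : A ⟶ A') {x : p.Fiber A} {y : p.Fiber A'}
    (ψ : fiberObj x ⟶ fiberObj y), p.IsHomLift f ψ → ∃! χ : x ⟶ obj f y, fiberVal χ ≫ lift f y = ψ

variable {p}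

/-- For cartesian lifts it is enough to factor morphisms over `f` itself. The coherence of inverse
images is obtained later as the mate of the coherence of direct images. -/
lemma Cleavage.nonempty (h : p.IsFibered) : Nonempty (Cleavage p) := by
  choose b φ hφ using fun {A A' : J} (f : A ⟶ A') (y : p.Fiber A') =>
    CategoryTheory.IsPreFibered.exists_isCartesian p (a := fiberObj y) y.2 f
  have h₁ : ∀ {A A' : J} (f : A ⟶ A') (y : p.Fiber A'), p.IsHomLift f (φ f y) := fun f y =>
    (hφ f y).toIsHomLift
  refine ⟨⟨fun f y => ⟨b f y, @IsHomLift.domain_eq _ _ _ _ p _ _ _ _ f (φ f y) (h₁ f y)⟩,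
    fun f y => φ f y, h₁, fun {A A'} f {x y} ψ hψ => ?_⟩⟩
  have := hφ f y
  obtain ⟨χ, ⟨h₂, h₃⟩, h₄⟩ := Functor.IsCartesian.universal_property (p := p) (f := f)
    (φ := φ f y) ψ
  exact ⟨⟨χ, h₂⟩, h₃, fun χ' h' => Subtype.ext (h₄ _ ⟨χ'.2, h'⟩)⟩

lemma OpCleavage.nonempty (h : p.op.IsFibered) : Nonempty (OpCleavage p) := by
  choose b φ hφ using fun {A A' : J} (f : A ⟶ A') (y : p.Fiber A) =>
    CategoryTheory.IsPreFibered.exists_isCartesian p.op (a := op (fiberObj y))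
      (congrArg op y.2) f.op
  have h₀ : ∀ {A A' : J} (f : A ⟶ A') (y : p.Fiber A), p.op.IsHomLift f.op (φ f y) := fun f y =>
    (hφ f y).toIsHomLift
  have h₁ : ∀ {A A' : J} (f : A ⟶ A') (y : p.Fiber A), p.IsHomLift f (φ f y).unop := fun f y =>
    isHomLift_unop (h₀ f y)
  refine ⟨⟨fun f y => ⟨(b f y).unop,
    @IsHomLift.codomain_eq _ _ _ _ p _ _ _ _ f (φ f y).unop (h₁ f y)⟩,
    fun f y => (φ f y).unop, h₁, fun {A A' A''} f g {x y} ψ hψ => ?_⟩⟩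
  have := hφ f x
  have h' : p.op.IsHomLift (f ≫ g).op ψ.op := isHomLift_op hψ
  -- In a fibration cartesian arrows are strongly cartesian. The factorization over an arbitrary
  -- second arrow `g` is what makes composites of opcartesian lifts opcartesian.
  obtain ⟨χ, ⟨h₂, h₃⟩, h₄⟩ := Functor.IsStronglyCartesian.universal_property p.op f.op (φ f x) g.op
    (f ≫ g).op rfl ψ.op
  exact ⟨χ.unop, ⟨isHomLift_unop h₂, congrArg Quiver.Hom.unop h₃⟩, fun χ' h' =>
    congrArg Quiver.Hom.unop (h₄ χ'.op ⟨isHomLift_op h'.1, congrArg Quiver.Hom.op h'.2⟩)⟩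

/-! ### Direct images and their coherence isomorphisms. -/

namespace OpCleavage

variable (D : OpCleavage p) {A A' A'' : J}

section

variable (f : A ⟶ A') (g : A' ⟶ A'') {x : p.Fiber A}

lemma ext_of_lift {y : p.Fiber A''} {χ χ' : fiberObj (D.obj f x) ⟶ fiberObj y} (h : p.IsHomLift g χ)
    (h' : p.IsHomLift g χ') (e : D.lift f x ≫ χ = D.lift f x ≫ χ') : χ = χ' := by
  have := D.isHomLift f x
  exact (D.existsUnique f g (D.lift f x ≫ χ') inferInstance).unique ⟨h, e⟩ ⟨h', rfl⟩

lemma fiber_ext {y : p.Fiber A'} {m n : D.obj f x ⟶ y}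
    (e : D.lift f x ≫ fiberVal m = D.lift f x ≫ fiberVal n) : m = n :=
  fiberVal_injective (D.ext_of_lift f (𝟙 A') (fiberVal_isHomLift m) (fiberVal_isHomLift n) e)

lemma exists_desc {y : p.Fiber A'} (ψ : fiberObj x ⟶ fiberObj y) (h : p.IsHomLift f ψ) :
    ∃ m : D.obj f x ⟶ y, D.lift f x ≫ fiberVal m = ψ := by
  obtain ⟨χ, ⟨h₁, h₂⟩, -⟩ := D.existsUnique f (𝟙 A') ψ inferInstance
  exact ⟨⟨χ, h₁⟩, h₂⟩

/-- The factorization of a morphism over `f` through the opcartesian lift. -/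
noncomputable def desc {y : p.Fiber A'} (ψ : fiberObj x ⟶ fiberObj y) (h : p.IsHomLift f ψ) :
    D.obj f x ⟶ y :=
  (D.exists_desc f ψ h).choose

lemma lift_desc {y : p.Fiber A'} (ψ : fiberObj x ⟶ fiberObj y) (h : p.IsHomLift f ψ) :
    D.lift f x ≫ fiberVal (D.desc f ψ h) = ψ :=
  (D.exists_desc f ψ h).choose_spec

lemma lift_desc_assoc {y : p.Fiber A'} (ψ : fiberObj x ⟶ fiberObj y) (h : p.IsHomLift f ψ) {z : X}
    (k : fiberObj y ⟶ z) : D.lift f x ≫ fiberVal (D.desc f ψ h) ≫ k = ψ ≫ k := by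
  rw [← Category.assoc, lift_desc]

end

/-- The direct image functor. -/
noncomputable def push (f : A ⟶ A') : p.Fiber A ⥤ p.Fiber A' where
  obj := D.obj f
  map {x y} m := D.desc f (fiberVal m ≫ D.lift f y) (isHomLift_fiberVal_comp (D.isHomLift f y) m)
  map_id x := D.fiber_ext f (by rw [lift_desc, fiberVal_id, fiberVal_id]; simp)
  map_comp {x y z} m n := D.fiber_ext f (by
    rw [lift_desc, fiberVal_comp, fiberVal_comp, lift_desc_assoc, Category.assoc, Category.assoc,
      lift_desc])

lemma lift_map (f : A ⟶ A') {x y : p.Fiber A} (m : x ⟶ y) :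
    D.lift f x ≫ fiberVal ((D.push f).map m) = fiberVal m ≫ D.lift f y :=
  D.lift_desc f _ (isHomLift_fiberVal_comp (D.isHomLift f y) m)

/-- The comparison of the direct image under an identity with the identity. -/
noncomputable def unitHom (x : p.Fiber A) : D.obj (𝟙 A) x ⟶ x :=
  D.desc (𝟙 A) (𝟙 (fiberObj x)) (fiberVal_isHomLift (𝟙 x))

lemma lift_unitHom (x : p.Fiber A) : D.lift (𝟙 A) x ≫ fiberVal (D.unitHom x) = 𝟙 (fiberObj x) :=
  D.lift_desc _ _ _

/-- The inverse is the opcartesian lift of `𝟙 A`, which is itself a morphism of the fibre. -/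
lemma isIso_unitHom (x : p.Fiber A) : IsIso (D.unitHom x) := by
  let l : x ⟶ D.obj (𝟙 A) x := ⟨D.lift (𝟙 A) x, D.isHomLift (𝟙 A) x⟩
  have h : l ≫ D.unitHom x = 𝟙 x := fiberVal_injective (D.lift_unitHom x)
  refine ⟨l, D.fiber_ext _ ?_, h⟩
  refine Eq.trans ?_ (Category.comp_id _).symm
  exact (Category.assoc _ _ _).symm.trans ((congrArg (· ≫ D.lift (𝟙 A) x) (D.lift_unitHom x)).trans
    (Category.id_comp _))

/-- The comparison of the direct image under a composite with the composite of direct images. -/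
noncomputable def compHom (f : A ⟶ A') (g : A' ⟶ A'') (x : p.Fiber A) :
    D.obj (f ≫ g) x ⟶ D.obj g (D.obj f x) :=
  D.desc (f ≫ g) (D.lift f x ≫ D.lift g (D.obj f x)) (by
    have := D.isHomLift f x
    have := D.isHomLift g (D.obj f x)
    infer_instance)

lemma lift_compHom (f : A ⟶ A') (g : A' ⟶ A'') (x : p.Fiber A) :
    D.lift (f ≫ g) x ≫ fiberVal (D.compHom f g x) = D.lift f x ≫ D.lift g (D.obj f x) :=
  D.lift_desc _ _ _

/-- The composite of two opcartesian lifts has the universal property of the lift of `f ≫ g`: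
factoring the latter through `D.lift f x` and then through the lift of `g` gives the inverse. -/
lemma isIso_compHom (f : A ⟶ A') (g : A' ⟶ A'') (x : p.Fiber A) : IsIso (D.compHom f g x) := by
  obtain ⟨χ, ⟨h₁, h₂⟩, -⟩ := D.existsUnique f g (D.lift (f ≫ g) x) (D.isHomLift (f ≫ g) x)
  have h₃ : D.compHom f g x ≫ D.desc g χ h₁ = 𝟙 _ := D.fiber_ext _ (by
    rw [fiberVal_comp, ← Category.assoc, lift_compHom, Category.assoc, lift_desc, h₂, fiberVal_id,
      Category.comp_id])
  refine ⟨D.desc g χ h₁, h₃, D.fiber_ext g ?_⟩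
  have := fiberVal_isHomLift (D.compHom f g x)
  have := D.isHomLift g (D.obj f x)
  rw [fiberVal_comp, lift_desc_assoc, fiberVal_id, Category.comp_id]
  refine D.ext_of_lift f g inferInstance inferInstance ?_
  rw [← Category.assoc, h₂, lift_compHom]

end OpCleavage

variable (D : OpCleavage p) (C : Cleavage p) {A A' A'' : J}

/-! ### Inverse images and the adjunction with direct images. -/

namespace Cleavage

variable (f : A ⟶ A')

lemma fiber_ext {x : p.Fiber A} {y : p.Fiber A'} {m n : x ⟶ C.obj f y}
    (e : fiberVal m ≫ C.lift f y = fiberVal n ≫ C.lift f y) : m = n :=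
  (C.existsUnique f _ (isHomLift_fiberVal_comp (C.isHomLift f y) n)).unique e rfl

/-- The factorization of a morphism over `f` through the cartesian lift. -/
noncomputable def desc {x : p.Fiber A} {y : p.Fiber A'} (ψ : fiberObj x ⟶ fiberObj y)
    (h : p.IsHomLift f ψ) :
    x ⟶ C.obj f y :=
  (C.existsUnique f ψ h).choose

lemma desc_lift {x : p.Fiber A} {y : p.Fiber A'} (ψ : fiberObj x ⟶ fiberObj y)
    (h : p.IsHomLift f ψ) :
    fiberVal (C.desc f ψ h) ≫ C.lift f y = ψ :=
  (C.existsUnique f ψ h).choose_spec.1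

/-- The inverse image functor. -/
noncomputable def pull : p.Fiber A' ⥤ p.Fiber A where
  obj := C.obj f
  map {x y} m := C.desc f (C.lift f x ≫ fiberVal m) (isHomLift_comp_fiberVal (C.isHomLift f x) m)
  map_id x := C.fiber_ext f (by rw [desc_lift, fiberVal_id, fiberVal_id]; simp)
  map_comp {x y z} m n := C.fiber_ext f (by
    rw [desc_lift, fiberVal_comp, fiberVal_comp, Category.assoc, desc_lift, ← Category.assoc,
      ← Category.assoc, desc_lift])

lemma map_lift {x y : p.Fiber A'} (m : x ⟶ y) :
    fiberVal ((C.pull f).map m) ≫ C.lift f y = C.lift f x ≫ fiberVal m :=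
  C.desc_lift f _ (isHomLift_comp_fiberVal (C.isHomLift f x) m)

end Cleavage

/-- The transposition between morphisms out of a direct image and morphisms into an inverse
image. -/
noncomputable def pushPullEquiv (f : A ⟶ A') (x : p.Fiber A) (y : p.Fiber A') :
    (D.obj f x ⟶ y) ≃ (x ⟶ C.obj f y) where
  toFun m := C.desc f (D.lift f x ≫ fiberVal m) (isHomLift_comp_fiberVal (D.isHomLift f x) m)
  invFun m := D.desc f (fiberVal m ≫ C.lift f y) (isHomLift_fiberVal_comp (C.isHomLift f y) m)
  left_inv m := D.fiber_ext f ((D.lift_desc _ _ _).trans (C.desc_lift _ _ _))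
  right_inv m := C.fiber_ext f ((C.desc_lift _ _ _).trans (D.lift_desc _ _ _))

/-- A morphism and its transpose describe the same morphism over `f` from `x` to `y`. This equation
and its companion below give the naturality of the bijection. -/
lemma pushPullEquiv_lift (f : A ⟶ A') {x : p.Fiber A} {y : p.Fiber A'} (m : D.obj f x ⟶ y) :
    fiberVal (pushPullEquiv D C f x y m) ≫ C.lift f y = D.lift f x ≫ fiberVal m :=
  C.desc_lift f _ (isHomLift_comp_fiberVal (D.isHomLift f x) m)

lemma lift_pushPullEquiv_symm (f : A ⟶ A') {x : p.Fiber A} {y : p.Fiber A'} (m : x ⟶ C.obj f y) :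
    D.lift f x ≫ fiberVal ((pushPullEquiv D C f x y).symm m) = fiberVal m ≫ C.lift f y :=
  D.lift_desc f _ (isHomLift_fiberVal_comp (C.isHomLift f y) m)

/-- The direct image functor is left adjoint to the inverse image functor. -/
noncomputable def pushAdjPull (f : A ⟶ A') : D.push f ⊣ C.pull f :=
  Adjunction.mkOfHomEquiv
    { homEquiv := fun x y => pushPullEquiv D C f x y
      homEquiv_naturality_left_symm := fun {x x' y} m n => D.fiber_ext f (by
        refine (lift_pushPullEquiv_symm D C f _).trans (Eq.symm ?_)
        refine (Category.assoc _ _ _).symm.trans ((congrArg (· ≫ _) (D.lift_map f m)).trans ?_)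
        exact (Category.assoc _ _ _).trans ((congrArg (fiberVal m ≫ ·)
          (lift_pushPullEquiv_symm D C f n)).trans (Category.assoc _ _ _).symm))
      homEquiv_naturality_right := fun {x y y'} m n => C.fiber_ext f (by
        refine (pushPullEquiv_lift D C f _).trans (Eq.symm ?_)
        refine (Category.assoc _ _ _).trans ((congrArg (_ ≫ ·) (C.map_lift f n)).trans ?_)
        exact (Category.assoc _ _ _).symm.trans ((congrArg (· ≫ fiberVal n)
          (pushPullEquiv_lift D C f m)).trans (Category.assoc _ _ _))) }

end

section

/-- A mate pair between vertical identities whose left part is invertible is invertible. -/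
lemma isVertIso_of_isIso_ξ {A C : Cat.{v, u}} {f g : AdjHom A C} (α : MatePair f (𝟭 A) (𝟭 C) g)
    (h : ∀ x, IsIso (α.ξ.app x)) : IsVertIso (E := ADJ) (f := f) (g := g) α := by
  have : IsIso α.ξ := NatIso.isIso_of_isIso_app _
  refine ⟨MatePair.ofξ (f := g) (g := f) (h := 𝟭 A) (k := 𝟭 C) (inv α.ξ), ?_, ?_⟩
  -- Vertical composition of cells composes left parts in the reverse order, so the first law is
  -- `inv_hom_id`.
  · exact MatePair.heq_of_ξ rfl rfl rfl rfl fun a =>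
      heq_of_eq (NatTrans.congr_app (IsIso.inv_hom_id α.ξ) a)
  · exact MatePair.heq_of_ξ rfl rfl rfl rfl fun a =>
      heq_of_eq (NatTrans.congr_app (IsIso.hom_inv_id α.ξ) a)

end

/-! ### Coherence of the bi-indexed category of fibres. -/

section

variable {J : Type u} [Category.{v} J] {X : Type u} [Category.{v} X] {p : X ⥤ J}
  (D : OpCleavage p) (C : Cleavage p)

namespace OpCleavage

/-- The coherence laws compare direct images along arrows such as `𝟙 A ≫ f` and `f`. Precomposition
with the lifts moves the comparison into the total category, where no transport is needed. -/
lemma heq_of_lift {A A' : J} {f f' : A ⟶ A'} (hf : f = f') {x : p.Fiber A} {y : p.Fiber A'}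
    {m : D.obj f x ⟶ y} {m' : D.obj f' x ⟶ y}
    (h : D.lift f x ≫ fiberVal m = D.lift f' x ≫ fiberVal m') : HEq m m' := by
  subst hf
  exact heq_of_eq (D.fiber_ext f h)

lemma unitHom_naturality {A : J} {x y : p.Fiber A} (m : x ⟶ y) :
    (D.push (𝟙 A)).map m ≫ D.unitHom y = D.unitHom x ≫ m := D.fiber_ext _ (by
  refine (Category.assoc _ _ _).symm.trans ((congrArg (· ≫ _) (D.lift_map _ m)).trans ?_)
  refine Eq.trans ?_ (Category.assoc _ _ _)
  refine ((Category.assoc _ _ _).trans (congrArg (fiberVal m ≫ ·) (D.lift_unitHom y))).trans ?_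
  exact (Category.comp_id _).trans ((Category.id_comp _).symm.trans
    (congrArg (· ≫ fiberVal m) (D.lift_unitHom x).symm)))

lemma compHom_naturality {A A' A'' : J} (f : A ⟶ A') (g : A' ⟶ A'') {x y : p.Fiber A}
    (m : x ⟶ y) : (D.push (f ≫ g)).map m ≫ D.compHom f g y =
      D.compHom f g x ≫ (D.push g).map ((D.push f).map m) := D.fiber_ext _ (by
  refine (Category.assoc _ _ _).symm.trans ((congrArg (· ≫ _) (D.lift_map _ m)).trans ?_)
  refine Eq.trans ?_ (Category.assoc _ _ _)
  refine ((Category.assoc _ _ _).trans (congrArg (fiberVal m ≫ ·) (D.lift_compHom f g y))).trans ?_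
  refine Eq.trans ?_ (congrArg (· ≫ _) (D.lift_compHom f g x).symm)
  refine Eq.trans ?_ (Category.assoc _ _ _).symm
  refine Eq.trans ?_ (congrArg (D.lift f x ≫ ·) (D.lift_map g ((D.push f).map m)).symm)
  refine (Category.assoc _ _ _).symm.trans ?_
  exact (congrArg (· ≫ _) (D.lift_map f m).symm).trans (Category.assoc _ _ _))

end OpCleavage

/-- The adjunction between the fibres over an arrow. -/
noncomputable def cleavageAdj {A A' : J} (f : A ⟶ A') :
    AdjHom (Cat.of (p.Fiber A)) (Cat.of (p.Fiber A')) :=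
  ⟨D.push f, C.pull f, pushAdjPull D C f⟩

/-- The unit cell of the bi-indexed category of a bifibration. -/
noncomputable def cleavageUnit (A : J) :
    MatePair (AdjHom.id (Cat.of (p.Fiber A))) (𝟭 _) (𝟭 _) (cleavageAdj D C (𝟙 A)) :=
  MatePair.ofξ (f := AdjHom.id (Cat.of (p.Fiber A))) (g := cleavageAdj D C (𝟙 A)) (h := 𝟭 _)
    (k := 𝟭 _) { app := fun x => D.unitHom x, naturality := fun _ _ m => D.unitHom_naturality m }

/-- The composition cells of the bi-indexed category of a bifibration. -/
noncomputable def cleavageComp {A A' A'' : J} (f : A ⟶ A') (g : A' ⟶ A'') :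
    MatePair ((cleavageAdj D C f).comp (cleavageAdj D C g)) (𝟭 _) (𝟭 _)
      (cleavageAdj D C (f ≫ g)) :=
  MatePair.ofξ (f := (cleavageAdj D C f).comp (cleavageAdj D C g)) (g := cleavageAdj D C (f ≫ g))
    (h := 𝟭 _) (k := 𝟭 _)
    { app := fun x => D.compHom f g x, naturality := fun _ _ m => D.compHom_naturality f g m }

/-- The identification of the fibres over equal objects. -/
def fiberTransport {A C : HB J} (h : VHom A C) :
    VHom (D := ADJ) (Cat.of (p.Fiber A.of)) (Cat.of (p.Fiber C.of)) :=
  match C, h with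
  | _, ⟨rfl⟩ => vId (D := ADJ) (Cat.of (p.Fiber A.of))

/-- The identification of the adjunctions over equal arrows. -/
noncomputable def cleavageTransport {A B A' B' : HB J} {f : HHom A B} {h : VHom A A'}
    {k : VHom B B'} {f' : HHom A' B'} (α : Cell f h k f') :
    Cell (D := ADJ) (cleavageAdj D C f) (fiberTransport h) (fiberTransport k)
      (cleavageAdj D C f') :=
  match A', B', h, k, f', α with
  | _, _, ⟨rfl⟩, ⟨rfl⟩, _, ⟨HEq.refl _⟩ => cellVId (D := ADJ) (cleavageAdj D C f)

/-- Precomposed with an opcartesian lift, each coherence morphism collapses to a composite of chosen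
lifts. Here and in `right_unit_lift` the result is `D.lift f x`; for associativity both bracketings
give the same three lifts. -/
lemma left_unit_lift {A B : J} (f : A ⟶ B) (x : p.Fiber A) :
    D.lift (𝟙 A ≫ f) x ≫ fiberVal (D.compHom (𝟙 A) f x ≫ (D.push f).map (D.unitHom x)) =
      D.lift f x := by
  refine (Category.assoc _ _ _).symm.trans ((congrArg (· ≫ _) (D.lift_compHom _ f x)).trans ?_)
  refine (Category.assoc _ _ _).trans ((congrArg (_ ≫ ·) (D.lift_map f _)).trans ?_)
  refine (Category.assoc _ _ _).symm.trans ((congrArg (· ≫ _) (D.lift_unitHom x)).trans ?_)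
  exact Category.id_comp _

lemma right_unit_lift {A B : J} (f : A ⟶ B) (x : p.Fiber A) :
    D.lift (f ≫ 𝟙 B) x ≫ fiberVal (D.compHom f (𝟙 B) x ≫ D.unitHom (D.obj f x)) =
      D.lift f x := by
  refine (Category.assoc _ _ _).symm.trans ((congrArg (· ≫ _) (D.lift_compHom f _ x)).trans ?_)
  refine (Category.assoc _ _ _).trans ((congrArg (_ ≫ ·) (D.lift_unitHom _)).trans ?_)
  exact Category.comp_id _

lemma assoc_lift_left {A B E E' : J} (f : A ⟶ B) (g : B ⟶ E) (e : E ⟶ E') (x : p.Fiber A) :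
    D.lift ((f ≫ g) ≫ e) x ≫
        fiberVal (D.compHom (f ≫ g) e x ≫ (D.push e).map (D.compHom f g x)) =
      D.lift f x ≫ D.lift g _ ≫ D.lift e _ := by
  refine (Category.assoc _ _ _).symm.trans ((congrArg (· ≫ _) (D.lift_compHom _ e x)).trans ?_)
  refine (Category.assoc _ _ _).trans ((congrArg (_ ≫ ·) (D.lift_map e _)).trans ?_)
  refine (Category.assoc _ _ _).symm.trans ((congrArg (· ≫ _) (D.lift_compHom f g x)).trans ?_)
  exact Category.assoc _ _ _

lemma assoc_lift_right {A B E E' : J} (f : A ⟶ B) (g : B ⟶ E) (e : E ⟶ E') (x : p.Fiber A) :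
    D.lift (f ≫ g ≫ e) x ≫
        fiberVal (D.compHom f (g ≫ e) x ≫ D.compHom g e (D.obj f x)) =
      D.lift f x ≫ D.lift g _ ≫ D.lift e _ := by
  refine (Category.assoc _ _ _).symm.trans ((congrArg (· ≫ _) (D.lift_compHom f _ x)).trans ?_)
  exact (Category.assoc _ _ _).trans (congrArg (_ ≫ ·) (D.lift_compHom g e _))

/-- The bi-indexed category of a bifibration with chosen lifts. -/
noncomputable def biindOfCleavage : BIIND J where
  obj A := Cat.of (p.Fiber A.of)
  hMap f := cleavageAdj D C f
  vMap h := fiberTransport h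
  cellMap α := cleavageTransport D C α
  vMap_id A := rfl
  vMap_comp h k := by
    obtain ⟨rfl⟩ := h
    obtain ⟨rfl⟩ := k
    rfl
  cellMap_vId f := HEq.rfl
  cellMap_vComp {A B A' B' A'' B'' f f' f'' h k h' k'} α β := by
    obtain ⟨rfl⟩ := h
    obtain ⟨rfl⟩ := k
    obtain ⟨rfl⟩ := h'
    obtain ⟨rfl⟩ := k'
    obtain ⟨α⟩ := α
    obtain ⟨β⟩ := β
    cases α
    cases β
    exact (CellEq.id_vcomp (D := ADJ) _).symm.heq
  δ A := cleavageUnit D C A.of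
  γ f g := cleavageComp D C f g
  δ_naturality h := by
    obtain ⟨rfl⟩ := h
    exact ((CellEq.vcomp_id (D := ADJ) _).trans (CellEq.id_vcomp (D := ADJ) _).symm).heq
  γ_naturality {A B E A' B' E' f g f' g' h k l} α β := by
    obtain ⟨rfl⟩ := h
    obtain ⟨rfl⟩ := k
    obtain ⟨rfl⟩ := l
    obtain ⟨α⟩ := α
    obtain ⟨β⟩ := β
    cases α
    cases β
    refine HEq.trans (CellEq.vcomp_id (D := ADJ) _).heq ?_
    refine HEq.trans (CellEq.id_vcomp (D := ADJ) _).symm.heq ?_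
    exact heq_of_eq (congrArg (fun t => cellVComp (D := ADJ) t (cleavageComp D C f g))
      (cellVId_hComp (D := ADJ) (cleavageAdj D C f) (cleavageAdj D C g)))
  -- Only left parts are compared, so the laws concern opcartesian lifts; the additional rewriting
  -- removes identities produced by the composition of cells.
  left_unit {A B} f := MatePair.heq_of_ξ (AdjHom.id_comp _) rfl rfl
    (congrArg (cleavageAdj D C) (Category.id_comp f)) fun x => D.heq_of_lift (Category.id_comp f)
      ((congrArg (fun t => D.lift _ x ≫ fiberVal (D.compHom _ f x ≫ t)) (Category.comp_id _)).trans
        ((left_unit_lift D f x).trans (Category.comp_id _).symm))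
  right_unit {A B} f := MatePair.heq_of_ξ (AdjHom.comp_id _) rfl rfl
    (congrArg (cleavageAdj D C) (Category.comp_id f)) fun x => D.heq_of_lift (Category.comp_id f)
      ((congrArg (fun t => D.lift _ x ≫ fiberVal (D.compHom f _ x ≫ t))
        ((congrArg (· ≫ _) ((D.push _).map_id _)).trans (Category.id_comp _))).trans
        ((right_unit_lift D f x).trans (Category.comp_id _).symm))
  assoc {A B E E'} f g e := MatePair.heq_of_ξ (AdjHom.assoc _ _ _) rfl rfl
    (congrArg (cleavageAdj D C) (Category.assoc f g e)) fun x =>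
      D.heq_of_lift (Category.assoc f g e)
      ((congrArg (fun t => D.lift _ x ≫ fiberVal (D.compHom _ e x ≫ t))
        (Category.comp_id _)).trans ((assoc_lift_left D f g e x).trans
        ((assoc_lift_right D f g e x).symm.trans
        (congrArg (fun t => D.lift _ x ≫ fiberVal (D.compHom f _ x ≫ t))
          ((congrArg (· ≫ _) ((D.push _).map_id _)).trans (Category.id_comp _)).symm))))
  δ_iso A := isVertIso_of_isIso_ξ _ fun x => D.isIso_unitHom x
  γ_iso f g := isVertIso_of_isIso_ξ _ fun x => D.isIso_compHom f g x

end

/-! ### Every bifibration is a Grothendieck op-construction -/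

section

variable {J : Type u} [Category.{v} J] {X : Type u} [Category.{v} X] {p : X ⥤ J}
  (D : OpCleavage p) (C : Cleavage p)

/-- The pseudofunctor of fibres and direct images. -/
noncomputable abbrev fiberPseudofunctor : LocallyDiscrete J ⥤ᵖ Cat.{v, u} :=
  leftPart (biindOfCleavage D C)

/-- The component of a morphism of the Grothendieck op-construction, as a morphism of a fibre. -/
def fiberComponent {a b : Pseudofunctor.Grothendieck (fiberPseudofunctor D C)} (f : a ⟶ b) :
    D.obj f.base (a.fiber : p.Fiber a.base) ⟶ (b.fiber : p.Fiber b.base) :=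
  f.fiber

variable {A A' A'' : J}

/-- The left side is the image in the total category of a composite of the op-construction, so this
is the functoriality of `toTotal`. -/
lemma lift_comp_fiberVal (f : A ⟶ A') (g : A' ⟶ A'') {x : p.Fiber A} {y : p.Fiber A'}
    {z : p.Fiber A''} (m : D.obj f x ⟶ y) (n : D.obj g y ⟶ z) :
    D.lift (f ≫ g) x ≫ fiberVal (D.compHom f g x ≫ (D.push g).map m ≫ n : D.obj (f ≫ g) x ⟶ z) =
      (D.lift f x ≫ fiberVal m) ≫ (D.lift g y ≫ fiberVal n) := by
  refine (Category.assoc _ _ _).symm.trans ((congrArg (· ≫ _) (D.lift_compHom f g x)).trans ?_)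
  refine (Category.assoc _ _ _).trans (Eq.trans (congrArg (_ ≫ ·) ?_) (Category.assoc _ _ _).symm)
  refine (Category.assoc _ _ _).symm.trans ((congrArg (· ≫ _) (D.lift_map g m)).trans ?_)
  exact Category.assoc _ _ _

/-- The comparison from the Grothendieck op-construction of the fibres to the total category. -/
noncomputable def toTotal : Pseudofunctor.Grothendieck (fiberPseudofunctor D C) ⥤ X where
  obj a := fiberObj (p := p) (A := a.base) a.fiber
  map {a b} f := D.lift f.base (a.fiber : p.Fiber a.base) ≫ fiberVal (fiberComponent D C f)
  map_id a := D.lift_unitHom (A := a.base) a.fiber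
  map_comp f g := lift_comp_fiberVal D f.base g.base (fiberComponent D C f) (fiberComponent D C g)

lemma toTotal_isHomLift {a b : Pseudofunctor.Grothendieck (fiberPseudofunctor D C)} (f : a ⟶ b) :
    p.IsHomLift f.base ((toTotal D C).map f) :=
  isHomLift_comp_fiberVal (D.isHomLift f.base (a.fiber : p.Fiber a.base)) (fiberComponent D C f)

/-- An object of a fibre determines the base object over which it lies. Hence the comparison is a
strict isomorphism of categories, and later equalities of morphisms need only be checked between
pairs of this form. -/
lemma exists_eq_mk_fiber (a : Pseudofunctor.Grothendieck (fiberPseudofunctor D C)) :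
    ∃ x, a = ⟨p.obj x, (⟨x, rfl⟩ : p.Fiber (p.obj x))⟩ := by
  obtain ⟨A, x, h⟩ := a
  change p.obj x = A at h
  subst h
  exact ⟨x, rfl⟩

lemma toTotal_base {x y : X} {f : (⟨p.obj x, (⟨x, rfl⟩ : p.Fiber (p.obj x))⟩ :
      Pseudofunctor.Grothendieck (fiberPseudofunctor D C)) ⟶
        ⟨p.obj y, (⟨y, rfl⟩ : p.Fiber (p.obj y))⟩} :
    f.base = p.map ((toTotal D C).map f) :=
  @IsHomLift.eq_of_isHomLift _ _ _ _ p x y _ _ (toTotal_isHomLift D C f)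

/-- The base arrow is recovered by applying `p`; the fibre component is then unique by the
opcartesian property. -/
lemma toTotal_map_injective {x y : X} {f g : (⟨p.obj x, (⟨x, rfl⟩ : p.Fiber (p.obj x))⟩ :
      Pseudofunctor.Grothendieck (fiberPseudofunctor D C)) ⟶
        ⟨p.obj y, (⟨y, rfl⟩ : p.Fiber (p.obj y))⟩}
    (h : (toTotal D C).map f = (toTotal D C).map g) : f = g := by
  have hb : f.base = g.base := (toTotal_base D C).trans ((congrArg (fun k => p.map k) h).trans
    (toTotal_base D C).symm)
  obtain ⟨f, m⟩ := f
  obtain ⟨g, n⟩ := g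
  obtain rfl : f = g := hb
  exact congrArg (Pseudofunctor.Grothendieck.Hom.mk _) (D.fiber_ext f h)

/-- The inverse of `toTotal`. -/
noncomputable def ofTotal : X ⥤ Pseudofunctor.Grothendieck (fiberPseudofunctor D C) where
  obj x := ⟨p.obj x, (⟨x, rfl⟩ : p.Fiber (p.obj x))⟩
  map {x y} φ := OpG.homMk (F := fiberPseudofunctor D C) (p.map φ)
    (D.desc (p.map φ) (x := ⟨x, rfl⟩) (y := ⟨y, rfl⟩) φ (IsHomLift.map p φ))
  map_id x := toTotal_map_injective D C <|
    (D.lift_desc _ _ (IsHomLift.map p (𝟙 x))).trans ((toTotal D C).map_id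
      ⟨p.obj x, (⟨x, rfl⟩ : p.Fiber (p.obj x))⟩).symm
  map_comp {x y z} φ ψ := toTotal_map_injective D C <|
    (D.lift_desc _ _ (IsHomLift.map p (φ ≫ ψ))).trans <| Eq.symm <|
      ((toTotal D C).map_comp _ _).trans (congrArg₂ (· ≫ ·)
        (D.lift_desc _ _ (IsHomLift.map p φ)) (D.lift_desc _ _ (IsHomLift.map p ψ)))

lemma ofTotal_comp_toTotal : ofTotal D C ⋙ toTotal D C = 𝟭 X :=
  Functor.hext (fun _ => rfl) fun x y φ => heq_of_eq (D.lift_desc _ _ (IsHomLift.map p φ))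

lemma toTotal_comp_ofTotal : toTotal D C ⋙ ofTotal D C = 𝟭 _ := by
  refine Functor.hext (fun a => ?_) fun a b f => ?_
  · obtain ⟨x, rfl⟩ := exists_eq_mk_fiber D C a
    rfl
  · obtain ⟨x, rfl⟩ := exists_eq_mk_fiber D C a
    obtain ⟨y, rfl⟩ := exists_eq_mk_fiber D C b
    exact heq_of_eq (toTotal_map_injective D C (D.lift_desc _ _ (IsHomLift.map p _)))

lemma toTotal_comp : toTotal D C ⋙ p =
    Pseudofunctor.Grothendieck.forget (fiberPseudofunctor D C) := by
  refine Functor.hext (fun a => Subtype.property (p := fun x => p.obj x = a.base) a.fiber)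
    fun a b f => ?_
  obtain ⟨x, rfl⟩ := exists_eq_mk_fiber D C a
  obtain ⟨y, rfl⟩ := exists_eq_mk_fiber D C b
  exact heq_of_eq (toTotal_base D C).symm

end

/-! ### Essential surjectivity and the theorem. -/

section

variable (B : Type u) [Category.{v} B]

open StrictPseudofunctor

/-- Both halves of the bifibration property enter: opcartesian lifts give the left adjoints and
cartesian lifts the right adjoints. -/
lemma forgetToLeft_comp_opGrothendieck_essSurj₂ :
    ((forgetToLeft B).comp (opGrothendieck B)).EssSurj₂ := fun Y => by
  obtain ⟨D⟩ := OpCleavage.nonempty Y.isOpfibered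
  obtain ⟨C⟩ := Cleavage.nonempty Y.isFibered
  exact ⟨biindOfCleavage D C,
    InducedBicategory.mkHom { toFunctor := toTotal D C, w := toTotal_comp D C },
    InducedBicategory.mkHom { toFunctor := ofTotal D C, w := rfl },
    bifib_hom_ext (toTotal_comp_ofTotal D C), bifib_hom_ext (ofTotal_comp_toTotal D C)⟩

end

theorem mainTheorem1 (B : Type u) [Category.{v} B] :
    IsTwoEquivalence (forgetToLeft B) ∧
    IsTwoEquivalence (forgetToRight B) ∧
    IsTwoEquivalence (grothendieck B) ∧
    IsTwoEquivalence (opGrothendieck B) ∧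
    Nonempty (TwoNatIso ((forgetToRight B).comp (grothendieck B))
      ((forgetToLeft B).comp (opGrothendieck B))) ∧
    IsTwoEquivalence ((forgetToRight B).comp (grothendieck B)) := by
  have hU := forgetToLeft_fullyFaithful₂ B
  have hO := opGrothendieck_fullyFaithful₂ B
  have hG := grothendieck_fullyFaithful₂ B
  have hUO := hU.comp hO
  have eUO := forgetToLeft_comp_opGrothendieck_essSurj₂ B
  have hVG := (grothendieckIso B).fullyFaithful₂ hUO
  have eVG := (grothendieckIso B).essSurj₂ eUO
  exact ⟨hU.isTwoEquivalence (eUO.of_comp_of_fullyFaithful hO),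
    -- Both properties of `forgetToRight` come from cancelling `grothendieck` in the composite,
    -- which inherits them through `grothendieckIso`.
    (hG.of_comp hVG).isTwoEquivalence (eVG.of_comp_of_fullyFaithful hG),
    hG.isTwoEquivalence eVG.of_comp, hO.isTwoEquivalence eUO.of_comp, ⟨grothendieckIso B⟩,
    hVG.isTwoEquivalence eVG⟩
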